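/- \textbf{Setting.} Let $(M,g)$ be an oriented closed Riemannian surface with a fixed spin structure, and let $S\to M$ be the associated spinor bundle of real rank four, with its real fibre metric $g_s$, its spin connection $\nabla^s$ and its Clifford multiplication, normalized by $X\cdot Y\cdot s+Y\cdot X\cdot s=-2g(X,Y)s$. Let $(N,h)$ be a compact Riemannian manifold. Let $\phi\colon M\to N$ be a smooth map, $\psi\in\Gamma(S\otimes\phi^*TN)$ a smooth vector spinor and $\chi\in\Gamma(S\otimes TM)$ a smooth gravitino. Write $\widetilde\nabla$ for the connection of $S\otimes\phi^*TN$. Let $(e_\alpha)$ be a local oriented orthonormal frame of $M$ and write $\chi=\chi^\alpha\otimes e_\alpha$; repeated indices are summed. Put $$\slashed D\psi=e_\alpha\cdot\widetilde\nabla_{e_\alpha}\psi,\qquad Q\chi=-\tfrac12 e_\beta\cdot e_\alpha\cdot\chi^\beta\otimes e_\alpha ,$$ and in local coordinates $(y^i)$ of $N$, with $\psi=\psi^i\otimes\phi^*\partial_{y^i}$, $\mathrm{Rm}(\partial_k,\partial_l)\partial_j=R^i{}_{jkl}\partial_i$ and $\mathrm{Rm}(X,Y)=[\nabla_X,\nabla_Y]-\nabla_{[X,Y]}$,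 put $$SR(\psi)=R^i{}_{jkl}\langle\psi^l,\psi^j\rangle\,\psi^k\otimes\phi^*\partial_{y^i},\qquad \mathrm{Rm}(\psi)=\langle SR(\psi),\psi\rangle ,$$ $$\mathrm{Rm}(\psi,e_\alpha\cdot\psi)\phi_*e_\alpha=R^i{}_{jkl}\langle\psi^k,e_\alpha\cdot\psi^l\rangle\,e_\alpha(\phi^j)\,\phi^*\partial_{y^i},\qquad S\nabla R(\psi)=h^{im}(\nabla_m R)_{pqrs}\langle\psi^p,\psi^r\rangle\langle\psi^q,\psi^s\rangle\,\phi^*\partial_{y^i}.$$ Let $\tau(\phi)$ be the tension field of $\phi$. \textbf{Critical triples.} Call $(\phi,\psi,\chi)$ critical if the Euler--Lagrange equations $$\tau(\phi)=\tfrac12\mathrm{Rm}(\psi,e_\alpha\cdot\psi)\phi_*e_\alpha-\tfrac1{12}S\nabla R(\psi)-\big(\langle\nabla^s_{e_\beta}(e_\alpha\cdot e_\beta\cdot\chi^\alpha),\psi\rangle_{g_s}+\langle e_\alpha\cdot e_\beta\cdot\chi^\alpha,\widetilde\nabla_{e_\beta}\psi\rangle_{g_s}\big),$$ $$\slashed D\psi=|Q\chi|^2\psi+\tfrac13SR(\psi)+2(1\otimes\phi_*)Q\chi$$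 hold, where $\nabla^s_{e_\beta}(e_\alpha\cdot e_\beta\cdot\chi^\alpha)$ denotes the divergence of the section $e_\alpha\cdot e_\beta\cdot\chi^\alpha\otimes e_\beta$ of $S\otimes TM$ (the literal expression in a frame with $\nabla e_\beta=0$ at the point), and the supercurrent vanishes: $$J^\alpha=2\langle\phi_*e_\beta,e_\beta\cdot e_\alpha\cdot\psi\rangle_{\phi^*h}+|\psi|^2e_\beta\cdot e_\alpha\cdot\chi^\beta=0\quad\text{for all }\alpha .$$ \textbf{Proposition.} Let $(\phi,\psi,\chi)$ be critical. Then the energy-momentum tensor $T=T_{\alpha\beta}\,e^\alpha\otimes e^\beta$, $$\begin{aligned}T_{\alpha\beta}={}&2\langle\phi_*e_\alpha,\phi_*e_\beta\rangle-|d\phi|^2g_{\alpha\beta}+\tfrac12\langle\psi,e_\alpha\cdot\widetilde\nabla_{e_\beta}\psi+e_\beta\cdot\widetilde\nabla_{e_\alpha}\psi\rangle-\langle\psi,\slashed D\psi\rangle g_{\alpha\beta}\\&+\langle e_\eta\cdot e_\alpha\cdot\chi^\eta\otimes\phi_*e_\beta+e_\eta\cdot e_\beta\cdot\chi^\eta\otimes\phi_*e_\alpha,\psi\rangle+4\langle(1\otimes\phi_*)Q\chi,\psi\rangle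 g_{\alpha\beta}\\&+|Q\chi|^2|\psi|^2g_{\alpha\beta}+\tfrac16\mathrm{Rm}(\psi)g_{\alpha\beta},\end{aligned}$$ can equivalently be written as $$\begin{aligned}T_{\alpha\beta}={}&2\langle\phi_*e_\alpha,\phi_*e_\beta\rangle-|d\phi|^2g_{\alpha\beta}+\langle\psi,e_\alpha\cdot\widetilde\nabla_{e_\beta}\psi\rangle-\tfrac12\langle\psi,\slashed D\psi\rangle g_{\alpha\beta}\\&+2\langle e_\eta\cdot e_\alpha\cdot\chi^\eta\otimes\phi_*e_\beta,\psi\rangle-\langle e_\theta\cdot e_\eta\cdot\chi^\theta\otimes\phi_*e_\eta,\psi\rangle g_{\alpha\beta},\end{aligned}$$ and it is symmetric ($T_{\alpha\beta}=T_{\beta\alpha}$), traceless ($T_{\alpha\alpha}=0$) and covariantly conserved, i.e. divergence-free ($(\nabla_{e_\alpha}T)(e_\alpha,e_\beta)=0$ for all $\beta$). -/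

import Mathlib

open scoped Manifold ContDiff Quaternion TensorProduct

noncomputable section

namespace SigmaModel

/-- A smooth Riemannian metric on an `n`-dimensional smooth manifold `X` (without boundary). -/
abbrev RMetric (n : ℕ) (X : Type*) [TopologicalSpace X]
    [ChartedSpace (EuclideanSpace ℝ (Fin n)) X] [IsManifold (𝓡 n) ∞ X] :=
  Bundle.ContMDiffRiemannianMetric (𝓡 n) ∞ (EuclideanSpace ℝ (Fin n))
    (fun x : X => TangentSpace (𝓡 n) x)

/-! ### Clifford algebra in dimension two

The Clifford algebra with `e₁² = e₂² = -1`, `e₁ e₂ + e₂ e₁ = 0` is the algebra of quaternions, with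
`e₁ = i`, `e₂ = j`, `e₁ e₂ = k`. Its irreducible real module is `ℍ` itself (real rank four) with the
action by left multiplication. The group `Spin(2)` consists of the `cos t + sin t e₁ e₂`. -/

/-- The generators `e₁ = i`, `e₂ = j` of the Clifford algebra. -/
def cliff : Fin 2 → ℍ[ℝ] := ![⟨0, 1, 0, 0⟩, ⟨0, 0, 1, 0⟩]

/-- `Spin(2)` inside the Clifford algebra: the unit vectors in the span of `1` and `e₁ e₂`. -/
def spinTwo : Set ℍ[ℝ] := {q | ‖q‖ = 1 ∧ q.imI = 0 ∧ q.imJ = 0}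

section Target

variable {n : ℕ} {N : Type*} [TopologicalSpace N] [ChartedSpace (EuclideanSpace ℝ (Fin n)) N]
  [IsManifold (𝓡 n) ∞ N]

/-! ### Riemannian geometry of the target in a chart `c`, with coordinates `(yⁱ)` -/

/-- The coordinate vector field `∂/∂yⁱ` at the point with coordinates `y`. -/
def coordVec (c : OpenPartialHomeomorph N (EuclideanSpace ℝ (Fin n))) (i : Fin n)
    (y : EuclideanSpace ℝ (Fin n)) : TangentSpace (𝓡 n) (c.symm y) :=
  mfderiv (𝓡 n) (𝓡 n) c.symm y (EuclideanSpace.single i (1 : ℝ))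

/-- The coordinate covector `dyⁱ` at `q`. -/
def coordCovec (c : OpenPartialHomeomorph N (EuclideanSpace ℝ (Fin n))) (i : Fin n) (q : N) :
    TangentSpace (𝓡 n) q →ₗ[ℝ] ℝ :=
  (EuclideanSpace.proj i : EuclideanSpace ℝ (Fin n) →L[ℝ] ℝ).toLinearMap ∘ₗ
    (mfderiv (𝓡 n) (𝓡 n) c q).toLinearMap

/-- The partial derivative `∂f/∂yᵏ`. -/
def pd (k : Fin n) (f : EuclideanSpace ℝ (Fin n) → ℝ) (y : EuclideanSpace ℝ (Fin n)) : ℝ :=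
  fderiv ℝ f y (EuclideanSpace.single k (1 : ℝ))

variable (h : RMetric n N) (c : OpenPartialHomeomorph N (EuclideanSpace ℝ (Fin n)))

/-- `h_{ij}`. -/
def hLow (i j : Fin n) (y : EuclideanSpace ℝ (Fin n)) : ℝ :=
  h.inner (c.symm y) (coordVec c i y) (coordVec c j y)

/-- `h^{ij}`, the inverse matrix. -/
def hUp (i j : Fin n) (y : EuclideanSpace ℝ (Fin n)) : ℝ :=
  (Matrix.of fun p q => hLow h c p q y)⁻¹ i j

/-- The Christoffel symbol `Γ^k_{ij}` of the Levi-Civita connection of `h`. -/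
def christoffel (k i j : Fin n) (y : EuclideanSpace ℝ (Fin n)) : ℝ :=
  (1 / 2) * ∑ l, hUp h c k l y *
    (pd i (hLow h c j l) y + pd j (hLow h c i l) y - pd l (hLow h c i j) y)

/-- The curvature `R^i_{jkl}`, with `Rm(∂_k, ∂_l) ∂_j = R^i_{jkl} ∂_i` and
`Rm(X, Y) Z = ∇_X ∇_Y Z - ∇_Y ∇_X Z - ∇_{[X, Y]} Z`. -/
def riem (i j k l : Fin n) (y : EuclideanSpace ℝ (Fin n)) : ℝ :=
  pd k (christoffel h c i l j) y - pd l (christoffel h c i k j) y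
    + ∑ m, (christoffel h c i k m y * christoffel h c m l j y
      - christoffel h c i l m y * christoffel h c m k j y)

/-- `R_{ijkl} = h_{im} R^m_{jkl}`. -/
def riemLow (i j k l : Fin n) (y : EuclideanSpace ℝ (Fin n)) : ℝ :=
  ∑ m, hLow h c i m y * riem h c m j k l y

/-- The components `(∇_p R)_{ijkl}` of the covariant derivative of the curvature tensor. -/
def nablaRiem (p i j k l : Fin n) (y : EuclideanSpace ℝ (Fin n)) : ℝ :=
  pd p (riemLow h c i j k l) y
    - ∑ m, (christoffel h c m p i y * riemLow h c m j k l y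
      + christoffel h c m p j y * riemLow h c i m k l y
      + christoffel h c m p k y * riemLow h c i j m l y
      + christoffel h c m p l y * riemLow h c i j k m y)

end Target

section Domain

variable {M : Type*} [TopologicalSpace M] [ChartedSpace (EuclideanSpace ℝ (Fin 2)) M]
  [IsManifold (𝓡 2) ∞ M]

/-- The derivative `v(f)` of a function `f` with values in a normed space along `v ∈ T_xM`. -/
def dir {F : Type*} [NormedAddCommGroup F] [NormedSpace ℝ F] (f : M → F) (x : M)
    (v : TangentSpace (𝓡 2) x) : F :=
  mfderiv (𝓡 2) 𝓘(ℝ, F) f x v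

/-- An orientation and a spin structure on the surface `(M, g)`, given by local sections of the
principal `Spin(2)`-bundle: an open cover `(U a)`, smooth orthonormal frames `(e a 0, e a 1)` over
the `U a` (the positively oriented ones), and smooth `Spin(2)`-valued functions `z a b` which satisfy
the cocycle condition and lift the transition functions of the frames through the double covering
`Spin(2) → SO(2)`, `z ↦ (v ↦ z v z⁻¹)`. (For unit quaternions `z⁻¹ = star z`.) -/
structure SpinStructure (ι : Type*) (g : RMetric 2 M) where
  U : ι → Set M
  isOpen_U : ∀ a, IsOpen (U a)
  cover : ∀ x, ∃ a, x ∈ U a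
  e : ι → Fin 2 → (x : M) → TangentSpace (𝓡 2) x
  smooth_e : ∀ a α, ContMDiffOn (𝓡 2) (𝓡 2).tangent ∞
    (fun x => (⟨x, e a α x⟩ : TangentBundle (𝓡 2) M)) (U a)
  orthonormal : ∀ a, ∀ x ∈ U a, ∀ α β, g.inner x (e a α x) (e a β x) = if α = β then 1 else 0
  z : ι → ι → M → ℍ[ℝ]
  z_mem : ∀ a b, ∀ x ∈ U a ∩ U b, z a b x ∈ spinTwo
  smooth_z : ∀ a b, ContMDiffOn (𝓡 2) 𝓘(ℝ, ℍ[ℝ]) ∞ (z a b) (U a ∩ U b)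
  cocycle : ∀ a b d, ∀ x ∈ U a ∩ U b ∩ U d, z a b x * z b d x = z a d x
  lift : ∀ a b, ∀ x ∈ U a ∩ U b, ∀ α,
    z a b x * cliff α * star (z a b x) = ∑ β, g.inner x (e b α x) (e a β x) • cliff β

variable {ι : Type*} {g : RMetric 2 M} (σ : SpinStructure ι g)

/-- The coefficient `g(∇_{e_α} e_β, e_η)` of the Levi-Civita connection of `g` in the orthonormal
frame `e a` (Koszul formula). -/
def SpinStructure.conn (a : ι) (α β η : Fin 2) (x : M) : ℝ :=
  (1 / 2) *
    (g.inner x (VectorField.mlieBracket (𝓡 2) (σ.e a α) (σ.e a β) x) (σ.e a η x)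
      - g.inner x (VectorField.mlieBracket (𝓡 2) (σ.e a α) (σ.e a η) x) (σ.e a β x)
      - g.inner x (VectorField.mlieBracket (𝓡 2) (σ.e a β) (σ.e a η) x) (σ.e a α x))

/-- The connection term `(1/4) g(∇_{e_α} e_β, e_η) e_β · e_η · s` of the spin connection. -/
def SpinStructure.spinTerm (a : ι) (α : Fin 2) (x : M) (s : ℍ[ℝ]) : ℍ[ℝ] :=
  (1 / 4 : ℝ) • ∑ β, ∑ η, σ.conn a α β η x • (cliff β * cliff η * s)

/-- The spin connection `∇^s_{e_α} s` of a spinor that is given by `s` in the spin frame `a`. -/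
def SpinStructure.nablaS (a : ι) (α : Fin 2) (s : M → ℍ[ℝ]) (x : M) : ℍ[ℝ] :=
  dir s x (σ.e a α x) + σ.spinTerm a α x (s x)

/-- A gravitino: a smooth section of `S ⊗ TM`, where `S` is the spinor bundle, i.e. the bundle
with fibre `ℍ` associated to the spin structure. A section is given by its values in the spin
frames, which transform by the cocycle `z` acting on the spinor factor. -/
structure Gravitino where
  val : ι → (x : M) → ℍ[ℝ] ⊗[ℝ] TangentSpace (𝓡 2) x
  transition : ∀ a b, ∀ x ∈ σ.U a ∩ σ.U b,
    val a x = LinearMap.rTensor _ (LinearMap.mulLeft ℝ (σ.z a b x)) (val b x)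
  smooth : ∀ a α, ContMDiffOn (𝓡 2) 𝓘(ℝ, ℍ[ℝ]) ∞
    (fun x => TensorProduct.rid ℝ ℍ[ℝ]
      (LinearMap.lTensor ℍ[ℝ] (g.inner x (σ.e a α x)).toLinearMap (val a x))) (σ.U a)

variable {n : ℕ} {N : Type*} [TopologicalSpace N] [ChartedSpace (EuclideanSpace ℝ (Fin n)) N]
  [IsManifold (𝓡 n) ∞ N]

/-- A vector spinor along `φ`: a smooth section of `S ⊗ φ^*TN`. -/
structure VectorSpinor (φ : M → N) where
  val : ι → (x : M) → ℍ[ℝ] ⊗[ℝ] TangentSpace (𝓡 n) (φ x)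
  transition : ∀ a b, ∀ x ∈ σ.U a ∩ σ.U b,
    val a x = LinearMap.rTensor _ (LinearMap.mulLeft ℝ (σ.z a b x)) (val b x)
  smooth : ∀ a, ∀ c ∈ IsManifold.maximalAtlas (𝓡 n) ∞ N, ∀ i,
    ContMDiffOn (𝓡 2) 𝓘(ℝ, ℍ[ℝ]) ∞
      (fun x => TensorProduct.rid ℝ ℍ[ℝ]
        (LinearMap.lTensor ℍ[ℝ] (coordCovec c i (φ x)) (val a x)))
      (σ.U a ∩ φ ⁻¹' c.source)

/-- The fields `(φ, ψ, χ)` of the model with domain `(M, g)` and target `(N, h)`. -/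
structure Fields (h : RMetric n N) where
  φ : M → N
  smooth_φ : ContMDiff (𝓡 2) (𝓡 n) ∞ φ
  ψ : VectorSpinor (n := n) σ φ
  χ : Gravitino σ

end Domain

namespace Fields

variable {M : Type*} [TopologicalSpace M] [ChartedSpace (EuclideanSpace ℝ (Fin 2)) M]
  [IsManifold (𝓡 2) ∞ M] {ι : Type*} {g : RMetric 2 M} {σ : SpinStructure ι g}
  {n : ℕ} {N : Type*} [TopologicalSpace N] [ChartedSpace (EuclideanSpace ℝ (Fin n)) N]
  [IsManifold (𝓡 n) ∞ N] {h : RMetric n N}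

/-! ### Local expressions in the spin frame `a` and the chart `c` of the target

They are meaningful at the points `x ∈ U a` with `φ x ∈ c.source`. Greek indices refer to the
orthonormal frame `e a`, in which `g_{αβ} = δ_{αβ}`, Latin indices to the coordinates `(yⁱ)`. -/

variable (F : Fields σ h) (a : ι) (c : OpenPartialHomeomorph N (EuclideanSpace ℝ (Fin n)))

/-- The coordinates `y(φ(x))`. -/
def yφ (x : M) : EuclideanSpace ℝ (Fin n) := c (F.φ x)

/-- `χ^α`, where `χ = χ^α ⊗ e_α`. -/
def chi (α : Fin 2) (x : M) : ℍ[ℝ] :=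
  TensorProduct.rid ℝ ℍ[ℝ]
    (LinearMap.lTensor ℍ[ℝ] (g.inner x (σ.e a α x)).toLinearMap (F.χ.val a x))

/-- `ψ^i`, where `ψ = ψ^i ⊗ φ^*(∂/∂yⁱ)`. -/
def psi (i : Fin n) (x : M) : ℍ[ℝ] :=
  TensorProduct.rid ℝ ℍ[ℝ] (LinearMap.lTensor ℍ[ℝ] (coordCovec c i (F.φ x)) (F.ψ.val a x))

/-- `e_α(φ^i)`, the components of `φ_* e_α`. -/
def dphi (α : Fin 2) (i : Fin n) (x : M) : ℝ := dir (fun p => F.yφ c p i) x (σ.e a α x)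

/-- The inner product `g_s ⊗ φ^*h` of vector spinors at `x`, in components. -/
def pair (x : M) (s t : Fin n → ℍ[ℝ]) : ℝ :=
  ∑ i, ∑ j, hLow h c i j (F.yφ c x) * inner ℝ (s i) (t j)

/-- The spinor `⟨φ_* e_α, t⟩_{φ^*h}` for a vector spinor `t` at `x`. -/
def contract (α : Fin 2) (x : M) (t : Fin n → ℍ[ℝ]) : ℍ[ℝ] :=
  ∑ i, ∑ j, (hLow h c i j (F.yφ c x) * F.dphi a c α i x) • t j

/-- `s ⊗ φ_* e_α` for a spinor `s` at `x`. -/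
def tensorDphi (s : ℍ[ℝ]) (α : Fin 2) (x : M) (i : Fin n) : ℍ[ℝ] := F.dphi a c α i x • s

/-- `⟨φ_* e_α, φ_* e_β⟩_{φ^*h}`. -/
def dphiInner (α β : Fin 2) (x : M) : ℝ :=
  ∑ i, ∑ j, hLow h c i j (F.yφ c x) * (F.dphi a c α i x * F.dphi a c β j x)

/-- `|dφ|²`. -/
def dphiSq (x : M) : ℝ := ∑ α, F.dphiInner a c α α x

/-- `|ψ|²`. -/
def psiSq (x : M) : ℝ :=
  F.pair c x (fun i => F.psi a c i x) (fun i => F.psi a c i x)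

/-- `∇̃_{e_α} ψ`, the connection of `S ⊗ φ^*TN`. -/
def nablaPsi (α : Fin 2) (i : Fin n) (x : M) : ℍ[ℝ] :=
  σ.nablaS a α (F.psi a c i) x
    + ∑ j, ∑ k, (christoffel h c i j k (F.yφ c x) * F.dphi a c α j x) • F.psi a c k x

/-- The twisted Dirac operator `D̸ψ = e_α · ∇̃_{e_α} ψ`. -/
def dirac (i : Fin n) (x : M) : ℍ[ℝ] := ∑ α, cliff α * F.nablaPsi a c α i x

/-- `e_α · e_β · χ^α`. -/
def xi (β : Fin 2) (x : M) : ℍ[ℝ] := ∑ α, cliff α * cliff β * F.chi a α x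

/-- `Qχ = -(1/2) e_β · e_α · χ^β ⊗ e_α`. -/
def qchi (α : Fin 2) (x : M) : ℍ[ℝ] := -(1 / 2 : ℝ) • ∑ β, cliff β * cliff α * F.chi a β x

/-- `|Qχ|²`. -/
def qchiSq (x : M) : ℝ := ∑ α, inner ℝ (F.qchi a α x) (F.qchi a α x)

/-- `(1 ⊗ φ_*) Qχ`. -/
def qchiPush (i : Fin n) (x : M) : ℍ[ℝ] := ∑ α, F.tensorDphi a c (F.qchi a α x) α x i

/-- `SR(ψ)`. -/
def SR (i : Fin n) (x : M) : ℍ[ℝ] :=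
  ∑ j, ∑ k, ∑ l, (riem h c i j k l (F.yφ c x) *
    inner ℝ (F.psi a c l x) (F.psi a c j x)) • F.psi a c k x

/-- `Rm(ψ) = ⟨SR(ψ), ψ⟩`. -/
def RmPsi (x : M) : ℝ := F.pair c x (fun i => F.SR a c i x) (fun i => F.psi a c i x)

/-- `Rm(ψ, e_α · ψ) φ_* e_α`. -/
def RmDphi (i : Fin n) (x : M) : ℝ :=
  ∑ α, ∑ j, ∑ k, ∑ l, riem h c i j k l (F.yφ c x) *
    inner ℝ (F.psi a c k x) (cliff α * F.psi a c l x) * F.dphi a c α j x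

/-- `S∇R(ψ) = φ^*(∇R)_{pqrs} ⟨ψ^p, ψ^r⟩ ⟨ψ^q, ψ^s⟩`, a section of `φ^*TN`, where the index of the
covariant derivative is raised by `h`. -/
def SNablaR (i : Fin n) (x : M) : ℝ :=
  ∑ m, hUp h c i m (F.yφ c x) * ∑ p, ∑ q, ∑ r, ∑ s, nablaRiem h c m p q r s (F.yφ c x) *
    (inner ℝ (F.psi a c p x) (F.psi a c r x) * inner ℝ (F.psi a c q x) (F.psi a c s x))

/-- The tension field `τ(φ) = tr_g ∇dφ`. -/
def tension (i : Fin n) (x : M) : ℝ :=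
  ∑ α, (dir (F.dphi a c α i) x (σ.e a α x) - ∑ η, σ.conn a α α η x * F.dphi a c η i x
    + ∑ j, ∑ k, christoffel h c i j k (F.yφ c x) * F.dphi a c α j x * F.dphi a c α k x)

/-- `∇^s_{e_β}(e_α · e_β · χ^α)`, i.e. the trace of the covariant derivative of the section
`e_α · e_β · χ^α ⊗ e_β` of `S ⊗ TM`; the second term vanishes if `∇ e_β = 0` at `x`. -/
def divXi (x : M) : ℍ[ℝ] :=
  ∑ β, (σ.nablaS a β (F.xi a β) x + ∑ η, σ.conn a β η β x • F.xi a η x)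

/-- The Euler-Lagrange equations for `φ` and `ψ`. -/
def EulerLagrange (F : Fields σ h) : Prop :=
  ∀ a, ∀ c ∈ IsManifold.maximalAtlas (𝓡 n) ∞ N, ∀ x ∈ σ.U a, F.φ x ∈ c.source → ∀ i,
    F.tension a c i x = (1 / 2) * F.RmDphi a c i x - (1 / 12) * F.SNablaR a c i x
        - (inner ℝ (F.divXi a x) (F.psi a c i x)
          + ∑ β, inner ℝ (F.xi a β x) (F.nablaPsi a c β i x)) ∧
    F.dirac a c i x = F.qchiSq a x • F.psi a c i x + (1 / 3 : ℝ) • F.SR a c i x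
        + (2 : ℝ) • F.qchiPush a c i x

/-- The component `J^α` of the supercurrent `J = J^α ⊗ e_α`. -/
def supercurrent (α : Fin 2) (x : M) : ℍ[ℝ] :=
  ∑ β, ((2 : ℝ) • F.contract a c β x (fun i => cliff β * cliff α * F.psi a c i x)
    + F.psiSq a c x • (cliff β * cliff α * F.chi a β x))

/-- `(φ, ψ, χ)` is critical: the Euler-Lagrange equations hold and the supercurrent vanishes. -/
def IsCritical (F : Fields σ h) : Prop :=
  F.EulerLagrange ∧
  ∀ a, ∀ c ∈ IsManifold.maximalAtlas (𝓡 n) ∞ N, ∀ x ∈ σ.U a, F.φ x ∈ c.source → ∀ α,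
    F.supercurrent a c α x = 0

/-- The components `T_{αβ}` of the energy-momentum tensor `T = T_{αβ} e^α ⊗ e^β`. -/
def T (α β : Fin 2) (x : M) : ℝ :=
  let ψ : Fin n → ℍ[ℝ] := fun i => F.psi a c i x
  let δ : ℝ := if α = β then 1 else 0
  2 * F.dphiInner a c α β x - F.dphiSq a c x * δ
    + (1 / 2) * F.pair c x ψ
      (fun i => cliff α * F.nablaPsi a c β i x + cliff β * F.nablaPsi a c α i x)
    - F.pair c x ψ (fun i => F.dirac a c i x) * δ
    + F.pair c x (fun i => F.tensorDphi a c (∑ η, cliff η * cliff α * F.chi a η x) β x i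
        + F.tensorDphi a c (∑ η, cliff η * cliff β * F.chi a η x) α x i) ψ
    + 4 * F.pair c x (fun i => F.qchiPush a c i x) ψ * δ
    + F.qchiSq a x * F.psiSq a c x * δ
    + (1 / 6) * F.RmPsi a c x * δ

/-- The second form of the components of the energy-momentum tensor (along critical fields). -/
def T₂ (α β : Fin 2) (x : M) : ℝ :=
  let ψ : Fin n → ℍ[ℝ] := fun i => F.psi a c i x
  let δ : ℝ := if α = β then 1 else 0
  2 * F.dphiInner a c α β x - F.dphiSq a c x * δ
    + F.pair c x ψ (fun i => cliff α * F.nablaPsi a c β i x)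
    - (1 / 2) * F.pair c x ψ (fun i => F.dirac a c i x) * δ
    + 2 * F.pair c x
        (fun i => F.tensorDphi a c (∑ η, cliff η * cliff α * F.chi a η x) β x i) ψ
    - F.pair c x (fun i =>
        ∑ η, F.tensorDphi a c (∑ θ, cliff θ * cliff η * F.chi a θ x) η x i) ψ * δ

/-- The divergence `(∇_{e_α} T)(e_α, e_β)`, summed over `α`, where
`(∇_{e_α} T)(e_α, e_β) = e_α(T_{αβ}) - T(∇_{e_α} e_α, e_β) - T(e_α, ∇_{e_α} e_β)`. -/
def divT (β : Fin 2) (x : M) : ℝ :=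
  ∑ α, (dir (F.T a c α β) x (σ.e a α x)
    - ∑ η, σ.conn a α α η x * F.T a c η β x - ∑ η, σ.conn a α β η x * F.T a c α η x)

end Fields

end SigmaModel

end

open scoped Manifold ContDiff Quaternion TensorProduct Topology

noncomputable section

namespace SigmaModel

/-! ### Directional derivatives and smoothness of functions and fields on the surface. -/

section Calculus

variable {M : Type*} [TopologicalSpace M] [ChartedSpace (EuclideanSpace ℝ (Fin 2)) M]
  {F G K : Type*} [NormedAddCommGroup F] [NormedSpace ℝ F]
  [NormedAddCommGroup G] [NormedSpace ℝ G] [NormedAddCommGroup K] [NormedSpace ℝ K]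

/-! ### Directional derivatives on the surface -/

/-! The claim is local, so everything is computed in one spin frame and one target chart. Write
K_{αβ} = ⟨φ_*e_α, φ_*e_β⟩, W_{αβ} = ⟨ψ, e_α·∇_βψ⟩, Z_{αβ} = ⟨(Qχ)^α ⊗ φ_*e_β, ψ⟩ and ω = e_0·e_1.

Algebra. Qχ is γ-traceless, and J = 0 tested against any γ-traceless P gives |ψ|²⟨Qχ, P⟩ = -2 Σ ⟨P^β
⊗ φ_*e_β, ψ⟩ (`psiSq_mul_inner_qchi`). Taking P = Qχ yields |ψ|²|Qχ|² = -2 tr Z, and P = ωQχ yields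
Z_{01} = Z_{10}. The Dirac equation paired with ψ gives tr W = Rm(ψ)/3 (`sum_tensorW`); paired with
ωψ it gives W_{01} = W_{10} (`tensorW_comm`), because ⟨SR(ψ), ωψ⟩ = 0. Hence both forms of T equal
2K + W - 4Z + (2 tr Z - |dφ|² - Rm(ψ)/6)g, which is `criticalT`; symmetry and vanishing trace can be
read off.

Divergence. All connections are metric, Clifford multiplication is parallel and ∇dφ is symmetric. So
div(2K) - d|dφ|² = 2⟨τ(φ), φ_*e_β⟩, and the equation for φ replaces τ(φ). In div W the second
derivatives of ψ are commuted (`sum_pair_hessψ`): the spin curvature is a multiple of ω and drops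
out, the curvature of φ^*TN contributes minus the term Rm(ψ, e_α·ψ)φ_*e_α of the equation for φ, and
what remains is d(tr W) - 2⟨Dψ, ∇_βψ⟩, evaluated by tr W = Rm(ψ)/3 and the Dirac equation.

The quartic terms cancel by d Rm(ψ) = (∇Rm)(ψ) + 4⟨SR(ψ), ∇ψ⟩ (`dir_RmPsi`), which rests on the
curvature symmetries of N. The gravitino terms cancel by the derivative of |ψ|²|Qχ|² = -2 tr Z
combined with J = 0 tested against P = ∇_βQχ (`dir_sum_tensorZ_eq`). -/

lemma dir_const (b : F) (x : M) (v : TangentSpace (𝓡 2) x) : dir (fun _ : M => b) x v = 0 := by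
  simp only [dir, mfderiv_const]
  rfl

lemma dir_congr {f f' : M → F} {x : M} (v : TangentSpace (𝓡 2) x) (hf : f =ᶠ[𝓝 x] f') :
    dir f x v = dir f' x v := by
  have := hf.mfderiv_eq (I := 𝓡 2) (I' := 𝓘(ℝ, F))
  simp only [dir, this]
  rfl

lemma dir_comp_fderiv {Φ : F → G} {f : M → F} {x : M} (v : TangentSpace (𝓡 2) x)
    (hΦ : DifferentiableAt ℝ Φ (f x)) (hf : MDifferentiableAt (𝓡 2) 𝓘(ℝ, F) f x) :
    dir (fun p => Φ (f p)) x v = fderiv ℝ Φ (f x) (dir f x v) := by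
  have := (hΦ.hasFDerivAt.hasMFDerivAt.comp x hf.hasMFDerivAt).mfderiv
  simp only [dir]
  change mfderiv (𝓡 2) 𝓘(ℝ, G) (Φ ∘ f) x v = _
  rw [this]; rfl

lemma dir_clm (L : F →L[ℝ] G) {f : M → F} {x : M} (v : TangentSpace (𝓡 2) x)
    (hf : MDifferentiableAt (𝓡 2) 𝓘(ℝ, F) f x) :
    dir (fun p => L (f p)) x v = L (dir f x v) := by
  rw [dir_comp_fderiv v L.differentiableAt hf, L.fderiv]

lemma hasMFDerivAt_prodMk {f : M → F} {f' : M → G} {x : M}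
    (hf : MDifferentiableAt (𝓡 2) 𝓘(ℝ, F) f x) (hf' : MDifferentiableAt (𝓡 2) 𝓘(ℝ, G) f' x) :
    HasMFDerivAt (𝓡 2) 𝓘(ℝ, F × G) (fun p => (f p, f' p)) x
      ((mfderiv (𝓡 2) 𝓘(ℝ, F) f x : EuclideanSpace ℝ (Fin 2) →L[ℝ] F).prod
        (mfderiv (𝓡 2) 𝓘(ℝ, G) f' x : EuclideanSpace ℝ (Fin 2) →L[ℝ] G)) :=
  ⟨hf.hasMFDerivAt.1.prodMk hf'.hasMFDerivAt.1, hf.hasMFDerivAt.2.prodMk hf'.hasMFDerivAt.2⟩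

lemma dir_bilin (B : F →L[ℝ] G →L[ℝ] K) {f : M → F} {f' : M → G} {x : M}
    (v : TangentSpace (𝓡 2) x)
    (hf : MDifferentiableAt (𝓡 2) 𝓘(ℝ, F) f x) (hf' : MDifferentiableAt (𝓡 2) 𝓘(ℝ, G) f' x) :
    dir (fun p => B (f p) (f' p)) x v = B (dir f x v) (f' x) + B (f x) (dir f' x v) := by
  have h1 := hasMFDerivAt_prodMk hf hf'
  have h2 := (B.hasFDerivAt_of_bilinear (hasFDerivAt_fst (p := (f x, f' x)))
    (hasFDerivAt_snd (p := (f x, f' x)))).hasMFDerivAt.comp x h1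
  have := h2.mfderiv
  simp only [dir]
  change mfderiv (𝓡 2) 𝓘(ℝ, K) ((fun y : F × G => B y.1 y.2) ∘ fun p => (f p, f' p)) x v = _
  rw [this, add_comm]; rfl

lemma dir_add {f f' : M → F} {x : M} (v : TangentSpace (𝓡 2) x)
    (hf : MDifferentiableAt (𝓡 2) 𝓘(ℝ, F) f x) (hf' : MDifferentiableAt (𝓡 2) 𝓘(ℝ, F) f' x) :
    dir (fun p => f p + f' p) x v = dir f x v + dir f' x v := by
  have := (hf.hasMFDerivAt.add hf'.hasMFDerivAt).mfderiv
  simp only [dir]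
  change mfderiv (𝓡 2) 𝓘(ℝ, F) (f + f') x v = _
  rw [this]; rfl

lemma dir_sub {f f' : M → F} {x : M} (v : TangentSpace (𝓡 2) x)
    (hf : MDifferentiableAt (𝓡 2) 𝓘(ℝ, F) f x) (hf' : MDifferentiableAt (𝓡 2) 𝓘(ℝ, F) f' x) :
    dir (fun p => f p - f' p) x v = dir f x v - dir f' x v := by
  have := (hf.hasMFDerivAt.sub hf'.hasMFDerivAt).mfderiv
  simp only [dir]
  change mfderiv (𝓡 2) 𝓘(ℝ, F) (f - f') x v = _
  rw [this]; rfl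

lemma mdifferentiableAt_sum {κ : Type*} (s : Finset κ) {f : κ → M → F} {x : M}
    (hf : ∀ i, MDifferentiableAt (𝓡 2) 𝓘(ℝ, F) (f i) x) :
    MDifferentiableAt (𝓡 2) 𝓘(ℝ, F) (fun p => ∑ i ∈ s, f i p) x := by
  classical
  induction s using Finset.induction_on with
  | empty => simpa using mdifferentiableAt_const
  | insert i s hi ih =>
    simp only [Finset.sum_insert hi]
    exact (hf i).add ih

lemma dir_sum {κ : Type*} (s : Finset κ) {f : κ → M → F} {x : M} (v : TangentSpace (𝓡 2) x)
    (hf : ∀ i, MDifferentiableAt (𝓡 2) 𝓘(ℝ, F) (f i) x) :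
    dir (fun p => ∑ i ∈ s, f i p) x v = ∑ i ∈ s, dir (f i) x v := by
  classical
  induction s using Finset.induction_on with
  | empty => simpa using dir_const (0 : F) x v
  | insert i s hi ih =>
    simp only [Finset.sum_insert hi]
    rw [dir_add v (hf i) (mdifferentiableAt_sum s hf), ih]

lemma dir_mul {f f' : M → ℝ} {x : M} (v : TangentSpace (𝓡 2) x)
    (hf : MDifferentiableAt (𝓡 2) 𝓘(ℝ, ℝ) f x) (hf' : MDifferentiableAt (𝓡 2) 𝓘(ℝ, ℝ) f' x) :
    dir (fun p => f p * f' p) x v = dir f x v * f' x + f x * dir f' x v :=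
  dir_bilin (ContinuousLinearMap.mul ℝ ℝ) v hf hf'

lemma dir_const_mul (b : ℝ) {f : M → ℝ} {x : M} (v : TangentSpace (𝓡 2) x)
    (hf : MDifferentiableAt (𝓡 2) 𝓘(ℝ, ℝ) f x) :
    dir (fun p => b * f p) x v = b * dir f x v :=
  dir_clm (ContinuousLinearMap.mul ℝ ℝ b) v hf

lemma dir_smul {f : M → ℝ} {f' : M → F} {x : M} (v : TangentSpace (𝓡 2) x)
    (hf : MDifferentiableAt (𝓡 2) 𝓘(ℝ, ℝ) f x) (hf' : MDifferentiableAt (𝓡 2) 𝓘(ℝ, F) f' x) :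
    dir (fun p => f p • f' p) x v = dir f x v • f' x + f x • dir f' x v :=
  dir_bilin (ContinuousLinearMap.lsmul ℝ ℝ) v hf hf'

lemma dir_cliff_mul (q : ℍ[ℝ]) {f : M → ℍ[ℝ]} {x : M} (v : TangentSpace (𝓡 2) x)
    (hf : MDifferentiableAt (𝓡 2) 𝓘(ℝ, ℍ[ℝ]) f x) :
    dir (fun p => q * f p) x v = q * dir f x v :=
  dir_clm (ContinuousLinearMap.mul ℝ ℍ[ℝ] q) v hf

lemma dir_inner {f f' : M → ℍ[ℝ]} {x : M} (v : TangentSpace (𝓡 2) x)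
    (hf : MDifferentiableAt (𝓡 2) 𝓘(ℝ, ℍ[ℝ]) f x)
    (hf' : MDifferentiableAt (𝓡 2) 𝓘(ℝ, ℍ[ℝ]) f' x) :
    dir (fun p => (inner ℝ (f p) (f' p) : ℝ)) x v
      = inner ℝ (dir f x v) (f' x) + inner ℝ (f x) (dir f' x v) :=
  dir_bilin (innerSL ℝ (E := ℍ[ℝ])) v hf hf'

/-! ### Smooth functions on open sets -/

/-- Smoothness on a set of a function with values in a normed space. -/
abbrev SmoothOn (Ω : Set M) (f : M → F) : Prop := ContMDiffOn (𝓡 2) 𝓘(ℝ, F) ∞ f Ω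

variable {Ω : Set M}

lemma SmoothOn.mdiff {f : M → F} (hf : SmoothOn Ω f) (hΩ : IsOpen Ω) {x : M} (hx : x ∈ Ω) :
    MDifferentiableAt (𝓡 2) 𝓘(ℝ, F) f x :=
  (hf.contMDiffAt (hΩ.mem_nhds hx)).mdifferentiableAt (by simp)

lemma SmoothOn.bilin (B : F →L[ℝ] G →L[ℝ] K) {f : M → F} {f' : M → G} (hf : SmoothOn Ω f)
    (hf' : SmoothOn Ω f') : SmoothOn Ω (fun p => B (f p) (f' p)) :=
  ContMDiffOn.clm_apply (B.contMDiff.comp_contMDiffOn hf) hf'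

lemma SmoothOn.sum {κ : Type*} (s : Finset κ) {f : κ → M → F} (hf : ∀ i, SmoothOn Ω (f i)) :
    SmoothOn Ω (fun p => ∑ i ∈ s, f i p) := by
  classical
  induction s using Finset.induction_on with
  | empty => simpa using contMDiffOn_const
  | insert i s hi ih =>
    simp only [Finset.sum_insert hi]
    exact (hf i).add ih

lemma SmoothOn.fun_add {f f' : M → F} (hf : SmoothOn Ω f) (hf' : SmoothOn Ω f') :
    SmoothOn Ω (fun p => f p + f' p) := ContMDiffOn.add hf hf'

lemma SmoothOn.fun_sub {f f' : M → F} (hf : SmoothOn Ω f) (hf' : SmoothOn Ω f') :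
    SmoothOn Ω (fun p => f p - f' p) := ContMDiffOn.sub hf hf'

lemma SmoothOn.mul {f f' : M → ℝ} (hf : SmoothOn Ω f) (hf' : SmoothOn Ω f') :
    SmoothOn Ω (fun p => f p * f' p) :=
  SmoothOn.bilin (ContinuousLinearMap.mul ℝ ℝ) hf hf'

lemma SmoothOn.smul {f : M → ℝ} {f' : M → F} (hf : SmoothOn Ω f) (hf' : SmoothOn Ω f') :
    SmoothOn Ω (fun p => f p • f' p) :=
  SmoothOn.bilin (ContinuousLinearMap.lsmul ℝ ℝ) hf hf'

lemma SmoothOn.cliff_mul (q : ℍ[ℝ]) {f : M → ℍ[ℝ]} (hf : SmoothOn Ω f) :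
    SmoothOn Ω (fun p => q * f p) :=
  SmoothOn.bilin (ContinuousLinearMap.mul ℝ ℍ[ℝ]) contMDiffOn_const hf

lemma SmoothOn.inner {f f' : M → ℍ[ℝ]} (hf : SmoothOn Ω f) (hf' : SmoothOn Ω f') :
    SmoothOn Ω (fun p => (inner ℝ (f p) (f' p) : ℝ)) :=
  SmoothOn.bilin (innerSL ℝ (E := ℍ[ℝ])) hf hf'

/-- Smoothness of a vector field on a set. -/
abbrev SmoothFieldOn [IsManifold (𝓡 2) ∞ M] (Ω : Set M) (V : (x : M) → TangentSpace (𝓡 2) x) :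
    Prop :=
  ContMDiffOn (𝓡 2) (𝓡 2).tangent ∞ (fun x => (⟨x, V x⟩ : TangentBundle (𝓡 2) M)) Ω

variable [IsManifold (𝓡 2) ∞ M]

/-- The derivative is the fibre component of the tangent map of `f` composed with the section `V`,
and both are smooth. -/
lemma SmoothOn.dir {f : M → F} (hf : SmoothOn Ω f) (hΩ : IsOpen Ω)
    {V : (x : M) → TangentSpace (𝓡 2) x} (hV : SmoothFieldOn Ω V) :
    SmoothOn Ω (fun p => dir f p (V p)) := by
  have h1 := hf.contMDiffOn_tangentMapWithin (m := ∞) (by simp) hΩ.uniqueMDiffOn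
  have h2 := h1.comp hV (fun x hx => hx)
  have h3 := (contMDiff_snd_tangentBundle_modelSpace F 𝓘(ℝ, F) (n := ∞)).comp_contMDiffOn h2
  refine h3.congr fun x hx => ?_
  change mfderiv (𝓡 2) 𝓘(ℝ, F) f x (V x) = mfderivWithin (𝓡 2) 𝓘(ℝ, F) f Ω x (V x)
  rw [mfderivWithin_of_isOpen hΩ hx]

lemma SmoothFieldOn.mdiff {V : (x : M) → TangentSpace (𝓡 2) x} (hV : SmoothFieldOn Ω V)
    (hΩ : IsOpen Ω) {x : M} (hx : x ∈ Ω) : MDifferentiableAt (𝓡 2) (𝓡 2).tangent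
      (fun x => (⟨x, V x⟩ : TangentBundle (𝓡 2) M)) x :=
  (hV.contMDiffAt (hΩ.mem_nhds hx)).mdifferentiableAt (by simp)

lemma SmoothFieldOn.mlieBracket {V W : (x : M) → TangentSpace (𝓡 2) x} (hV : SmoothFieldOn Ω V)
    (hW : SmoothFieldOn Ω W) (hΩ : IsOpen Ω) :
    SmoothFieldOn Ω (VectorField.mlieBracket (𝓡 2) V W) := fun x hx => by
  have : IsManifold (𝓡 2) ((⊤ : ℕ∞) + 1) M := by
    simpa using (inferInstance : IsManifold (𝓡 2) ∞ M)
  have : IsManifold (𝓡 2) (minSmoothness ℝ 2) M := by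
    simpa using (inferInstance : IsManifold (𝓡 2) 2 M)
  refine (ContMDiffAt.mlieBracket_vectorField (m := ⊤) (n := ⊤) (hV.contMDiffAt (hΩ.mem_nhds hx))
    (hW.contMDiffAt (hΩ.mem_nhds hx)) (by simp)).contMDiffWithinAt

lemma SmoothFieldOn.metric (g : RMetric 2 M) {V W : (x : M) → TangentSpace (𝓡 2) x}
    (hV : SmoothFieldOn Ω V) (hW : SmoothFieldOn Ω W) :
    SmoothOn Ω (fun x => g.inner x (V x) (W x)) := fun x hx => by
  have := ContMDiffWithinAt.clm_bundle_apply₂ (F₁ := EuclideanSpace ℝ (Fin 2))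
    (F₂ := EuclideanSpace ℝ (Fin 2)) (F₃ := ℝ) (E₃ := Bundle.Trivial M ℝ)
    (g.contMDiff.contMDiffAt.contMDiffWithinAt (s := Ω)) (hV x hx) (hW x hx)
  simp only [Bundle.contMDiffWithinAt_totalSpace] at this
  exact this.2

end Calculus

/-! ### The Lie bracket as the commutator of derivations. -/

section Bracket

variable {M : Type*} [TopologicalSpace M] [ChartedSpace (EuclideanSpace ℝ (Fin 2)) M]
  [IsManifold (𝓡 2) ∞ M] {F : Type*} [NormedAddCommGroup F] [NormedSpace ℝ F]

lemma dir_eq_fderiv_chart {x p : M} (hp : p ∈ (extChartAt (𝓡 2) x).source) {f : M → F}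
    (hf : MDifferentiableAt (𝓡 2) 𝓘(ℝ, F) f p) (v : TangentSpace (𝓡 2) p) :
    dir f p v = fderiv ℝ (f ∘ (extChartAt (𝓡 2) x).symm) (extChartAt (𝓡 2) x p)
      (mfderiv (𝓡 2) 𝓘(ℝ, EuclideanSpace ℝ (Fin 2)) (extChartAt (𝓡 2) x) p v) := by
  have h1 : MDifferentiableAt (𝓡 2) 𝓘(ℝ, EuclideanSpace ℝ (Fin 2)) (extChartAt (𝓡 2) x) p :=
    mdifferentiableAt_extChartAt (by simpa using hp)
  have hinv := (extChartAt (𝓡 2) x).left_inv hp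
  have h2 : MDifferentiableAt 𝓘(ℝ, EuclideanSpace ℝ (Fin 2)) (𝓡 2) (extChartAt (𝓡 2) x).symm
      (extChartAt (𝓡 2) x p) := by
    have := mdifferentiableWithinAt_extChartAt_symm (I := 𝓡 2) ((extChartAt (𝓡 2) x).map_source hp)
    simpa [mdifferentiableWithinAt_univ] using this
  have h3 : MDifferentiableAt 𝓘(ℝ, EuclideanSpace ℝ (Fin 2)) 𝓘(ℝ, F)
      (f ∘ (extChartAt (𝓡 2) x).symm) (extChartAt (𝓡 2) x p) :=
    MDifferentiableAt.comp _ (by rwa [hinv]) h2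
  have h4 := (h3.hasMFDerivAt.comp p h1.hasMFDerivAt).mfderiv
  have h5 : (f ∘ (extChartAt (𝓡 2) x).symm) ∘ (extChartAt (𝓡 2) x) =ᶠ[𝓝 p] f := by
    filter_upwards [(isOpen_extChartAt_source x).mem_nhds hp] with q hq
    simp only [Function.comp_apply, (extChartAt (𝓡 2) x).left_inv hq]
  calc dir f p v = dir ((f ∘ (extChartAt (𝓡 2) x).symm) ∘ (extChartAt (𝓡 2) x)) p v :=
        dir_congr v h5.symm
    _ = _ := by
      change mfderiv (𝓡 2) 𝓘(ℝ, F) _ p v = _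
      rw [h4, ← mfderiv_eq_fderiv]
      rfl

/-- The coordinate expression of a vector field in the preferred chart at `x`. -/
abbrev chartField (x : M) (V : (x : M) → TangentSpace (𝓡 2) x) :
    EuclideanSpace ℝ (Fin 2) → EuclideanSpace ℝ (Fin 2) :=
  VectorField.mpullbackWithin 𝓘(ℝ, EuclideanSpace ℝ (Fin 2)) (𝓡 2) (extChartAt (𝓡 2) x).symm V
      (Set.range (𝓡 2))

/-- Identifies the coordinate field used in the definition of the manifold bracket with the
push-forward by the chart, at all points near `x`, so that it may be differentiated there. -/
lemma eventually_mfderiv_extChartAt_apply (x : M) (V : (x : M) → TangentSpace (𝓡 2) x) :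
    ∀ᶠ p in 𝓝 x, mfderiv (𝓡 2) 𝓘(ℝ, EuclideanSpace ℝ (Fin 2)) (extChartAt (𝓡 2) x) p (V p)
      = chartField x V (extChartAt (𝓡 2) x p) := by
  have h := VectorField.eventuallyEq_mpullback_mpullbackWithin_extChartAt (I := 𝓡 2)
    (s := Set.univ) (x := x) V
  rw [nhdsWithin_univ] at h
  filter_upwards [h, extChartAt_source_mem_nhds (I := 𝓡 2) x] with p hp hs
  rw [hp, VectorField.mpullback_apply]
  exact (isInvertible_mfderiv_extChartAt hs).self_apply_inverse _

/-- In the chart at `x` the second derivatives of `f` cancel by symmetry, leaving the bracket of the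
coordinate fields. -/
lemma dir_mlieBracket {Ω : Set M} (hΩ : IsOpen Ω) {V W : (x : M) → TangentSpace (𝓡 2) x}
    (hV : SmoothFieldOn Ω V) (hW : SmoothFieldOn Ω W) {f : M → F} (hf : SmoothOn Ω f) {x : M}
    (hx : x ∈ Ω) :
    dir f x (VectorField.mlieBracket (𝓡 2) V W x) =
      dir (fun p => dir f p (W p)) x (V x) - dir (fun p => dir f p (V p)) x (W x) := by
  have hxs := mem_extChartAt_source (I := 𝓡 2) x
  have hfx : ContDiffAt ℝ 2 (f ∘ (extChartAt (𝓡 2) x).symm) (extChartAt (𝓡 2) x x) := by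
    have h1 := (hf.contMDiffAt (hΩ.mem_nhds hx)).of_le (show (2 : ℕ∞ω) ≤ ∞ from ENat.LEInfty.out)
    have h2 := contMDiffWithinAt_extChartAt_symm_range_self (I := 𝓡 2) (n := 2) x
    rw [(𝓡 2).range_eq_univ, contMDiffWithinAt_univ] at h2
    exact (ContMDiffAt.comp _ (by simpa using h1) h2).contDiffAt
  have hdiff : ∀ V : (x : M) → TangentSpace (𝓡 2) x, SmoothFieldOn Ω V →
      DifferentiableAt ℝ (chartField x V) (extChartAt (𝓡 2) x x) := by
    intro V hV
    have : IsManifold (𝓡 2) 2 M := inferInstance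
    have := MDifferentiableWithinAt.differentiableWithinAt_mpullbackWithin_vectorField
      (s := Set.univ) ((hV.mdiff hΩ hx).mdifferentiableWithinAt)
    exact this.differentiableAt (by simp)
  have hbr := VectorField.fderiv_apply_lieBracket (n := 2) hfx (by simp) (hdiff W hW) (hdiff V hV)
  -- The outer derivative requires the coordinate formula for the inner one on a neighbourhood, not
  -- only at `x`.
  have key : ∀ V : (x : M) → TangentSpace (𝓡 2) x, SmoothFieldOn Ω V →
      (fun p => dir f p (V p)) ∘ (extChartAt (𝓡 2) x).symm =ᶠ[𝓝 (extChartAt (𝓡 2) x x)]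
      fun y => fderiv ℝ (f ∘ (extChartAt (𝓡 2) x).symm) y (chartField x V y) := by
    intro V hV
    have h1 : ∀ᶠ p in 𝓝 x, dir f p (V p) = fderiv ℝ (f ∘ (extChartAt (𝓡 2) x).symm)
        (extChartAt (𝓡 2) x p) (chartField x V (extChartAt (𝓡 2) x p)) := by
      filter_upwards [eventually_mfderiv_extChartAt_apply x V,
        extChartAt_source_mem_nhds (I := 𝓡 2) x, hΩ.mem_nhds hx] with p hp hs hpΩ
      rw [dir_eq_fderiv_chart hs (hf.mdiff hΩ hpΩ), hp]
    have hc : ContinuousAt (extChartAt (𝓡 2) x).symm (extChartAt (𝓡 2) x x) :=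
      continuousAt_extChartAt_symm x
    have h2 : ∀ᶠ y in 𝓝 (extChartAt (𝓡 2) x x), y ∈ (extChartAt (𝓡 2) x).target := by
      have := extChartAt_target_mem_nhds (I := 𝓡 2) x
      exact this
    rw [ContinuousAt, extChartAt_to_inv x] at hc
    filter_upwards [hc.eventually h1, h2] with y hy hyt
    rw [Function.comp_apply, hy, (extChartAt (𝓡 2) x).right_inv hyt]
  have hdir : ∀ V W : (x : M) → TangentSpace (𝓡 2) x, SmoothFieldOn Ω V →
      SmoothFieldOn Ω W → dir (fun p => dir f p (W p)) x (V x) =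
      fderiv ℝ (fun y => fderiv ℝ (f ∘ (extChartAt (𝓡 2) x).symm) y (chartField x W y))
        (extChartAt (𝓡 2) x x) (chartField x V (extChartAt (𝓡 2) x x)) := by
    intro V W hV hW
    rw [dir_eq_fderiv_chart hxs ((hf.dir hΩ hW).mdiff hΩ hx),
      (eventually_mfderiv_extChartAt_apply x V).self_of_nhds, (key W hW).fderiv_eq]
  rw [hdir V W hV hW, hdir W V hW hV, ← hbr, dir_eq_fderiv_chart hxs (hf.mdiff hΩ hx),
    ← VectorField.mlieBracketWithin_univ, VectorField.mlieBracketWithin_apply]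
  refine congrArg (fderiv ℝ (f ∘ (extChartAt (𝓡 2) x).symm) (extChartAt (𝓡 2) x x))
    (((isInvertible_mfderiv_extChartAt hxs).self_apply_inverse _).trans ?_)
  have hn : ((extChartAt (𝓡 2) x).symm ⁻¹' Set.univ ∩ Set.range (𝓡 2)) ∈
      𝓝 (extChartAt (𝓡 2) x x) := by simp
  exact VectorField.lieBracketWithin_of_mem_nhds (𝕜 := ℝ) (E := EuclideanSpace ℝ (Fin 2))
    (V := chartField x V) (W := chartField x W) hn

end Bracket

/-! ### The Levi-Civita connection in an orthonormal frame. -/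

section Frame

variable {M : Type*} [TopologicalSpace M] [ChartedSpace (EuclideanSpace ℝ (Fin 2)) M]
  [IsManifold (𝓡 2) ∞ M] {ι : Type*} {g : RMetric 2 M} (σ : SpinStructure ι g)
  {F : Type*} [NormedAddCommGroup F] [NormedSpace ℝ F]

/-- Metric compatibility. The Koszul formula has only bracket terms here, since the metric
coefficients of the frame are constant; antisymmetry of the bracket does the rest. -/
lemma SpinStructure.conn_skew (a : ι) (α β η : Fin 2) (x : M) :
    σ.conn a α β η x = -σ.conn a α η β x := by
  have := congrArg (fun v => g.inner x v (σ.e a α x))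
    (VectorField.mlieBracket_swap_apply (I := 𝓡 2) (V := σ.e a β) (W := σ.e a η) (x := x))
  simp only [map_neg, neg_apply] at this
  simp only [conn, this]
  ring

lemma SpinStructure.conn_self (a : ι) (α β : Fin 2) (x : M) : σ.conn a α β β x = 0 := by
  linarith [σ.conn_skew a α β β x]

lemma SpinStructure.conn_torsion (a : ι) (α β η : Fin 2) (x : M) :
    σ.conn a α β η x - σ.conn a β α η x
      = g.inner x (VectorField.mlieBracket (𝓡 2) (σ.e a α) (σ.e a β) x) (σ.e a η x) := by
  have := congrArg (fun v => g.inner x v (σ.e a η x))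
    (VectorField.mlieBracket_swap_apply (I := 𝓡 2) (V := σ.e a β) (W := σ.e a α) (x := x))
  simp only [map_neg, neg_apply] at this
  simp only [conn, this]
  ring

lemma SpinStructure.smooth_conn (a : ι) (α β η : Fin 2) : SmoothOn (σ.U a) (σ.conn a α β η) := by
  have hb : ∀ α β η, SmoothOn (σ.U a) (fun x =>
      g.inner x (VectorField.mlieBracket (𝓡 2) (σ.e a α) (σ.e a β) x) (σ.e a η x)) := fun α β η =>
    ((SmoothFieldOn.mlieBracket (σ.smooth_e a α) (σ.smooth_e a β) (σ.isOpen_U a))).metric g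
      (σ.smooth_e a η)
  exact contMDiffOn_const.mul (((hb α β η).sub (hb α η β)).sub (hb β η α))

/-- Two orthonormal vectors are independent, hence span the two-dimensional tangent space. -/
lemma SpinStructure.sum_inner_smul_e (a : ι) {x : M} (hx : x ∈ σ.U a)
    (v : TangentSpace (𝓡 2) x) : ∑ η, g.inner x v (σ.e a η x) • σ.e a η x = v := by
  have hlin : LinearIndependent ℝ (fun η => σ.e a η x) := by
    rw [Fintype.linearIndependent_iff]
    intro b hb η
    have := congrArg (fun w => g.inner x w (σ.e a η x)) hb
    fin_cases η <;> simpa [σ.orthonormal a x hx] using this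
  have hspan : Submodule.span ℝ (Set.range fun η => σ.e a η x) = ⊤ := by
    refine hlin.span_eq_top_of_card_eq_finrank ?_
    change _ = Module.finrank ℝ (EuclideanSpace ℝ (Fin 2))
    simp
  obtain ⟨b, rfl⟩ := (Submodule.mem_span_range_iff_exists_fun ℝ).1
    (show v ∈ Submodule.span ℝ (Set.range fun η => σ.e a η x) by rw [hspan]; trivial)
  simp [σ.orthonormal a x hx]

lemma SpinStructure.mlieBracket_eq (a : ι) (α β : Fin 2) {x : M} (hx : x ∈ σ.U a) :
    VectorField.mlieBracket (𝓡 2) (σ.e a α) (σ.e a β) x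
      = ∑ η, (σ.conn a α β η x - σ.conn a β α η x) • σ.e a η x := by
  simp only [conn_torsion, σ.sum_inner_smul_e a hx]

/-- The commutator of two frame derivatives, in terms of the Levi-Civita connection. -/
lemma SpinStructure.dir_dir_comm (a : ι) {Ω : Set M} (hΩ : IsOpen Ω) (hΩU : Ω ⊆ σ.U a)
    {f : M → F} (hf : SmoothOn Ω f) {x : M} (hx : x ∈ Ω) (α β : Fin 2) :
    dir (fun p => dir f p (σ.e a β p)) x (σ.e a α x)
      - dir (fun p => dir f p (σ.e a α p)) x (σ.e a β x)
      = ∑ η, (σ.conn a α β η x - σ.conn a β α η x) • dir f x (σ.e a η x) := by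
  rw [← dir_mlieBracket hΩ ((σ.smooth_e a α).mono hΩU) ((σ.smooth_e a β).mono hΩU) hf hx,
    σ.mlieBracket_eq a α β (hΩU hx)]
  simp only [dir, map_sum, map_smul]
  rfl

end Frame

/-! ### Partial derivatives and smoothness of the metric coefficients in a target chart. -/

section TargetSmooth

variable {n : ℕ}

lemma pd_congr {f f' : EuclideanSpace ℝ (Fin n) → ℝ} {y : EuclideanSpace ℝ (Fin n)} (k : Fin n)
    (hf : f =ᶠ[𝓝 y] f') : pd k f y = pd k f' y := by
  simp only [pd, hf.fderiv_eq]

lemma pd_add {f f' : EuclideanSpace ℝ (Fin n) → ℝ} {y : EuclideanSpace ℝ (Fin n)} (k : Fin n)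
    (hf : DifferentiableAt ℝ f y) (hf' : DifferentiableAt ℝ f' y) :
    pd k (fun z => f z + f' z) y = pd k f y + pd k f' y := by
  simp [pd, fderiv_fun_add hf hf']

lemma pd_sub {f f' : EuclideanSpace ℝ (Fin n) → ℝ} {y : EuclideanSpace ℝ (Fin n)} (k : Fin n)
    (hf : DifferentiableAt ℝ f y) (hf' : DifferentiableAt ℝ f' y) :
    pd k (fun z => f z - f' z) y = pd k f y - pd k f' y := by
  simp [pd, fderiv_fun_sub hf hf']

lemma pd_mul {f f' : EuclideanSpace ℝ (Fin n) → ℝ} {y : EuclideanSpace ℝ (Fin n)} (k : Fin n)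
    (hf : DifferentiableAt ℝ f y) (hf' : DifferentiableAt ℝ f' y) :
    pd k (fun z => f z * f' z) y = pd k f y * f' y + f y * pd k f' y := by
  simp only [pd, fderiv_fun_mul hf hf', add_apply,
    smul_apply, smul_eq_mul]
  ring

lemma pd_const_mul (b : ℝ) {f : EuclideanSpace ℝ (Fin n) → ℝ} {y : EuclideanSpace ℝ (Fin n)}
    (k : Fin n) (hf : DifferentiableAt ℝ f y) :
    pd k (fun z => b * f z) y = b * pd k f y := by
  simp [pd, fderiv_const_mul hf]

lemma pd_sum {κ : Type*} (s : Finset κ) {f : κ → EuclideanSpace ℝ (Fin n) → ℝ}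
    {y : EuclideanSpace ℝ (Fin n)} (k : Fin n) (hf : ∀ i, DifferentiableAt ℝ (f i) y) :
    pd k (fun z => ∑ i ∈ s, f i z) y = ∑ i ∈ s, pd k (f i) y := by
  simp [pd, fderiv_fun_sum fun i _ => hf i]

variable {Ω : Set (EuclideanSpace ℝ (Fin n))}

lemma contDiffOn_pd {f : EuclideanSpace ℝ (Fin n) → ℝ} (hf : ContDiffOn ℝ ∞ f Ω) (hΩ : IsOpen Ω)
    (k : Fin n) : ContDiffOn ℝ ∞ (pd k f) Ω :=
  (hf.fderiv_of_isOpen hΩ (by simp)).clm_apply contDiffOn_const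

lemma differentiableAt_of_contDiffOn {f : EuclideanSpace ℝ (Fin n) → ℝ} (hf : ContDiffOn ℝ ∞ f Ω)
    (hΩ : IsOpen Ω) {y : EuclideanSpace ℝ (Fin n)} (hy : y ∈ Ω) : DifferentiableAt ℝ f y :=
  (hf.contDiffAt (hΩ.mem_nhds hy)).differentiableAt (by simp)

lemma pd_comm {f : EuclideanSpace ℝ (Fin n) → ℝ} (hf : ContDiffOn ℝ ∞ f Ω) (hΩ : IsOpen Ω)
    {y : EuclideanSpace ℝ (Fin n)} (hy : y ∈ Ω) (k l : Fin n) :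
    pd k (pd l f) y = pd l (pd k f) y := by
  have hsymm := (hf.contDiffAt (hΩ.mem_nhds hy)).isSymmSndFDerivAt
    (by simpa using (ENat.LEInfty.out : (2 : ℕ∞ω) ≤ ∞))
  have hd : DifferentiableAt ℝ (fderiv ℝ f) y :=
    ((hf.fderiv_of_isOpen hΩ (m := ∞) (by simp)).contDiffAt (hΩ.mem_nhds hy)).differentiableAt
      (by simp)
  have h2 : ∀ k l, pd k (pd l f) y
      = fderiv ℝ (fderiv ℝ f) y (EuclideanSpace.single k 1) (EuclideanSpace.single l 1) := by
    intro k l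
    change fderiv ℝ (fun z => fderiv ℝ f z (EuclideanSpace.single l 1)) y _ = _
    rw [fderiv_clm_apply hd (differentiableAt_const _)]
    simp
  rw [h2, h2, hsymm.eq]

lemma contDiffOn_det {m : ℕ} {A : EuclideanSpace ℝ (Fin n) → Matrix (Fin m) (Fin m) ℝ}
    (hA : ∀ i j, ContDiffOn ℝ ∞ (fun y => A y i j) Ω) :
    ContDiffOn ℝ ∞ (fun y => (A y).det) Ω := by
  simp only [Matrix.det_apply']
  exact ContDiffOn.sum fun s _ => contDiffOn_const.mul (contDiffOn_prod fun i _ => hA _ _)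

lemma contDiffOn_inv_apply {m : ℕ} {A : EuclideanSpace ℝ (Fin n) → Matrix (Fin m) (Fin m) ℝ}
    (hA : ∀ i j, ContDiffOn ℝ ∞ (fun y => A y i j) Ω) (hdet : ∀ y ∈ Ω, (A y).det ≠ 0)
    (i j : Fin m) : ContDiffOn ℝ ∞ (fun y => (A y)⁻¹ i j) Ω := by
  simp only [Matrix.inv_def, Matrix.smul_apply, Ring.inverse_eq_inv', smul_eq_mul,
    Matrix.adjugate_apply]
  -- By Cramer's rule a cofactor is the determinant of `A` with row `j` replaced by a basis vector,
  -- so its entries are constants or entries of `A`.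
  refine ((contDiffOn_det hA).inv hdet).mul (contDiffOn_det fun p q => ?_)
  by_cases hp : p = j
  · subst hp; simpa using contDiffOn_const
  · simpa [Matrix.updateRow_ne hp] using hA p q

variable {N : Type*} [TopologicalSpace N] [ChartedSpace (EuclideanSpace ℝ (Fin n)) N]
  [IsManifold (𝓡 n) ∞ N] (h : RMetric n N)
  {c : OpenPartialHomeomorph N (EuclideanSpace ℝ (Fin n))}
  (hc : c ∈ IsManifold.maximalAtlas (𝓡 n) ∞ N)

include hc in
lemma contMDiffOn_coordVec (i : Fin n) : ContMDiffOn (𝓡 n) (𝓡 n).tangent ∞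
    (fun y => (⟨c.symm y, coordVec c i y⟩ : TangentBundle (𝓡 n) N)) c.target := by
  have h1 := (contMDiffOn_symm_of_mem_maximalAtlas hc).contMDiffOn_tangentMapWithin (m := ∞)
    (by simp) c.open_target.uniqueMDiffOn
  have h0 : ContMDiffOn (𝓡 n) (𝓡 n).tangent ∞
      (fun y => (⟨y, EuclideanSpace.single i (1 : ℝ)⟩ :
        TangentBundle (𝓡 n) (EuclideanSpace ℝ (Fin n)))) c.target :=
    contMDiffOn_vectorSpace_iff_contDiffOn.2 contDiffOn_const
  refine (h1.comp h0 fun y hy => hy).congr fun y hy => ?_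
  simp only [Function.comp_apply, tangentMapWithin, mfderivWithin_of_isOpen c.open_target hy]
  rfl

include hc in
lemma contDiffOn_hLow (i j : Fin n) : ContDiffOn ℝ ∞ (hLow h c i j) c.target := by
  rw [← contMDiffOn_iff_contDiffOn]
  intro y hy
  have := ContMDiffWithinAt.clm_bundle_apply₂ (F₁ := EuclideanSpace ℝ (Fin n))
    (F₂ := EuclideanSpace ℝ (Fin n)) (F₃ := ℝ) (E₃ := Bundle.Trivial N ℝ)
    (h.contMDiff.contMDiffAt.comp_contMDiffWithinAt y
      (contMDiffOn_symm_of_mem_maximalAtlas hc y hy))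
    (contMDiffOn_coordVec hc i y hy) (contMDiffOn_coordVec hc j y hy)
  simp only [Bundle.contMDiffWithinAt_totalSpace] at this
  exact this.2

omit [IsManifold (𝓡 n) ∞ N] in
lemma hLow_symm [IsManifold (𝓡 n) ∞ N] (h : RMetric n N)
    (c : OpenPartialHomeomorph N (EuclideanSpace ℝ (Fin n))) (i j : Fin n) :
    hLow h c i j = hLow h c j i := by
  funext y
  exact h.symm _ _ _

omit [IsManifold (𝓡 n) ∞ N] in
include hc in
lemma mfderiv_symm_injective {y : EuclideanSpace ℝ (Fin n)} (hy : y ∈ c.target) :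
    Function.Injective (mfderiv (𝓡 n) (𝓡 n) c.symm y) := by
  have hd : OpenPartialHomeomorph.MDifferentiable (𝓡 n) (𝓡 n) c :=
    ⟨(contMDiffOn_of_mem_maximalAtlas hc).mdifferentiableOn (by simp),
      (contMDiffOn_symm_of_mem_maximalAtlas hc).mdifferentiableOn (by simp)⟩
  have := hd.comp_symm_deriv hy
  intro u v huv
  have hu := congrArg (fun L => L u) this
  have hv := congrArg (fun L => L v) this
  simp only [ContinuousLinearMap.comp_apply] at hu hv
  rw [huv] at hu
  exact hu.symm.trans hv

include hc in
-- A kernel vector v of the Gram matrix gives a tangent vector v^i ∂_i of length zero. Positivity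
-- makes it vanish, and the differential of the chart inverse is injective.
lemma det_hLow_ne_zero {y : EuclideanSpace ℝ (Fin n)} (hy : y ∈ c.target) :
    (Matrix.of fun p q => hLow h c p q y).det ≠ 0 := by
  intro hdet
  obtain ⟨v, hv, hv0⟩ := Matrix.exists_mulVec_eq_zero_iff.2 hdet
  set w : TangentSpace (𝓡 n) (c.symm y) := ∑ i, v i • coordVec c i y with hw
  have h1 : h.inner (c.symm y) w w = 0 := by
    have : h.inner (c.symm y) w w
        = v ⬝ᵥ ((Matrix.of fun p q => hLow h c p q y).mulVec v) := by
      simp only [hw, map_sum, map_smul, dotProduct, Matrix.mulVec, Matrix.of_apply, hLow,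
        FunLike.coe_sum, Finset.sum_apply, FunLike.coe_smul, Pi.smul_apply, smul_eq_mul,
        Finset.mul_sum]
      rw [Finset.sum_comm]
      exact Finset.sum_congr rfl fun i _ => Finset.sum_congr rfl fun j _ => by ring
    rw [this, hv0, dotProduct_zero]
  have h2 : w = 0 := by
    by_contra hne
    exact (h.pos _ w hne).ne' h1
  have h3 : w = mfderiv (𝓡 n) (𝓡 n) c.symm y (∑ i, v i • EuclideanSpace.single i (1 : ℝ)) := by
    refine Eq.symm ((map_sum (mfderiv (𝓡 n) (𝓡 n) c.symm y)
      (fun i => v i • EuclideanSpace.single i (1 : ℝ)) Finset.univ).trans ?_)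
    exact Finset.sum_congr rfl fun i _ => (mfderiv (𝓡 n) (𝓡 n) c.symm y).map_smul _ _
  have h4 : ∑ i, v i • EuclideanSpace.single i (1 : ℝ) = (0 : EuclideanSpace ℝ (Fin n)) := mfderiv_symm_injective hc hy ((h3.symm.trans h2).trans (map_zero _).symm)
  apply hv
  funext i
  have := congrArg (fun u : EuclideanSpace ℝ (Fin n) => u i) h4
  simpa [Pi.single_apply] using this

include hc in
lemma sum_hLow_mul_hUp {y : EuclideanSpace ℝ (Fin n)} (hy : y ∈ c.target) (i j : Fin n) :
    ∑ k, hLow h c i k y * hUp h c k j y = if i = j then 1 else 0 := by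
  have := congrFun (congrFun (Matrix.mul_nonsing_inv (Matrix.of fun p q => hLow h c p q y)
    (det_hLow_ne_zero h hc hy).isUnit) i) j
  simpa [Matrix.mul_apply, Matrix.one_apply, hUp] using this

include hc in
lemma contDiffOn_hUp (i j : Fin n) : ContDiffOn ℝ ∞ (hUp h c i j) c.target :=
  contDiffOn_inv_apply (A := fun y => Matrix.of fun p q => hLow h c p q y)
    (fun p q => contDiffOn_hLow h hc p q) (fun _ hy => det_hLow_ne_zero h hc hy) i j

include hc in
lemma contDiffOn_christoffel (k i j : Fin n) : ContDiffOn ℝ ∞ (christoffel h c k i j) c.target := by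
  have hp := fun l i j => contDiffOn_pd (contDiffOn_hLow h hc i j) c.open_target l
  exact contDiffOn_const.mul (ContDiffOn.sum fun l _ => (contDiffOn_hUp h hc k l).mul
    (((hp i j l).add (hp j i l)).sub (hp l i j)))

include hc in
lemma contDiffOn_riem (i j k l : Fin n) : ContDiffOn ℝ ∞ (riem h c i j k l) c.target := by
  have hp := fun k i l j => contDiffOn_pd (contDiffOn_christoffel h hc i l j) c.open_target k
  have hg := contDiffOn_christoffel h hc
  exact ((hp k i l j).sub (hp l i k j)).add (ContDiffOn.sum fun m _ =>
    ((hg i k m).mul (hg m l j)).sub ((hg i l m).mul (hg m k j)))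

include hc in
lemma contDiffOn_riemLow (i j k l : Fin n) : ContDiffOn ℝ ∞ (riemLow h c i j k l) c.target :=
  ContDiffOn.sum fun m _ => (contDiffOn_hLow h hc i m).mul (contDiffOn_riem h hc m j k l)

end TargetSmooth

/-! ### Christoffel symbols and the symmetries of the curvature of the target. -/

section TargetCurvature

variable {n : ℕ} {N : Type*} [TopologicalSpace N] [ChartedSpace (EuclideanSpace ℝ (Fin n)) N]
  [IsManifold (𝓡 n) ∞ N] (h : RMetric n N)
  {c : OpenPartialHomeomorph N (EuclideanSpace ℝ (Fin n))}
  (hc : c ∈ IsManifold.maximalAtlas (𝓡 n) ∞ N)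

lemma christoffel_symm (c : OpenPartialHomeomorph N (EuclideanSpace ℝ (Fin n))) (k i j : Fin n) :
    christoffel h c k i j = christoffel h c k j i := by
  funext y
  simp only [christoffel, hLow_symm h c i j]
  exact congrArg _ (Finset.sum_congr rfl fun l _ => by ring)

/-- The Christoffel symbols of the first kind. -/
def christoffelLow (c : OpenPartialHomeomorph N (EuclideanSpace ℝ (Fin n))) (m i j : Fin n)
    (y : EuclideanSpace ℝ (Fin n)) : ℝ :=
  (1 / 2) * (pd i (hLow h c j m) y + pd j (hLow h c i m) y - pd m (hLow h c i j) y)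

include hc in
lemma sum_hLow_mul_christoffel {y : EuclideanSpace ℝ (Fin n)} (hy : y ∈ c.target) (m i j : Fin n) :
    ∑ k, hLow h c m k y * christoffel h c k i j y = christoffelLow h c m i j y := by
  calc ∑ k, hLow h c m k y * christoffel h c k i j y
      = ∑ l, (∑ k, hLow h c m k y * hUp h c k l y) * ((1 / 2) *
        (pd i (hLow h c j l) y + pd j (hLow h c i l) y - pd l (hLow h c i j) y)) := by
        simp only [christoffel, Finset.mul_sum, Finset.sum_mul]
        rw [Finset.sum_comm]
        exact Finset.sum_congr rfl fun i _ => Finset.sum_congr rfl fun j _ => by ring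
    _ = christoffelLow h c m i j y := by
        simp [sum_hLow_mul_hUp h hc hy, christoffelLow]

include hc in
/-- Metric compatibility of the Levi-Civita connection in coordinates. -/
lemma pd_hLow {y : EuclideanSpace ℝ (Fin n)} (hy : y ∈ c.target) (k i j : Fin n) :
    pd k (hLow h c i j) y = ∑ l, christoffel h c l k i y * hLow h c l j y
      + ∑ l, christoffel h c l k j y * hLow h c i l y := by
  have h1 := sum_hLow_mul_christoffel h hc hy j k i
  have h2 := sum_hLow_mul_christoffel h hc hy i k j
  have e1 : ∑ l, christoffel h c l k i y * hLow h c l j y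
      = ∑ l, hLow h c j l y * christoffel h c l k i y :=
    Finset.sum_congr rfl fun l _ => by rw [hLow_symm h c j l]; ring
  have e2 : ∑ l, christoffel h c l k j y * hLow h c i l y
      = ∑ l, hLow h c i l y * christoffel h c l k j y :=
    Finset.sum_congr rfl fun l _ => by ring
  rw [e1, e2, h1, h2]
  simp only [christoffelLow, hLow_symm h c j i, hLow_symm h c k i, hLow_symm h c k j]
  ring

include hc in
-- Lowering the index turns h∂Γ into ∂(hΓ) - (∂h)Γ. Half of (∂h)Γ cancels the quadratic part of the
-- curvature; the other half survives.
lemma riemLow_eq {y : EuclideanSpace ℝ (Fin n)} (hy : y ∈ c.target) (i j k l : Fin n) :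
    riemLow h c i j k l y = pd k (christoffelLow h c i l j) y - pd l (christoffelLow h c i k j) y
      - ∑ m, christoffelLow h c m k i y * christoffel h c m l j y
      + ∑ m, christoffelLow h c m l i y * christoffel h c m k j y := by
  have hdL := fun i j => differentiableAt_of_contDiffOn (contDiffOn_hLow h hc i j) c.open_target hy
  have hdG := fun k i j => differentiableAt_of_contDiffOn (contDiffOn_christoffel h hc k i j)
    c.open_target hy
  have key : ∀ k l, pd k (christoffelLow h c i l j) y
      = ∑ m, (pd k (hLow h c i m) y * christoffel h c m l j y
        + hLow h c i m y * pd k (christoffel h c m l j) y) := by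
    intro k l
    -- The identity between the two kinds of Christoffel symbols holds on the whole open chart
    -- target, so it may be differentiated.
    rw [← pd_congr (f := fun z => ∑ m, hLow h c i m z * christoffel h c m l j z) k]
    · rw [pd_sum _ _ fun m => (hdL i m).fun_mul (hdG m l j)]
      exact Finset.sum_congr rfl fun m _ => pd_mul k (hdL i m) (hdG m l j)
    · filter_upwards [c.open_target.mem_nhds hy] with z hz
      exact sum_hLow_mul_christoffel h hc hz i l j
  have hpd : ∀ k m, pd k (hLow h c i m) y
      = christoffelLow h c m k i y + christoffelLow h c i k m y := by
    intro k m
    simp only [christoffelLow, hLow_symm h c m i, hLow_symm h c k i, hLow_symm h c k m]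
    ring
  have hquad : ∀ k l, ∑ m, hLow h c i m y * ∑ p, christoffel h c m k p y * christoffel h c p l j y
      = ∑ p, christoffelLow h c i k p y * christoffel h c p l j y := by
    intro k l
    simp only [← sum_hLow_mul_christoffel h hc hy, Finset.mul_sum, Finset.sum_mul]
    rw [Finset.sum_comm]
    exact Finset.sum_congr rfl fun i _ => Finset.sum_congr rfl fun j _ => by ring
  have e := hquad k l
  have e' := hquad l k
  simp only [key, hpd, riemLow, riem, Finset.sum_sub_distrib, mul_add, mul_sub, add_mul,
    Finset.sum_add_distrib] at e e' ⊢
  linarith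

include hc in
lemma pd_christoffelLow {y : EuclideanSpace ℝ (Fin n)} (hy : y ∈ c.target) (k m i j : Fin n) :
    pd k (christoffelLow h c m i j) y = (1 / 2) * (pd k (pd i (hLow h c j m)) y
      + pd k (pd j (hLow h c i m)) y - pd k (pd m (hLow h c i j)) y) := by
  have hp := fun l i j => differentiableAt_of_contDiffOn
    (contDiffOn_pd (contDiffOn_hLow h hc i j) c.open_target l) c.open_target hy
  unfold christoffelLow
  rw [pd_const_mul _ _ (((hp _ _ _).fun_add (hp _ _ _)).fun_sub (hp _ _ _)),
    pd_sub _ ((hp _ _ _).fun_add (hp _ _ _)) (hp _ _ _), pd_add _ (hp _ _ _) (hp _ _ _)]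

include hc in
-- Both sides are the value of the symmetric form h on the vectors Γ_{ij} and Γ_{kl}.
lemma sum_christoffelLow_mul_christoffel_comm {y : EuclideanSpace ℝ (Fin n)} (hy : y ∈ c.target)
    (i j k l : Fin n) : ∑ m, christoffelLow h c m i j y * christoffel h c m k l y
      = ∑ m, christoffelLow h c m k l y * christoffel h c m i j y := by
  simp only [← sum_hLow_mul_christoffel h hc hy, Finset.sum_mul]
  rw [Finset.sum_comm]
  refine Finset.sum_congr rfl fun p _ => Finset.sum_congr rfl fun m _ => ?_
  rw [hLow_symm h c m p]; ring

lemma christoffelLow_symm (c : OpenPartialHomeomorph N (EuclideanSpace ℝ (Fin n)))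
    (m i j : Fin n) (y : EuclideanSpace ℝ (Fin n)) :
    christoffelLow h c m i j y = christoffelLow h c m j i y := by
  simp only [christoffelLow, hLow_symm h c i j]
  ring

lemma riem_skew (c : OpenPartialHomeomorph N (EuclideanSpace ℝ (Fin n))) (i j k l : Fin n)
    (y : EuclideanSpace ℝ (Fin n)) : riem h c i j k l y = -riem h c i j l k y := by
  simp only [riem, Finset.sum_sub_distrib]
  ring

lemma riemLow_skew_right (c : OpenPartialHomeomorph N (EuclideanSpace ℝ (Fin n)))
    (i j k l : Fin n) (y : EuclideanSpace ℝ (Fin n)) :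
    riemLow h c i j k l y = -riemLow h c i j l k y := by
  simp only [riemLow, riem_skew h c _ j k l, mul_neg, Finset.sum_neg_distrib]

include hc in
-- In the lowered formula only second derivatives of h, which commute, and products h(Γ, Γ), which
-- are symmetric, remain; matching them proves the symmetry without the Bianchi identity.
lemma riemLow_pair_symm {y : EuclideanSpace ℝ (Fin n)} (hy : y ∈ c.target) (i j k l : Fin n) :
    riemLow h c i j k l y = riemLow h c k l i j y := by
  have hp : ∀ a b i j, pd a (pd b (hLow h c i j)) y = pd b (pd a (hLow h c i j)) y :=
    fun a b i j => pd_comm (contDiffOn_hLow h hc i j) c.open_target hy a b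
  simp only [riemLow_eq h hc hy, pd_christoffelLow h hc hy]
  rw [sum_christoffelLow_mul_christoffel_comm h hc hy j k i l,
    hLow_symm h c j i, hLow_symm h c l i, hLow_symm h c k j, hLow_symm h c k i,
    hLow_symm h c l k, hLow_symm h c l j, hp k l, hp k i, hp l i, hp k j, hp l j, hp i j]
  simp only [christoffelLow_symm h c _ k i, christoffelLow_symm h c _ l i,
    christoffel_symm h c _ l j, christoffel_symm h c _ k j]
  ring

include hc in
lemma riemLow_skew_left {y : EuclideanSpace ℝ (Fin n)} (hy : y ∈ c.target) (i j k l : Fin n) :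
    riemLow h c i j k l y = -riemLow h c j i k l y := by
  rw [riemLow_pair_symm h hc hy, riemLow_skew_right, riemLow_pair_symm h hc hy k l j i]

end TargetCurvature

/-! ### Clifford multiplication on quaternions. -/

section Quaternions

@[simp] lemma cliff_zero_re : (cliff 0).re = 0 := rfl

@[simp] lemma cliff_zero_imI : (cliff 0).imI = 1 := rfl

@[simp] lemma cliff_zero_imJ : (cliff 0).imJ = 0 := rfl

@[simp] lemma cliff_zero_imK : (cliff 0).imK = 0 := rfl

@[simp] lemma cliff_one_re : (cliff 1).re = 0 := rfl

@[simp] lemma cliff_one_imI : (cliff 1).imI = 0 := rfl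

@[simp] lemma cliff_one_imJ : (cliff 1).imJ = 1 := rfl

@[simp] lemma cliff_one_imK : (cliff 1).imK = 0 := rfl

/-- Left multiplication by an imaginary quaternion is skew-adjoint. -/
lemma inner_cliff_mul (α : Fin 2) (s t : ℍ[ℝ]) :
    (inner ℝ (cliff α * s) t : ℝ) = -inner ℝ s (cliff α * t) := by
  fin_cases α <;> simp [Quaternion.inner_def] <;> ring

lemma inner_cliff_cliff_mul (α β : Fin 2) (s t : ℍ[ℝ]) :
    (inner ℝ (cliff α * cliff β * s) t : ℝ) = inner ℝ s (cliff β * cliff α * t) := by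
  rw [mul_assoc, inner_cliff_mul, inner_cliff_mul, neg_neg, mul_assoc]

lemma cliff_sq (α : Fin 2) : cliff α * cliff α = -1 := by
  fin_cases α <;> ext <;> simp

lemma cliff_one_mul_zero : cliff 1 * cliff 0 = -(cliff 0 * cliff 1) := by
  ext <;> simp

end Quaternions

/-! ### The spin connection is metric and compatible with Clifford multiplication. -/

section SpinConnection

variable {M : Type*} [TopologicalSpace M] [ChartedSpace (EuclideanSpace ℝ (Fin 2)) M]
  [IsManifold (𝓡 2) ∞ M] {ι : Type*} {g : RMetric 2 M} (σ : SpinStructure ι g)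

/-- In dimension two the connection has a single coefficient, and the index pairs (0,1) and (1,0)
contribute equally, turning 1/4 into 1/2. -/
lemma SpinStructure.spinTerm_eq (a : ι) (α : Fin 2) (x : M) (s : ℍ[ℝ]) :
    σ.spinTerm a α x s = (σ.conn a α 0 1 x / 2) • (cliff 0 * cliff 1 * s) := by
  simp only [spinTerm, Fin.sum_univ_two, σ.conn_self, σ.conn_skew a α 1 0, cliff_one_mul_zero,
    zero_smul, neg_smul, neg_mul, smul_neg, neg_neg, zero_add, add_zero]
  module

lemma SpinStructure.inner_spinTerm (a : ι) (α : Fin 2) (x : M) (s t : ℍ[ℝ]) :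
    (inner ℝ (σ.spinTerm a α x s) t : ℝ) + inner ℝ s (σ.spinTerm a α x t) = 0 := by
  simp only [spinTerm_eq, inner_smul_left, inner_smul_right, inner_cliff_cliff_mul,
    cliff_one_mul_zero, neg_mul, inner_neg_right]
  simp

lemma SpinStructure.smooth_spinTerm (a : ι) (α : Fin 2) {Ω : Set M} (hΩU : Ω ⊆ σ.U a)
    {s : M → ℍ[ℝ]} (hs : SmoothOn Ω s) : SmoothOn Ω (fun p => σ.spinTerm a α p (s p)) := by
  simp only [spinTerm_eq]
  refine SmoothOn.smul ?_ (hs.cliff_mul _)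
  simp only [div_eq_mul_inv]
  exact SmoothOn.mul ((σ.smooth_conn a α 0 1).mono hΩU) contMDiffOn_const

lemma SpinStructure.smooth_nablaS (a : ι) (α : Fin 2) {Ω : Set M} (hΩ : IsOpen Ω)
    (hΩU : Ω ⊆ σ.U a) {s : M → ℍ[ℝ]} (hs : SmoothOn Ω s) : SmoothOn Ω (σ.nablaS a α s) :=
  ContMDiffOn.add (hs.dir hΩ ((σ.smooth_e a α).mono hΩU)) (σ.smooth_spinTerm a α hΩU hs)

/-- The spin connection is metric. -/
lemma SpinStructure.dir_inner_nablaS (a : ι) (α : Fin 2) {s t : M → ℍ[ℝ]} {x : M}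
    (hs : MDifferentiableAt (𝓡 2) 𝓘(ℝ, ℍ[ℝ]) s x) (ht : MDifferentiableAt (𝓡 2) 𝓘(ℝ, ℍ[ℝ]) t x) :
    dir (fun p => (inner ℝ (s p) (t p) : ℝ)) x (σ.e a α x)
      = inner ℝ (σ.nablaS a α s x) (t x) + inner ℝ (s x) (σ.nablaS a α t x) := by
  rw [dir_inner _ hs ht, nablaS, nablaS, inner_add_left, inner_add_right]
  linarith [σ.inner_spinTerm a α x (s x) (t x)]

/-- Clifford multiplication is parallel. -/
lemma SpinStructure.nablaS_cliff_mul (a : ι) (α β : Fin 2) {s : M → ℍ[ℝ]} {x : M}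
    (hs : MDifferentiableAt (𝓡 2) 𝓘(ℝ, ℍ[ℝ]) s x) :
    σ.nablaS a α (fun p => cliff β * s p) x
      = cliff β * σ.nablaS a α s x + ∑ η, σ.conn a α β η x • (cliff η * s x) := by
  rw [nablaS, dir_cliff_mul _ _ hs, nablaS, spinTerm_eq, spinTerm_eq, mul_add, add_assoc]
  congr 1
  -- The commutator of (1/2)e_0·e_1 with e_β is the infinitesimal rotation of e_β, i.e. e_1 for β =
  -- 0 and -e_0 for β = 1; it is checked on quaternion components.
  fin_cases β <;>
  · simp only [Fin.sum_univ_two, σ.conn_self, σ.conn_skew a α 1 0, Fin.zero_eta, Fin.mk_one]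
    ext <;> simp <;> ring

lemma SpinStructure.nablaS_smul (a : ι) (α : Fin 2) {f : M → ℝ} {s : M → ℍ[ℝ]} {x : M}
    (hf : MDifferentiableAt (𝓡 2) 𝓘(ℝ, ℝ) f x) (hs : MDifferentiableAt (𝓡 2) 𝓘(ℝ, ℍ[ℝ]) s x) :
    σ.nablaS a α (fun p => f p • s p) x
      = f x • σ.nablaS a α s x + dir f x (σ.e a α x) • s x := by
  rw [nablaS, dir_smul _ hf hs, nablaS, spinTerm_eq, spinTerm_eq, mul_smul_comm]
  module

end SpinConnection

namespace Fields

/-! ### Smoothness of the local expressions of the fields. -/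

section Smooth

variable {M : Type*} [TopologicalSpace M] [ChartedSpace (EuclideanSpace ℝ (Fin 2)) M]
  [IsManifold (𝓡 2) ∞ M] {ι : Type*} {g : RMetric 2 M} {σ : SpinStructure ι g}
  {n : ℕ} {N : Type*} [TopologicalSpace N] [ChartedSpace (EuclideanSpace ℝ (Fin n)) N]
  [IsManifold (𝓡 n) ∞ N] {h : RMetric n N}
  (F : Fields σ h) (a : ι) (c : OpenPartialHomeomorph N (EuclideanSpace ℝ (Fin n)))

/-- The open set on which the local expressions in the spin frame `a` and the chart `c` are
meaningful. -/
def dom : Set M := σ.U a ∩ F.φ ⁻¹' c.source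

lemma isOpen_dom : IsOpen (F.dom a c) :=
  (σ.isOpen_U a).inter (c.open_source.preimage F.smooth_φ.continuous)

lemma dom_subset : F.dom a c ⊆ σ.U a := Set.inter_subset_left

variable {F a c}

lemma yφ_mem {x : M} (hx : x ∈ F.dom a c) : F.yφ c x ∈ c.target := c.map_source hx.2

lemma smoothField_e (α : Fin 2) : SmoothFieldOn (F.dom a c) (σ.e a α) :=
  (σ.smooth_e a α).mono (F.dom_subset a c)

lemma smooth_dir {V : Type*} [NormedAddCommGroup V] [NormedSpace ℝ V] {f : M → V}
    (hf : SmoothOn (F.dom a c) f) (α : Fin 2) :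
    SmoothOn (F.dom a c) (fun p => dir f p (σ.e a α p)) :=
  hf.dir (F.isOpen_dom a c) (smoothField_e α)

lemma smooth_conn (α β η : Fin 2) : SmoothOn (F.dom a c) (σ.conn a α β η) :=
  (σ.smooth_conn a α β η).mono (F.dom_subset a c)

lemma mdiff {V : Type*} [NormedAddCommGroup V] [NormedSpace ℝ V] {f : M → V}
    (hf : SmoothOn (F.dom a c) f) {x : M} (hx : x ∈ F.dom a c) :
    MDifferentiableAt (𝓡 2) 𝓘(ℝ, V) f x := hf.mdiff (F.isOpen_dom a c) hx

lemma smooth_chi (α : Fin 2) : SmoothOn (F.dom a c) (F.chi a α) :=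
  (F.χ.smooth a α).mono (F.dom_subset a c)

lemma smooth_qchi (α : Fin 2) : SmoothOn (F.dom a c) (F.qchi a α) :=
  SmoothOn.smul contMDiffOn_const
    (SmoothOn.sum _ fun β => (smooth_chi β).cliff_mul (cliff β * cliff α))

variable (hc : c ∈ IsManifold.maximalAtlas (𝓡 n) ∞ N)
include hc

lemma smooth_yφ : SmoothOn (F.dom a c) (F.yφ c) :=
  (contMDiffOn_of_mem_maximalAtlas hc).comp F.smooth_φ.contMDiffOn (fun _ hx => hx.2)

lemma smooth_comp_yφ {f : EuclideanSpace ℝ (Fin n) → ℝ} (hf : ContDiffOn ℝ ∞ f c.target) :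
    SmoothOn (F.dom a c) (fun p => f (F.yφ c p)) :=
  (contMDiffOn_iff_contDiffOn.2 hf).comp (smooth_yφ hc) (fun _ hx => yφ_mem hx)

lemma smooth_yφ_apply (i : Fin n) : SmoothOn (F.dom a c) (fun p => F.yφ c p i) :=
  (EuclideanSpace.proj i : EuclideanSpace ℝ (Fin n) →L[ℝ] ℝ).contMDiff.comp_contMDiffOn
    (smooth_yφ hc)

lemma smooth_dphi (α : Fin 2) (i : Fin n) : SmoothOn (F.dom a c) (F.dphi a c α i) :=
  smooth_dir (smooth_yφ_apply hc i) α

/-- The chain rule for a function of the coordinates of the target. -/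
lemma dir_comp_yφ {f : EuclideanSpace ℝ (Fin n) → ℝ} (hf : ContDiffOn ℝ ∞ f c.target) {x : M}
    (hx : x ∈ F.dom a c) (α : Fin 2) :
    dir (fun p => f (F.yφ c p)) x (σ.e a α x)
      = ∑ k, pd k f (F.yφ c x) * F.dphi a c α k x := by
  rw [dir_comp_fderiv _ (differentiableAt_of_contDiffOn hf c.open_target (yφ_mem hx))
    (mdiff (smooth_yφ hc) hx)]
  have h1 : dir (F.yφ c) x (σ.e a α x)
      = ∑ k, F.dphi a c α k x • EuclideanSpace.single k (1 : ℝ) := by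
    ext i
    have := dir_clm (EuclideanSpace.proj i : EuclideanSpace ℝ (Fin n) →L[ℝ] ℝ) (σ.e a α x)
      (mdiff (smooth_yφ hc) hx)
    simp only [PiLp.proj_apply] at this
    rw [← this]
    simp [Pi.single_apply, dphi]
  rw [h1, map_sum]
  exact Finset.sum_congr rfl fun k _ => by simp [pd, mul_comm]

lemma smooth_psi (i : Fin n) : SmoothOn (F.dom a c) (F.psi a c i) := F.ψ.smooth a c hc i

lemma smooth_pair {s t : Fin n → M → ℍ[ℝ]} (hs : ∀ i, SmoothOn (F.dom a c) (s i))
    (ht : ∀ i, SmoothOn (F.dom a c) (t i)) :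
    SmoothOn (F.dom a c) (fun p => F.pair c p (fun i => s i p) (fun i => t i p)) :=
  SmoothOn.sum _ fun i => SmoothOn.sum _ fun j =>
    (smooth_comp_yφ hc (contDiffOn_hLow h hc i j)).mul ((hs i).inner (ht j))

lemma smooth_nablaPsi (α : Fin 2) (i : Fin n) : SmoothOn (F.dom a c) (F.nablaPsi a c α i) :=
  ContMDiffOn.add (σ.smooth_nablaS a α (F.isOpen_dom a c) (F.dom_subset a c) (smooth_psi hc i))
    (SmoothOn.sum _ fun j => SmoothOn.sum _ fun k =>
      ((smooth_comp_yφ hc (contDiffOn_christoffel h hc i j k)).mul (smooth_dphi hc α j)).smul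
        (smooth_psi hc k))

lemma smooth_dphiInner (α β : Fin 2) : SmoothOn (F.dom a c) (F.dphiInner a c α β) :=
  SmoothOn.sum _ fun i => SmoothOn.sum _ fun j =>
    (smooth_comp_yφ hc (contDiffOn_hLow h hc i j)).mul
      ((smooth_dphi hc α i).mul (smooth_dphi hc β j))

lemma smooth_tensorDphi {s : M → ℍ[ℝ]} (hs : SmoothOn (F.dom a c) s) (α : Fin 2) (i : Fin n) :
    SmoothOn (F.dom a c) (fun p => F.tensorDphi a c (s p) α p i) :=
  (smooth_dphi hc α i).smul hs

lemma smooth_SR (i : Fin n) : SmoothOn (F.dom a c) (F.SR a c i) :=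
  SmoothOn.sum _ fun j => SmoothOn.sum _ fun k => SmoothOn.sum _ fun l =>
    ((smooth_comp_yφ hc (contDiffOn_riem h hc i j k l)).mul
      ((smooth_psi hc l).inner (smooth_psi hc j))).smul (smooth_psi hc k)

lemma smooth_RmPsi : SmoothOn (F.dom a c) (F.RmPsi a c) :=
  smooth_pair hc (smooth_SR hc) (smooth_psi hc)

end Smooth

end Fields

namespace Fields

/-! ### Algebra of the fibre metrics on S ⊗ φ^*TN and φ^*TN. -/

section Pairing

variable {M : Type*} [TopologicalSpace M] [ChartedSpace (EuclideanSpace ℝ (Fin 2)) M]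
  [IsManifold (𝓡 2) ∞ M] {ι : Type*} {g : RMetric 2 M} {σ : SpinStructure ι g}
  {n : ℕ} {N : Type*} [TopologicalSpace N] [ChartedSpace (EuclideanSpace ℝ (Fin n)) N]
  [IsManifold (𝓡 n) ∞ N] {h : RMetric n N}

variable (F : Fields σ h) (c : OpenPartialHomeomorph N (EuclideanSpace ℝ (Fin n))) (x : M)

lemma pair_add_left (s s' t : Fin n → ℍ[ℝ]) :
    F.pair c x (fun i => s i + s' i) t = F.pair c x s t + F.pair c x s' t := by
  simp only [pair, inner_add_left, mul_add, Finset.sum_add_distrib]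

lemma pair_add_right (s t t' : Fin n → ℍ[ℝ]) :
    F.pair c x s (fun i => t i + t' i) = F.pair c x s t + F.pair c x s t' := by
  simp only [pair, inner_add_right, mul_add, Finset.sum_add_distrib]

lemma pair_sub_right (s t t' : Fin n → ℍ[ℝ]) :
    F.pair c x s (fun i => t i - t' i) = F.pair c x s t - F.pair c x s t' := by
  simp only [pair, inner_sub_right, mul_sub, Finset.sum_sub_distrib]

lemma pair_smul_left (b : ℝ) (s t : Fin n → ℍ[ℝ]) :
    F.pair c x (fun i => b • s i) t = b * F.pair c x s t := by
  simp only [pair, inner_smul_left, Finset.mul_sum]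
  refine Finset.sum_congr rfl fun i _ => Finset.sum_congr rfl fun j _ => ?_
  simp only [conj_trivial]; ring

lemma pair_smul_right (b : ℝ) (s t : Fin n → ℍ[ℝ]) :
    F.pair c x s (fun i => b • t i) = b * F.pair c x s t := by
  simp only [pair, inner_smul_right, Finset.mul_sum]
  refine Finset.sum_congr rfl fun i _ => Finset.sum_congr rfl fun j _ => ?_
  ring

lemma pair_neg_left (s t : Fin n → ℍ[ℝ]) :
    F.pair c x (fun i => -s i) t = -F.pair c x s t := by
  simp only [pair, inner_neg_left, mul_neg, Finset.sum_neg_distrib]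

lemma pair_neg_right (s t : Fin n → ℍ[ℝ]) :
    F.pair c x s (fun i => -t i) = -F.pair c x s t := by
  simp only [pair, inner_neg_right, mul_neg, Finset.sum_neg_distrib]

lemma pair_sum_left {κ : Type*} (S : Finset κ) (s : κ → Fin n → ℍ[ℝ]) (t : Fin n → ℍ[ℝ]) :
    F.pair c x (fun i => ∑ k ∈ S, s k i) t = ∑ k ∈ S, F.pair c x (s k) t := by
  simp only [pair, sum_inner, Finset.mul_sum]
  rw [Finset.sum_comm]
  conv_lhs => rw [Finset.sum_comm]
  conv_rhs => rw [Finset.sum_comm]; enter [2, i]; rw [Finset.sum_comm]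

lemma pair_comm (s t : Fin n → ℍ[ℝ]) : F.pair c x s t = F.pair c x t s := by
  simp only [pair]
  rw [Finset.sum_comm]
  refine Finset.sum_congr rfl fun i _ => Finset.sum_congr rfl fun j _ => ?_
  rw [hLow_symm h c j i, real_inner_comm]

lemma pair_sum_right {κ : Type*} (S : Finset κ) (s : Fin n → ℍ[ℝ]) (t : κ → Fin n → ℍ[ℝ]) :
    F.pair c x s (fun i => ∑ k ∈ S, t k i) = ∑ k ∈ S, F.pair c x s (t k) := by
  rw [pair_comm, pair_sum_left]
  exact Finset.sum_congr rfl fun k _ => pair_comm _ _ _ _ _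

lemma pair_cliff_mul (α : Fin 2) (s t : Fin n → ℍ[ℝ]) :
    F.pair c x (fun i => cliff α * s i) t = -F.pair c x s (fun i => cliff α * t i) := by
  simp only [pair, inner_cliff_mul, mul_neg, Finset.sum_neg_distrib]

/-- A skew-adjoint operator has zero quadratic form. -/
lemma pair_cliff_mul_self (α : Fin 2) (s : Fin n → ℍ[ℝ]) :
    F.pair c x s (fun i => cliff α * s i) = 0 := by
  have := F.pair_cliff_mul c x α s s
  rw [pair_comm] at this
  linarith

lemma pair_cliff_cliff_mul (α β : Fin 2) (s t : Fin n → ℍ[ℝ]) :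
    F.pair c x (fun i => cliff α * cliff β * s i) t
      = F.pair c x s (fun i => cliff β * cliff α * t i) := by
  simp only [mul_assoc, pair_cliff_mul, neg_neg]

lemma pair_volume_mul (s t : Fin n → ℍ[ℝ]) :
    F.pair c x (fun i => cliff 0 * cliff 1 * s i) t
      = -F.pair c x s (fun i => cliff 0 * cliff 1 * t i) := by
  simp only [pair_cliff_cliff_mul, cliff_one_mul_zero, neg_mul, pair_neg_right]

lemma pair_volume_mul_self (s : Fin n → ℍ[ℝ]) :
    F.pair c x s (fun i => cliff 0 * cliff 1 * s i) = 0 := by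
  have := F.pair_volume_mul c x s s
  rw [pair_comm] at this
  linarith

/-- The pairing of a spinor times a tangent vector `u` with a vector spinor. -/
lemma pair_smul_spinor (u : Fin n → ℝ) (s : ℍ[ℝ]) (t : Fin n → ℍ[ℝ]) :
    F.pair c x (fun i => u i • s) t
      = inner ℝ s (∑ i, ∑ j, (hLow h c i j (F.yφ c x) * u i) • t j) := by
  simp only [pair, inner_smul_left, inner_sum, inner_smul_right, conj_trivial]
  refine Finset.sum_congr rfl fun i _ => Finset.sum_congr rfl fun j _ => ?_
  ring

/-- The inner product `φ^*h` of tangent vectors at `φ x`, in components. -/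
def hInner (u v : Fin n → ℝ) : ℝ := ∑ i, ∑ j, hLow h c i j (F.yφ c x) * (u i * v j)

lemma hInner_add_left (u u' v : Fin n → ℝ) :
    F.hInner c x (fun i => u i + u' i) v = F.hInner c x u v + F.hInner c x u' v := by
  simp only [hInner, add_mul, mul_add, Finset.sum_add_distrib]

lemma hInner_sub_left (u u' v : Fin n → ℝ) :
    F.hInner c x (fun i => u i - u' i) v = F.hInner c x u v - F.hInner c x u' v := by
  simp only [hInner, sub_mul, mul_sub, Finset.sum_sub_distrib]

lemma hInner_smul_left (b : ℝ) (u v : Fin n → ℝ) :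
    F.hInner c x (fun i => b * u i) v = b * F.hInner c x u v := by
  simp only [hInner, Finset.mul_sum]
  refine Finset.sum_congr rfl fun i _ => Finset.sum_congr rfl fun j _ => ?_
  ring

lemma hInner_comm (u v : Fin n → ℝ) : F.hInner c x u v = F.hInner c x v u := by
  simp only [hInner]
  rw [Finset.sum_comm]
  refine Finset.sum_congr rfl fun i _ => Finset.sum_congr rfl fun j _ => ?_
  rw [hLow_symm h c j i, mul_comm (u j)]

lemma hInner_sum_left {κ : Type*} (S : Finset κ) (u : κ → Fin n → ℝ) (v : Fin n → ℝ) :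
    F.hInner c x (fun i => ∑ k ∈ S, u k i) v = ∑ k ∈ S, F.hInner c x (u k) v := by
  simp only [hInner, Finset.sum_mul, Finset.mul_sum]
  conv_rhs => rw [Finset.sum_comm]; enter [2, i]; rw [Finset.sum_comm]

/-- The pairing of an inner product with a vector spinor. -/
lemma hInner_inner_left (s : ℍ[ℝ]) (t : Fin n → ℍ[ℝ]) (u : Fin n → ℝ) :
    F.hInner c x (fun i => inner ℝ s (t i)) u = F.pair c x (fun i => u i • s) t := by
  rw [hInner_comm]
  simp only [pair, hInner, inner_smul_left, conj_trivial]

end Pairing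

/-! ### Covariant derivatives along φ and their metric compatibility. -/

section Covariant

variable {M : Type*} [TopologicalSpace M] [ChartedSpace (EuclideanSpace ℝ (Fin 2)) M]
  [IsManifold (𝓡 2) ∞ M] {ι : Type*} {g : RMetric 2 M} {σ : SpinStructure ι g}
  {n : ℕ} {N : Type*} [TopologicalSpace N] [ChartedSpace (EuclideanSpace ℝ (Fin n)) N]
  [IsManifold (𝓡 n) ∞ N] {h : RMetric n N}

variable (F : Fields σ h) (a : ι) (c : OpenPartialHomeomorph N (EuclideanSpace ℝ (Fin n)))

/-- The connection matrix of `φ^*TN` in the frame `φ^*(∂/∂yⁱ)`. -/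
def gauge (α : Fin 2) (i k : Fin n) (x : M) : ℝ :=
  ∑ j, christoffel h c i j k (F.yφ c x) * F.dphi a c α j x

/-- The covariant derivative of a vector spinor. -/
def covPsi (α : Fin 2) (s : Fin n → M → ℍ[ℝ]) (i : Fin n) (x : M) : ℍ[ℝ] :=
  σ.nablaS a α (s i) x + ∑ k, F.gauge a c α i k x • s k x

/-- The second fundamental form `∇dφ`. -/
def hessφ (α β : Fin 2) (i : Fin n) (x : M) : ℝ :=
  dir (F.dphi a c β i) x (σ.e a α x) + ∑ k, F.gauge a c α i k x * F.dphi a c β k x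
    - ∑ η, σ.conn a α β η x * F.dphi a c η i x

/-- The second covariant derivative `∇²ψ`. -/
def hessψ (α β : Fin 2) (i : Fin n) (x : M) : ℍ[ℝ] :=
  F.covPsi a c α (F.nablaPsi a c β) i x - ∑ η, σ.conn a α β η x • F.nablaPsi a c η i x

/-- The covariant derivative of `Qχ`. -/
def nablaQ (α β : Fin 2) (x : M) : ℍ[ℝ] :=
  σ.nablaS a α (F.qchi a β) x - ∑ η, σ.conn a α β η x • F.qchi a η x

omit F c in
/-- The covariant derivative of a tensor with components `T α β` in an orthonormal frame. -/
def covTensor (σ : SpinStructure ι g) (a : ι) (γ : Fin 2) (T : Fin 2 → Fin 2 → M → ℝ)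
    (α β : Fin 2) (x : M) : ℝ :=
  dir (T α β) x (σ.e a γ x) - ∑ η, σ.conn a γ α η x * T η β x - ∑ η, σ.conn a γ β η x * T α η x

lemma nablaPsi_eq (α : Fin 2) (i : Fin n) :
    F.nablaPsi a c α i = F.covPsi a c α (F.psi a c) i := by
  funext x
  simp only [nablaPsi, covPsi, gauge, Finset.sum_smul]
  rw [Finset.sum_comm]

lemma tension_eq (i : Fin n) (x : M) : F.tension a c i x = ∑ α, F.hessφ a c α α i x := by
  simp only [tension, hessφ, gauge, Finset.sum_mul]
  refine Finset.sum_congr rfl fun α _ => ?_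
  rw [Finset.sum_comm (s := Finset.univ (α := Fin n))]
  ring

lemma dphiInner_eq (α β : Fin 2) (x : M) : F.dphiInner a c α β x
    = F.hInner c x (fun i => F.dphi a c α i x) (fun i => F.dphi a c β i x) := rfl

variable {F a c} (hc : c ∈ IsManifold.maximalAtlas (𝓡 n) ∞ N) {x : M} (hx : x ∈ F.dom a c)

include hc in
lemma smooth_gauge (α : Fin 2) (i k : Fin n) : SmoothOn (F.dom a c) (F.gauge a c α i k) :=
  SmoothOn.sum _ fun j => (smooth_comp_yφ hc (contDiffOn_christoffel h hc i j k)).mul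
    (smooth_dphi hc α j)

include hc hx in
-- Both connections are torsion-free: on the target the Christoffel symbols are symmetric, on the
-- domain the frame commutator is absorbed by the connection coefficients.
lemma hessφ_comm (α β : Fin 2) (i : Fin n) : F.hessφ a c α β i x = F.hessφ a c β α i x := by
  have h1 := σ.dir_dir_comm a (F.isOpen_dom a c) (F.dom_subset a c) (smooth_yφ_apply hc i) hx α β
  have h2 : ∀ α β, ∑ k, F.gauge a c α i k x * F.dphi a c β k x
      = ∑ k, F.gauge a c β i k x * F.dphi a c α k x := by
    intro α β
    simp only [gauge, Finset.sum_mul]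
    rw [Finset.sum_comm]
    refine Finset.sum_congr rfl fun j _ => Finset.sum_congr rfl fun k _ => ?_
    rw [christoffel_symm]; ring
  change dir (F.dphi a c β i) x (σ.e a α x) - dir (F.dphi a c α i) x (σ.e a β x)
    = ∑ η, (σ.conn a α β η x - σ.conn a β α η x) • F.dphi a c η i x at h1
  simp only [smul_eq_mul, sub_mul, Finset.sum_sub_distrib] at h1
  rw [hessφ, hessφ, h2 β α]
  linarith

include hc hx in
lemma dir_hLow (α : Fin 2) (i j : Fin n) :
    dir (fun p => hLow h c i j (F.yφ c p)) x (σ.e a α x)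
      = ∑ l, F.gauge a c α l i x * hLow h c l j (F.yφ c x)
        + ∑ l, F.gauge a c α l j x * hLow h c i l (F.yφ c x) := by
  rw [dir_comp_yφ hc (contDiffOn_hLow h hc i j) hx]
  simp only [pd_hLow h hc (yφ_mem hx), gauge, add_mul, Finset.sum_mul, Finset.sum_add_distrib]
  congr 1
  all_goals
    rw [Finset.sum_comm]
    exact Finset.sum_congr rfl fun i _ => Finset.sum_congr rfl fun j _ => by ring

omit F in
-- Transposes the connection matrix from the metric to the contracted tensor, so that
-- differentiating h produces the connection terms of the covariant derivative of P.
lemma sum_gauge_mul (A H P : Fin n → Fin n → ℝ) :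
    ∑ i, ∑ j, (∑ l, A l i * H l j + ∑ l, A l j * H i l) * P i j
      = ∑ i, ∑ j, H i j * (∑ k, A i k * P k j + ∑ k, A j k * P i k) := by
  simp only [add_mul, mul_add, Finset.sum_add_distrib, Finset.sum_mul, Finset.mul_sum]
  congr 1
  · conv_lhs => enter [2, i]; rw [Finset.sum_comm]
    rw [Finset.sum_comm]
    refine Finset.sum_congr rfl fun i _ => ?_
    rw [Finset.sum_comm]
    exact Finset.sum_congr rfl fun j _ => Finset.sum_congr rfl fun k _ => by ring
  · refine Finset.sum_congr rfl fun i _ => ?_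
    rw [Finset.sum_comm]
    exact Finset.sum_congr rfl fun j _ => Finset.sum_congr rfl fun k _ => by ring

include hc hx in
/-- The product rule for a contraction with the metric `φ^*h`. -/
lemma dir_sum_hLow_mul (α : Fin 2) {P : Fin n → Fin n → M → ℝ}
    (hP : ∀ i j, SmoothOn (F.dom a c) (P i j)) :
    dir (fun p => ∑ i, ∑ j, hLow h c i j (F.yφ c p) * P i j p) x (σ.e a α x)
      = ∑ i, ∑ j, hLow h c i j (F.yφ c x) * (dir (P i j) x (σ.e a α x)
        + (∑ k, F.gauge a c α i k x * P k j x + ∑ k, F.gauge a c α j k x * P i k x)) := by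
  have hH := fun i j => smooth_comp_yφ (F := F) (a := a) hc (contDiffOn_hLow h hc i j)
  rw [dir_sum _ _ fun i => mdiff (SmoothOn.sum _ fun j => (hH i j).mul (hP i j)) hx]
  simp only [mul_add (hLow h c _ _ _) (dir _ _ _), Finset.sum_add_distrib (f := fun j =>
    hLow h c _ j _ * dir _ _ _)]
  rw [Finset.sum_add_distrib, ← sum_gauge_mul (fun i k => F.gauge a c α i k x)
    (fun i j => hLow h c i j (F.yφ c x)) (fun i j => P i j x), ← Finset.sum_add_distrib]
  refine Finset.sum_congr rfl fun i _ => ?_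
  rw [dir_sum _ _ fun j => mdiff ((hH i j).mul (hP i j)) hx, ← Finset.sum_add_distrib]
  refine Finset.sum_congr rfl fun j _ => ?_
  rw [dir_mul _ (mdiff (hH i j) hx) (mdiff (hP i j) hx), dir_hLow hc hx]
  ring

include hc hx in
/-- The connection of `S ⊗ φ^*TN` is metric. -/
lemma dir_pair (α : Fin 2) {s t : Fin n → M → ℍ[ℝ]} (hs : ∀ i, SmoothOn (F.dom a c) (s i))
    (ht : ∀ i, SmoothOn (F.dom a c) (t i)) :
    dir (fun p => F.pair c p (fun i => s i p) (fun i => t i p)) x (σ.e a α x)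
      = F.pair c x (fun i => F.covPsi a c α s i x) (fun i => t i x)
        + F.pair c x (fun i => s i x) (fun i => F.covPsi a c α t i x) := by
  simp only [pair]
  rw [dir_sum_hLow_mul hc hx α fun i j => (hs i).inner (ht j), ← Finset.sum_add_distrib]
  refine Finset.sum_congr rfl fun i _ => ?_
  rw [← Finset.sum_add_distrib]
  refine Finset.sum_congr rfl fun j _ => ?_
  rw [σ.dir_inner_nablaS a α (mdiff (hs i) hx) (mdiff (ht j) hx)]
  simp only [covPsi, inner_add_left, inner_add_right, sum_inner, inner_sum, inner_smul_left,
    inner_smul_right, conj_trivial]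
  ring

include hc hx in
lemma dir_dphiInner (γ α β : Fin 2) : covTensor σ a γ (F.dphiInner a c) α β x
    = F.hInner c x (fun i => F.hessφ a c γ α i x) (fun i => F.dphi a c β i x)
      + F.hInner c x (fun i => F.dphi a c α i x) (fun i => F.hessφ a c γ β i x) := by
  have h1 : dir (F.dphiInner a c α β) x (σ.e a γ x) = F.hInner c x
      (fun i => dir (F.dphi a c α i) x (σ.e a γ x) + ∑ k, F.gauge a c γ i k x * F.dphi a c α k x)
        (fun i => F.dphi a c β i x) + F.hInner c x (fun i => F.dphi a c α i x)
      (fun i => dir (F.dphi a c β i) x (σ.e a γ x)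
        + ∑ k, F.gauge a c γ i k x * F.dphi a c β k x) := by
    refine (dir_sum_hLow_mul hc hx γ fun i j =>
      (smooth_dphi hc α i).mul (smooth_dphi hc β j)).trans ?_
    simp only [hInner]
    rw [← Finset.sum_add_distrib]
    refine Finset.sum_congr rfl fun i _ => ?_
    rw [← Finset.sum_add_distrib]
    refine Finset.sum_congr rfl fun j _ => ?_
    rw [dir_mul _ (mdiff (smooth_dphi hc α i) hx) (mdiff (smooth_dphi hc β j) hx)]
    simp only [add_mul, mul_add, Finset.sum_mul, Finset.mul_sum]
    simp only [mul_assoc, mul_left_comm (F.dphi a c α i x)]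
    ring
  rw [covTensor, h1]
  simp only [hessφ, hInner_sub_left, hInner_comm F c x (fun i => F.dphi a c α i x),
    hInner_sum_left, hInner_smul_left, dphiInner_eq]
  simp only [hInner_comm F c x (fun i => F.dphi a c _ i x) (fun i => F.dphi a c α i x)]
  ring

end Covariant

end Fields

namespace Fields

/-! ### Index manipulations for quadruple sums. -/

section Sums

variable {κ : Type*} [Fintype κ]

lemma sum_transpose_mul (A : κ → κ → ℝ) (f g : κ → ℝ) :
    ∑ p, (∑ m, A m p * f m) * g p = ∑ p, f p * ∑ m, A p m * g m := by
  simp only [Finset.sum_mul, Finset.mul_sum]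
  rw [Finset.sum_comm]
  exact Finset.sum_congr rfl fun _ _ => Finset.sum_congr rfl fun _ _ => by ring

lemma sum_four_rotate (f : κ → κ → κ → κ → ℝ) :
    ∑ p, ∑ q, ∑ r, ∑ s, f p q r s = ∑ q, ∑ r, ∑ s, ∑ p, f p q r s := by
  rw [Finset.sum_comm]
  refine Finset.sum_congr rfl fun q _ => ?_
  rw [Finset.sum_comm]
  refine Finset.sum_congr rfl fun r _ => ?_
  rw [Finset.sum_comm]

lemma sum_four_swap_pairs (f : κ → κ → κ → κ → ℝ) :
    ∑ p, ∑ q, ∑ r, ∑ s, f p q r s = ∑ p, ∑ q, ∑ r, ∑ s, f r s p q := by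
  rw [sum_four_rotate, sum_four_rotate (fun q r s p => f p q r s)]

lemma sum_four_swap_inside (f : κ → κ → κ → κ → ℝ) :
    ∑ p, ∑ q, ∑ r, ∑ s, f p q r s = ∑ p, ∑ q, ∑ r, ∑ s, f q p s r := by
  rw [Finset.sum_comm]
  exact Finset.sum_congr rfl fun _ _ => Finset.sum_congr rfl fun _ _ => Finset.sum_comm

/-- The derivation by `A` on the four slots of `R` is adjoint to the one on the slots of `G`. -/
lemma sum_four_derivation (A : κ → κ → ℝ) (R G : κ → κ → κ → κ → ℝ) :
    ∑ p, ∑ q, ∑ r, ∑ s, (∑ m, A m p * R m q r s + ∑ m, A m q * R p m r s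
        + ∑ m, A m r * R p q m s + ∑ m, A m s * R p q r m) * G p q r s
      = ∑ p, ∑ q, ∑ r, ∑ s, R p q r s * (∑ m, A p m * G m q r s + ∑ m, A q m * G p m r s
        + ∑ m, A r m * G p q m s + ∑ m, A s m * G p q r m) := by
  -- The last slot is a plain transposition; the other three are brought there by permuting the
  -- order of summation.
  have h1 : ∀ R G : κ → κ → κ → κ → ℝ, ∑ p, ∑ q, ∑ r, ∑ s, (∑ m, A m s * R p q r m) * G p q r s
      = ∑ p, ∑ q, ∑ r, ∑ s, R p q r s * ∑ m, A s m * G p q r m := fun R G =>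
    Finset.sum_congr rfl fun p _ => Finset.sum_congr rfl fun q _ => Finset.sum_congr rfl fun r _ =>
      sum_transpose_mul A (R p q r) (G p q r)
  simp only [add_mul, mul_add, Finset.sum_add_distrib]
  congr 1
  · congr 1
    · congr 1
      · rw [sum_four_rotate, sum_four_rotate (fun p q r s => R p q r s * _)]
        exact h1 (fun q r s p => R p q r s) (fun q r s p => G p q r s)
      · rw [sum_four_swap_pairs, sum_four_swap_pairs (fun p q r s => R p q r s * _)]
        exact h1 (fun r s p q => R p q r s) (fun r s p q => G p q r s)
    · rw [sum_four_swap_inside, sum_four_swap_inside (fun p q r s => R p q r s * _)]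
      exact h1 (fun q p s r => R p q r s) (fun q p s r => G p q r s)
  · exact h1 R G

end Sums
-- The derivative of the quartic curvature term Rm(ψ).
section RmPsi

variable {M : Type*} [TopologicalSpace M] [ChartedSpace (EuclideanSpace ℝ (Fin 2)) M]
  [IsManifold (𝓡 2) ∞ M] {ι : Type*} {g : RMetric 2 M} {σ : SpinStructure ι g}
  {n : ℕ} {N : Type*} [TopologicalSpace N] [ChartedSpace (EuclideanSpace ℝ (Fin n)) N]
  [IsManifold (𝓡 n) ∞ N] {h : RMetric n N}

variable {F : Fields σ h} {a : ι} {c : OpenPartialHomeomorph N (EuclideanSpace ℝ (Fin n))}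
  (hc : c ∈ IsManifold.maximalAtlas (𝓡 n) ∞ N) {x : M} (hx : x ∈ F.dom a c)

lemma pair_SR (x : M) (t : Fin n → ℍ[ℝ]) :
    F.pair c x (fun i => F.SR a c i x) t
      = ∑ p, ∑ q, ∑ r, ∑ s, riemLow h c p q r s (F.yφ c x) *
        ((inner ℝ (F.psi a c r x) (t p) : ℝ) * inner ℝ (F.psi a c q x) (F.psi a c s x)) := by
  simp only [pair, SR, sum_inner, inner_smul_left, conj_trivial, riemLow, Finset.sum_mul,
    Finset.mul_sum]
  rw [Finset.sum_comm]
  refine Finset.sum_congr rfl fun p _ => ?_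
  rw [Finset.sum_comm]
  refine Finset.sum_congr rfl fun q _ => ?_
  rw [Finset.sum_comm]
  refine Finset.sum_congr rfl fun r _ => ?_
  rw [Finset.sum_comm]
  refine Finset.sum_congr rfl fun s _ => Finset.sum_congr rfl fun i _ => ?_
  rw [hLow_symm h c i p, real_inner_comm (F.psi a c q x)]
  ring

lemma RmPsi_eq (x : M) : F.RmPsi a c x = ∑ p, ∑ q, ∑ r, ∑ s, riemLow h c p q r s (F.yφ c x) *
    ((inner ℝ (F.psi a c p x) (F.psi a c r x) : ℝ) * inner ℝ (F.psi a c q x) (F.psi a c s x)) := by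
  rw [RmPsi, pair_SR]
  simp only [real_inner_comm]

/-- The contraction of `∇R` with `ψ` in four slots and with `φ_* e_β`. -/
def nablaRmPsi (F : Fields σ h) (a : ι) (c : OpenPartialHomeomorph N (EuclideanSpace ℝ (Fin n)))
    (β : Fin 2) (x : M) : ℝ :=
  ∑ p, ∑ q, ∑ r, ∑ s, (∑ m, nablaRiem h c m p q r s (F.yφ c x) * F.dphi a c β m x) *
    ((inner ℝ (F.psi a c p x) (F.psi a c r x) : ℝ) * inner ℝ (F.psi a c q x) (F.psi a c s x))

include hc hx in
-- The index of S∇R(ψ) raised by h^{im} is lowered again by the pairing.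
lemma hInner_SNablaR (β : Fin 2) : F.hInner c x (fun i => F.SNablaR a c i x)
    (fun i => F.dphi a c β i x) = F.nablaRmPsi a c β x := by
  have h1 : ∀ Y : Fin n → ℝ, F.hInner c x (fun i => ∑ m, hUp h c i m (F.yφ c x) * Y m)
      (fun i => F.dphi a c β i x) = ∑ m, Y m * F.dphi a c β m x := by
    intro Y
    rw [hInner_comm]
    simp only [hInner]
    refine Finset.sum_congr rfl fun i _ => ?_
    calc ∑ j, hLow h c i j (F.yφ c x) * (F.dphi a c β i x * ∑ m, hUp h c j m (F.yφ c x) * Y m)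
        = F.dphi a c β i x * ∑ m, (∑ j, hLow h c i j (F.yφ c x) * hUp h c j m (F.yφ c x)) * Y m := by
          simp only [Finset.mul_sum, Finset.sum_mul]
          rw [Finset.sum_comm]
          exact Finset.sum_congr rfl fun i _ => Finset.sum_congr rfl fun j _ => by ring
      _ = _ := by
          simp [sum_hLow_mul_hUp h hc (yφ_mem hx), mul_comm]
  simp only [SNablaR]
  rw [h1, nablaRmPsi]
  simp only [Finset.sum_mul]
  rw [Finset.sum_comm]
  refine Finset.sum_congr rfl fun p _ => ?_
  rw [Finset.sum_comm]
  refine Finset.sum_congr rfl fun q _ => ?_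
  rw [Finset.sum_comm]
  refine Finset.sum_congr rfl fun r _ => ?_
  rw [Finset.sum_comm]
  refine Finset.sum_congr rfl fun s _ => Finset.sum_congr rfl fun i _ => ?_
  ring

include hc hx in
lemma dir_riemLow (β : Fin 2) (p q r s : Fin n) :
    dir (fun y => riemLow h c p q r s (F.yφ c y)) x (σ.e a β x)
      = ∑ m, nablaRiem h c m p q r s (F.yφ c x) * F.dphi a c β m x
        + (∑ m, F.gauge a c β m p x * riemLow h c m q r s (F.yφ c x)
          + ∑ m, F.gauge a c β m q x * riemLow h c p m r s (F.yφ c x)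
          + ∑ m, F.gauge a c β m r x * riemLow h c p q m s (F.yφ c x)
          + ∑ m, F.gauge a c β m s x * riemLow h c p q r m (F.yφ c x)) := by
  rw [dir_comp_yφ hc (contDiffOn_riemLow h hc p q r s) hx]
  have h1 : ∀ (i : Fin n) (R : Fin n → ℝ), ∑ m, F.gauge a c β m i x * R m
      = ∑ j, (∑ m, christoffel h c m j i (F.yφ c x) * R m) * F.dphi a c β j x := by
    intro i R
    simp only [gauge, Finset.sum_mul]
    rw [Finset.sum_comm]
    exact Finset.sum_congr rfl fun i _ => Finset.sum_congr rfl fun j _ => by ring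
  simp only [h1, ← Finset.sum_add_distrib]
  refine Finset.sum_congr rfl fun m _ => ?_
  rw [nablaRiem]
  simp only [Finset.sum_add_distrib]
  ring

include hc hx in
lemma dir_inner_psi (β : Fin 2) (p r : Fin n) :
    dir (fun y => (inner ℝ (F.psi a c p y) (F.psi a c r y) : ℝ)) x (σ.e a β x)
      = inner ℝ (F.nablaPsi a c β p x) (F.psi a c r x)
        + inner ℝ (F.psi a c p x) (F.nablaPsi a c β r x)
        - (∑ m, F.gauge a c β p m x * inner ℝ (F.psi a c m x) (F.psi a c r x)
          + ∑ m, F.gauge a c β r m x * inner ℝ (F.psi a c p x) (F.psi a c m x)) := by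
  rw [σ.dir_inner_nablaS a β (mdiff (smooth_psi hc p) hx) (mdiff (smooth_psi hc r) hx)]
  simp only [nablaPsi_eq, covPsi, inner_add_left, inner_add_right, sum_inner, inner_sum,
    inner_smul_left, inner_smul_right, conj_trivial]
  ring

include hc hx in
-- Leibniz rule for a full contraction. The factor 4 appears because the curvature symmetries make
-- all four positions of ∇ψ equivalent.
lemma dir_RmPsi (β : Fin 2) : dir (F.RmPsi a c) x (σ.e a β x) = F.nablaRmPsi a c β x
    + 4 * F.pair c x (fun i => F.SR a c i x) (fun i => F.nablaPsi a c β i x) := by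
  have hR := fun p q r s => smooth_comp_yφ (F := F) (a := a) hc (contDiffOn_riemLow h hc p q r s)
  have hS := fun p r => (smooth_psi (F := F) (a := a) hc p).inner (smooth_psi hc r)
  have hT := fun p q r s => (hR p q r s).mul ((hS p r).mul (hS q s))
  set S : Fin n → Fin n → ℝ := fun p r => inner ℝ (F.psi a c p x) (F.psi a c r x) with hSdef
  set E : Fin n → Fin n → ℝ := fun p r => inner ℝ (F.nablaPsi a c β p x) (F.psi a c r x) with hE
  set R : Fin n → Fin n → Fin n → Fin n → ℝ := fun p q r s => riemLow h c p q r s (F.yφ c x)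
    with hRdef
  have hSs : ∀ p r, S p r = S r p := fun p r => real_inner_comm _ _
  have h1 : dir (F.RmPsi a c) x (σ.e a β x) = ∑ p, ∑ q, ∑ r, ∑ s,
      ((∑ m, nablaRiem h c m p q r s (F.yφ c x) * F.dphi a c β m x) * (S p r * S q s)
      + (∑ m, F.gauge a c β m p x * R m q r s + ∑ m, F.gauge a c β m q x * R p m r s
          + ∑ m, F.gauge a c β m r x * R p q m s + ∑ m, F.gauge a c β m s x * R p q r m)
          * (S p r * S q s)
      - R p q r s * (∑ m, F.gauge a c β p m x * (S m r * S q s)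
        + ∑ m, F.gauge a c β q m x * (S p r * S m s)
        + ∑ m, F.gauge a c β r m x * (S p m * S q s)
        + ∑ m, F.gauge a c β s m x * (S p r * S q m))
      + R p q r s * (E p r * S q s) + R p q r s * (E r p * S q s)
      + R p q r s * (E q s * S p r) + R p q r s * (E s q * S p r)) := by
    rw [dir_congr (f' := fun y => ∑ p, ∑ q, ∑ r, ∑ s, riemLow h c p q r s (F.yφ c y) *
      ((inner ℝ (F.psi a c p y) (F.psi a c r y) : ℝ) * inner ℝ (F.psi a c q y) (F.psi a c s y)))
      _ (Filter.Eventually.of_forall fun y => RmPsi_eq y)]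
    rw [dir_sum _ _ fun p => mdiff (SmoothOn.sum _ fun q => SmoothOn.sum _ fun r =>
      SmoothOn.sum _ fun s => hT p q r s) hx]
    refine Finset.sum_congr rfl fun p _ => ?_
    rw [dir_sum _ _ fun q => mdiff (SmoothOn.sum _ fun r => SmoothOn.sum _ fun s => hT p q r s) hx]
    refine Finset.sum_congr rfl fun q _ => ?_
    rw [dir_sum _ _ fun r => mdiff (SmoothOn.sum _ fun s => hT p q r s) hx]
    refine Finset.sum_congr rfl fun r _ => ?_
    rw [dir_sum _ _ fun s => mdiff (hT p q r s) hx]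
    refine Finset.sum_congr rfl fun s _ => ?_
    rw [dir_mul _ (mdiff (hR p q r s) hx) (mdiff ((hS p r).mul (hS q s)) hx),
      dir_mul _ (mdiff (hS p r) hx) (mdiff (hS q s) hx), dir_riemLow hc hx, dir_inner_psi hc hx,
      dir_inner_psi hc hx, real_inner_comm (F.nablaPsi a c β r x),
      real_inner_comm (F.nablaPsi a c β s x)]
    have e1 : ∀ p r q s, ∑ m, F.gauge a c β p m x * (S m r * S q s)
        = (∑ m, F.gauge a c β p m x * S m r) * S q s := fun p r q s => by
      rw [Finset.sum_mul]; exact Finset.sum_congr rfl fun _ _ => by ring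
    have e2 : ∀ p r q s, ∑ m, F.gauge a c β q m x * (S p r * S m s)
        = (∑ m, F.gauge a c β q m x * S m s) * S p r := fun p r q s => by
      rw [Finset.sum_mul]; exact Finset.sum_congr rfl fun _ _ => by ring
    have e3 : ∀ p r q s, ∑ m, F.gauge a c β r m x * (S p m * S q s)
        = (∑ m, F.gauge a c β r m x * S p m) * S q s := fun p r q s => by
      rw [Finset.sum_mul]; exact Finset.sum_congr rfl fun _ _ => by ring
    have e4 : ∀ p r q s, ∑ m, F.gauge a c β s m x * (S p r * S q m)
        = (∑ m, F.gauge a c β s m x * S q m) * S p r := fun p r q s => by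
      rw [Finset.sum_mul]; exact Finset.sum_congr rfl fun _ _ => by ring
    rw [e1, e2, e3, e4]
    simp only [hSdef, hE, hRdef]
    ring
  have hpair : F.pair c x (fun i => F.SR a c i x) (fun i => F.nablaPsi a c β i x)
      = ∑ p, ∑ q, ∑ r, ∑ s, R p q r s * (E p r * S q s) := by
    rw [pair_SR]
    simp only [hE, hSdef, hRdef, real_inner_comm]
  -- R_{pqrs} = R_{rspq} exchanges the two arguments inside each inner product, while R_{pqrs} =
  -- R_{qpsr} exchanges the two inner products; together they identify the four terms containing ∇ψ.
  have hps : ∀ p q r s, R p q r s = R r s p q := fun p q r s =>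
    riemLow_pair_symm h hc (yφ_mem hx) p q r s
  have hqp : ∀ p q r s, R p q r s = R q p s r := fun p q r s => by
    simp only [hRdef]
    rw [riemLow_skew_left h hc (yφ_mem hx), riemLow_skew_right, neg_neg]
  have hE2 : ∑ p, ∑ q, ∑ r, ∑ s, R p q r s * (E r p * S q s)
      = ∑ p, ∑ q, ∑ r, ∑ s, R p q r s * (E p r * S q s) := by
    rw [sum_four_swap_pairs]
    simp only [← hps, hSs]
  have hE3 : ∑ p, ∑ q, ∑ r, ∑ s, R p q r s * (E q s * S p r)
      = ∑ p, ∑ q, ∑ r, ∑ s, R p q r s * (E p r * S q s) := by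
    rw [sum_four_swap_inside]
    simp only [← hqp]
  have hE4 : ∑ p, ∑ q, ∑ r, ∑ s, R p q r s * (E s q * S p r)
      = ∑ p, ∑ q, ∑ r, ∑ s, R p q r s * (E p r * S q s) := by
    rw [sum_four_swap_inside, ← hE2]
    simp only [← hqp]
  -- The connection terms from ∂R and those from ∂ψ cancel, being transposes of each other.
  have hder := sum_four_derivation (fun m p => F.gauge a c β m p x) R
    (fun p q r s => S p r * S q s)
  rw [h1, hpair, nablaRmPsi]
  simp only [Finset.sum_add_distrib, Finset.sum_sub_distrib] at hder hE2 hE3 hE4 ⊢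
  linarith

end RmPsi

end Fields

namespace Fields

/-! ### Curvature of S ⊗ φ^*TN and the commutator of second covariant derivatives. -/

section Curvature

variable {M : Type*} [TopologicalSpace M] [ChartedSpace (EuclideanSpace ℝ (Fin 2)) M]
  [IsManifold (𝓡 2) ∞ M] {ι : Type*} {g : RMetric 2 M} {σ : SpinStructure ι g}
  {n : ℕ} {N : Type*} [TopologicalSpace N] [ChartedSpace (EuclideanSpace ℝ (Fin n)) N]
  [IsManifold (𝓡 n) ∞ N] {h : RMetric n N}

variable {F : Fields σ h} {a : ι} {c : OpenPartialHomeomorph N (EuclideanSpace ℝ (Fin n))}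
  (hc : c ∈ IsManifold.maximalAtlas (𝓡 n) ∞ N) {x : M} (hx : x ∈ F.dom a c)

/-- The curvature of `φ^*TN` in the directions `e_α`, `e_β`. -/
def pullCurv (F : Fields σ h) (a : ι) (c : OpenPartialHomeomorph N (EuclideanSpace ℝ (Fin n)))
    (α β : Fin 2) (i k : Fin n) (x : M) : ℝ :=
  ∑ l, ∑ j, riem h c i k l j (F.yφ c x) * (F.dphi a c α l x * F.dphi a c β j x)

include hc hx in
lemma dir_gauge (α β : Fin 2) (i k : Fin n) : dir (F.gauge a c β i k) x (σ.e a α x)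
    = ∑ l, ∑ j, pd l (christoffel h c i j k) (F.yφ c x) * (F.dphi a c α l x * F.dphi a c β j x)
      + ∑ j, christoffel h c i j k (F.yφ c x) * dir (F.dphi a c β j) x (σ.e a α x) := by
  have hG := fun j => smooth_comp_yφ (F := F) (a := a) hc (contDiffOn_christoffel h hc i j k)
  have hd := fun j => smooth_dphi (F := F) (a := a) hc β j
  unfold gauge
  rw [dir_sum _ _ fun j => mdiff ((hG j).mul (hd j)) hx, Finset.sum_comm, ← Finset.sum_add_distrib]
  refine Finset.sum_congr rfl fun j _ => ?_
  rw [dir_mul _ (mdiff (hG j) hx) (mdiff (hd j) hx), dir_comp_yφ hc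
    (contDiffOn_christoffel h hc i j k) hx, Finset.sum_mul]
  congr 1
  exact Finset.sum_congr rfl fun l _ => by ring

include hc hx in
/-- The structure equation for the connection of `φ^*TN`. -/
lemma gauge_structure (α β : Fin 2) (i k : Fin n) :
    dir (F.gauge a c β i k) x (σ.e a α x) - dir (F.gauge a c α i k) x (σ.e a β x)
      - ∑ η, (σ.conn a α β η x - σ.conn a β α η x) * F.gauge a c η i k x
      + (∑ m, F.gauge a c α i m x * F.gauge a c β m k x
        - ∑ m, F.gauge a c β i m x * F.gauge a c α m k x) = F.pullCurv a c α β i k x := by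
  have hcomm : ∀ j, dir (F.dphi a c β j) x (σ.e a α x) = dir (F.dphi a c α j) x (σ.e a β x)
      + ∑ η, (σ.conn a α β η x - σ.conn a β α η x) * F.dphi a c η j x := fun j => by
    have := σ.dir_dir_comm a (F.isOpen_dom a c) (F.dom_subset a c) (smooth_yφ_apply hc j) hx α β
    change dir (F.dphi a c β j) x (σ.e a α x) - dir (F.dphi a c α j) x (σ.e a β x)
      = ∑ η, (σ.conn a α β η x - σ.conn a β α η x) • F.dphi a c η j x at this
    simp only [smul_eq_mul] at this
    linarith
  have e1 : ∑ j, christoffel h c i j k (F.yφ c x) * dir (F.dphi a c β j) x (σ.e a α x)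
      = ∑ j, christoffel h c i j k (F.yφ c x) * dir (F.dphi a c α j) x (σ.e a β x)
      + ∑ η, (σ.conn a α β η x - σ.conn a β α η x) * F.gauge a c η i k x := by
    simp only [hcomm, mul_add, Finset.sum_add_distrib, gauge, Finset.mul_sum]
    congr 1
    rw [Finset.sum_comm]
    exact Finset.sum_congr rfl fun η _ => Finset.sum_congr rfl fun j _ => by ring
  have e2 : ∑ l, ∑ j, pd l (christoffel h c i j k) (F.yφ c x)
        * (F.dphi a c β l x * F.dphi a c α j x)
      = ∑ l, ∑ j, pd j (christoffel h c i l k) (F.yφ c x)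
        * (F.dphi a c α l x * F.dphi a c β j x) := by
    rw [Finset.sum_comm]
    exact Finset.sum_congr rfl fun η _ => Finset.sum_congr rfl fun j _ => by ring
  have e3 : ∀ α β, ∑ m, F.gauge a c α i m x * F.gauge a c β m k x
      = ∑ l, ∑ j, (∑ m, christoffel h c i l m (F.yφ c x) * christoffel h c m j k (F.yφ c x))
        * (F.dphi a c α l x * F.dphi a c β j x) := by
    intro α β
    simp only [gauge, Finset.sum_mul, Finset.mul_sum]
    rw [Finset.sum_comm]
    conv_lhs => enter [2, l]; rw [Finset.sum_comm]
    rw [Finset.sum_comm]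
    refine Finset.sum_congr rfl fun l _ => Finset.sum_congr rfl fun j _ =>
      Finset.sum_congr rfl fun m _ => by ring
  have e4 : ∑ m, F.gauge a c β i m x * F.gauge a c α m k x
      = ∑ l, ∑ j, (∑ m, christoffel h c i j m (F.yφ c x) * christoffel h c m l k (F.yφ c x))
        * (F.dphi a c α l x * F.dphi a c β j x) := by
    rw [e3, Finset.sum_comm]
    exact Finset.sum_congr rfl fun η _ => Finset.sum_congr rfl fun j _ => by ring
  rw [dir_gauge hc hx, dir_gauge hc hx, e1, e2, e3, e4]
  simp only [pullCurv, riem, add_mul, sub_mul, Finset.sum_add_distrib, Finset.sum_sub_distrib]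
  ring

include hc hx in
lemma dir_nablaPsi (α β : Fin 2) (i : Fin n) :
    dir (F.nablaPsi a c β i) x (σ.e a α x)
      = dir (fun p => dir (F.psi a c i) p (σ.e a β p)) x (σ.e a α x)
        + ((dir (σ.conn a β 0 1) x (σ.e a α x) / 2) • (cliff 0 * cliff 1 * F.psi a c i x)
          + (σ.conn a β 0 1 x / 2) • (cliff 0 * cliff 1 * dir (F.psi a c i) x (σ.e a α x)))
        + (∑ k, dir (F.gauge a c β i k) x (σ.e a α x) • F.psi a c k x
          + ∑ k, F.gauge a c β i k x • dir (F.psi a c k) x (σ.e a α x)) := by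
  have hψ := fun i => smooth_psi (F := F) (a := a) hc i
  have hA := fun k => smooth_gauge (F := F) (a := a) hc β i k
  have hw : SmoothOn (F.dom a c) (fun p => (1 / 2) * σ.conn a β 0 1 p) :=
    SmoothOn.mul contMDiffOn_const (smooth_conn β 0 1)
  have h1 : F.nablaPsi a c β i = fun p => dir (F.psi a c i) p (σ.e a β p)
      + ((1 / 2) * σ.conn a β 0 1 p) • (cliff 0 * cliff 1 * F.psi a c i p)
      + ∑ k, F.gauge a c β i k p • F.psi a c k p := by
    funext p
    rw [nablaPsi_eq, covPsi, SpinStructure.nablaS, SpinStructure.spinTerm_eq, one_div_mul_eq_div]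
  have s1 := smooth_dir (hψ i) β
  have s2 := hw.smul ((hψ i).cliff_mul (cliff 0 * cliff 1))
  have s3 := fun k => (hA k).smul (hψ k)
  rw [h1, dir_add _ (mdiff (SmoothOn.fun_add s1 s2) hx) (mdiff (SmoothOn.sum _ s3) hx),
    dir_add _ (mdiff s1 hx) (mdiff s2 hx), dir_sum _ _ fun k => mdiff (s3 k) hx,
    dir_smul _ (mdiff hw hx) (mdiff ((hψ i).cliff_mul (cliff 0 * cliff 1)) hx),
    dir_const_mul _ _ (mdiff (smooth_conn β 0 1) hx),
    dir_cliff_mul _ _ (mdiff (hψ i) hx), ← Finset.sum_add_distrib, one_div_mul_eq_div,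
    one_div_mul_eq_div]
  congr 1
  refine Finset.sum_congr rfl fun k _ => ?_
  rw [dir_smul _ (mdiff (hA k) hx) (mdiff (hψ k) hx)]

include hc hx in
/-- The commutator of covariant derivatives of `ψ`: a multiple of the volume element, from the
curvature of the spinor bundle, and the curvature of `φ^*TN`. -/
lemma hessψ_sub_hessψ (α β : Fin 2) : ∃ b : ℝ, ∀ i,
    F.hessψ a c α β i x - F.hessψ a c β α i x = b • (cliff 0 * cliff 1 * F.psi a c i x)
      + ∑ k, F.pullCurv a c α β i k x • F.psi a c k x := by
  -- The scalar is half the exterior derivative of the connection form g(∇e_0, e_1) evaluated on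
  -- (e_α, e_β); there is no quadratic term, since SO(2) is abelian.
  refine ⟨(dir (σ.conn a β 0 1) x (σ.e a α x) - dir (σ.conn a α 0 1) x (σ.e a β x)
    - ∑ η, (σ.conn a α β η x - σ.conn a β α η x) * σ.conn a η 0 1 x) / 2, fun i => ?_⟩
  have hψ := fun i => smooth_psi (F := F) (a := a) hc i
  have hcomm := σ.dir_dir_comm a (F.isOpen_dom a c) (F.dom_subset a c) (hψ i) hx α β
  have hN : ∀ γ m, F.nablaPsi a c γ m x = dir (F.psi a c m) x (σ.e a γ x)
      + (σ.conn a γ 0 1 x / 2) • (cliff 0 * cliff 1 * F.psi a c m x)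
      + ∑ k, F.gauge a c γ m k x • F.psi a c k x := fun γ m => by
    rw [nablaPsi_eq, covPsi, SpinStructure.nablaS, SpinStructure.spinTerm_eq]
  have hcov : ∀ α β, F.covPsi a c α (F.nablaPsi a c β) i x
      = dir (F.nablaPsi a c β i) x (σ.e a α x)
        + (σ.conn a α 0 1 x / 2) • (cliff 0 * cliff 1 * F.nablaPsi a c β i x)
        + ∑ m, F.gauge a c α i m x • F.nablaPsi a c β m x := fun α β => by
    rw [covPsi, SpinStructure.nablaS, SpinStructure.spinTerm_eq]
  have hsum : ∀ α β, ∑ m, F.gauge a c α i m x • F.nablaPsi a c β m x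
      = ∑ m, F.gauge a c α i m x • dir (F.psi a c m) x (σ.e a β x)
        + (σ.conn a β 0 1 x / 2) • ∑ m, F.gauge a c α i m x • (cliff 0 * cliff 1 * F.psi a c m x)
        + ∑ k, (∑ m, F.gauge a c α i m x * F.gauge a c β m k x) • F.psi a c k x := by
    intro α β
    simp only [hN, smul_add, Finset.sum_add_distrib, Finset.smul_sum, Finset.sum_smul, smul_smul]
    congr 1
    · congr 1
      exact Finset.sum_congr rfl fun m _ => by rw [mul_comm]
    · rw [Finset.sum_comm]
  have hmul : ∀ β, cliff 0 * cliff 1 * F.nablaPsi a c β i x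
      = cliff 0 * cliff 1 * dir (F.psi a c i) x (σ.e a β x)
        + (σ.conn a β 0 1 x / 2) • (cliff 0 * cliff 1 * (cliff 0 * cliff 1 * F.psi a c i x))
        + ∑ k, F.gauge a c β i k x • (cliff 0 * cliff 1 * F.psi a c k x) := by
    intro β
    rw [hN, mul_add, mul_add, Finset.mul_sum]
    simp only [mul_smul_comm]
  have hcurv : ∑ k, F.pullCurv a c α β i k x • F.psi a c k x
      = ∑ k, dir (F.gauge a c β i k) x (σ.e a α x) • F.psi a c k x
        - ∑ k, dir (F.gauge a c α i k) x (σ.e a β x) • F.psi a c k x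
        - ∑ η, (σ.conn a α β η x - σ.conn a β α η x) • ∑ k, F.gauge a c η i k x • F.psi a c k x
        + (∑ k, (∑ m, F.gauge a c α i m x * F.gauge a c β m k x) • F.psi a c k x
          - ∑ k, (∑ m, F.gauge a c β i m x * F.gauge a c α m k x) • F.psi a c k x) := by
    simp only [← gauge_structure hc hx, add_smul, sub_smul, Finset.sum_add_distrib,
      Finset.sum_sub_distrib, Finset.sum_smul, Finset.smul_sum, smul_smul]
    congr 2
    rw [Finset.sum_comm]
  rw [hessψ, hessψ, hcov, hcov, dir_nablaPsi hc hx, dir_nablaPsi hc hx, hsum, hsum, hmul, hmul,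
    hcurv]
  simp only [hN, Fin.sum_univ_two] at hcomm ⊢
  rw [sub_eq_iff_eq_add] at hcomm
  rw [hcomm]
  module

include hc hx in
/-- The curvature term in the divergence is minus that in the equation for `φ`. -/
lemma sum_pair_pullCurv (β : Fin 2) :
    ∑ α, F.pair c x (fun i => F.psi a c i x)
      (fun i => cliff α * ∑ k, F.pullCurv a c α β i k x • F.psi a c k x)
      = -F.hInner c x (fun i => F.RmDphi a c i x) (fun i => F.dphi a c β i x) := by
  have h1 : ∀ α, F.pair c x (fun i => F.psi a c i x)
      (fun i => cliff α * ∑ k, F.pullCurv a c α β i k x • F.psi a c k x)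
      = ∑ p, ∑ q, ∑ r, ∑ s, riemLow h c p q r s (F.yφ c x) *
        ((inner ℝ (F.psi a c p x) (cliff α * F.psi a c q x) : ℝ)
          * F.dphi a c α r x * F.dphi a c β s x) := by
    intro α
    simp only [pair, pullCurv, riemLow, Finset.mul_sum, Finset.sum_mul, inner_sum, mul_smul_comm,
      inner_smul_right, Finset.sum_smul]
    refine Finset.sum_congr rfl fun p _ => ?_
    rw [Finset.sum_comm]
    refine Finset.sum_congr rfl fun q _ => ?_
    rw [Finset.sum_comm]
    refine Finset.sum_congr rfl fun r _ => ?_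
    rw [Finset.sum_comm]
    refine Finset.sum_congr rfl fun s _ => Finset.sum_congr rfl fun i _ => ?_
    ring
  have h2 : F.hInner c x (fun i => F.RmDphi a c i x) (fun i => F.dphi a c β i x)
      = ∑ α, ∑ p, ∑ q, ∑ r, ∑ s, riemLow h c p q r s (F.yφ c x) *
        ((inner ℝ (F.psi a c r x) (cliff α * F.psi a c s x) : ℝ)
          * F.dphi a c α q x * F.dphi a c β p x) := by
    simp only [RmDphi]
    rw [hInner_sum_left]
    refine Finset.sum_congr rfl fun α _ => ?_
    simp only [hInner, riemLow, Finset.mul_sum, Finset.sum_mul]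
    rw [Finset.sum_comm]
    refine Finset.sum_congr rfl fun p _ => ?_
    rw [Finset.sum_comm]
    refine Finset.sum_congr rfl fun q _ => ?_
    rw [Finset.sum_comm]
    refine Finset.sum_congr rfl fun r _ => ?_
    rw [Finset.sum_comm]
    refine Finset.sum_congr rfl fun s _ => Finset.sum_congr rfl fun i _ => ?_
    rw [hLow_symm h c i p]
    ring
  rw [h2, ← Finset.sum_neg_distrib]
  refine Finset.sum_congr rfl fun α _ => ?_
  rw [h1, sum_four_swap_pairs]
  simp only [← Finset.sum_neg_distrib]
  rw [Finset.sum_comm]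
  refine Finset.sum_congr rfl fun p _ => Finset.sum_congr rfl fun q _ =>
    Finset.sum_congr rfl fun r _ => Finset.sum_congr rfl fun s _ => ?_
  -- Pair symmetry moves the ψ slots to the other index pair; the φ_* slots then stand in the
  -- opposite order, which gives the minus sign.
  rw [riemLow_pair_symm h hc (yφ_mem hx) r s q p, riemLow_skew_left h hc (yφ_mem hx) q p]
  ring

end Curvature

end Fields

namespace Fields

/-! ### Covariant derivatives of the tensors W and Z. -/

section Tensors

variable {M : Type*} [TopologicalSpace M] [ChartedSpace (EuclideanSpace ℝ (Fin 2)) M]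
  [IsManifold (𝓡 2) ∞ M] {ι : Type*} {g : RMetric 2 M} {σ : SpinStructure ι g}
  {n : ℕ} {N : Type*} [TopologicalSpace N] [ChartedSpace (EuclideanSpace ℝ (Fin n)) N]
  [IsManifold (𝓡 n) ∞ N] {h : RMetric n N}

/-- The tensor `⟨ψ, e_α · ∇̃_{e_β} ψ⟩`. -/
def tensorW (F : Fields σ h) (a : ι) (c : OpenPartialHomeomorph N (EuclideanSpace ℝ (Fin n)))
    (α β : Fin 2) (x : M) : ℝ :=
  F.pair c x (fun i => F.psi a c i x) (fun i => cliff α * F.nablaPsi a c β i x)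

/-- The tensor `⟨(Qχ)^α ⊗ φ_* e_β, ψ⟩`. -/
def tensorZ (F : Fields σ h) (a : ι) (c : OpenPartialHomeomorph N (EuclideanSpace ℝ (Fin n)))
    (α β : Fin 2) (x : M) : ℝ :=
  F.pair c x (fun i => F.tensorDphi a c (F.qchi a α x) β x i) (fun i => F.psi a c i x)

variable {F : Fields σ h} {a : ι} {c : OpenPartialHomeomorph N (EuclideanSpace ℝ (Fin n))}
  (hc : c ∈ IsManifold.maximalAtlas (𝓡 n) ∞ N) {x : M} (hx : x ∈ F.dom a c)

include hc in
lemma smooth_tensorW (α β : Fin 2) : SmoothOn (F.dom a c) (F.tensorW a c α β) :=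
  smooth_pair hc (smooth_psi hc) fun i => (smooth_nablaPsi hc β i).cliff_mul (cliff α)

include hc in
lemma smooth_tensorZ (α β : Fin 2) : SmoothOn (F.dom a c) (F.tensorZ a c α β) :=
  smooth_pair hc (smooth_tensorDphi hc (smooth_qchi α) β) (smooth_psi hc)

include hx in
lemma covPsi_cliff_mul (γ α : Fin 2) {s : Fin n → M → ℍ[ℝ]} (hs : ∀ i, SmoothOn (F.dom a c) (s i))
    (i : Fin n) : F.covPsi a c γ (fun i p => cliff α * s i p) i x
      = cliff α * F.covPsi a c γ s i x + ∑ η, σ.conn a γ α η x • (cliff η * s i x) := by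
  rw [covPsi, σ.nablaS_cliff_mul a γ α (mdiff (hs i) hx), covPsi, mul_add, Finset.mul_sum]
  simp only [mul_smul_comm]
  abel

include hc hx in
lemma covPsi_tensorDphi (γ β : Fin 2) {s : M → ℍ[ℝ]} (hs : SmoothOn (F.dom a c) s)
    (i : Fin n) : F.covPsi a c γ (fun i p => F.tensorDphi a c (s p) β p i) i x
      = F.tensorDphi a c (σ.nablaS a γ s x) β x i
        + (F.hessφ a c γ β i x + ∑ η, σ.conn a γ β η x * F.dphi a c η i x) • s x := by
  have h1 : F.covPsi a c γ (fun i p => F.tensorDphi a c (s p) β p i) i x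
      = σ.nablaS a γ (fun p => F.dphi a c β i p • s p) x
        + ∑ k, F.gauge a c γ i k x • (F.dphi a c β k x • s x) := rfl
  rw [h1, σ.nablaS_smul a γ (mdiff (smooth_dphi hc β i) hx) (mdiff hs hx), tensorDphi, hessφ]
  simp only [smul_smul, ← Finset.sum_smul]
  module

include hc hx in
-- The terms in which the frame itself is differentiated are exactly those that `covTensor`
-- subtracts, so the Leibniz rule holds covariantly.
lemma covTensor_tensorW (γ α β : Fin 2) : covTensor σ a γ (F.tensorW a c) α β x
    = F.pair c x (fun i => F.nablaPsi a c γ i x) (fun i => cliff α * F.nablaPsi a c β i x)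
      + F.pair c x (fun i => F.psi a c i x) (fun i => cliff α * F.hessψ a c γ β i x) := by
  have hN := fun i => smooth_nablaPsi (F := F) (a := a) hc β i
  have h1 := dir_pair hc hx γ (smooth_psi hc) fun i => (hN i).cliff_mul (cliff α)
  have h2 : ∀ i, F.covPsi a c γ (fun i p => cliff α * F.nablaPsi a c β i p) i x
      = cliff α * F.hessψ a c γ β i x
        + ∑ η, σ.conn a γ β η x • (cliff α * F.nablaPsi a c η i x)
        + ∑ η, σ.conn a γ α η x • (cliff η * F.nablaPsi a c β i x) := fun i => by
    rw [covPsi_cliff_mul hx γ α hN, hessψ, mul_sub, Finset.mul_sum]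
    simp only [mul_smul_comm]
    abel
  simp only [h2, ← nablaPsi_eq, pair_add_right, pair_sum_right, pair_smul_right] at h1
  rw [covTensor]
  change dir (F.tensorW a c α β) x (σ.e a γ x) = _ at h1
  rw [h1]
  simp only [tensorW]
  ring

include hc hx in
lemma covTensor_tensorZ (γ α β : Fin 2) : covTensor σ a γ (F.tensorZ a c) α β x
    = F.pair c x (fun i => F.tensorDphi a c (F.nablaQ a γ α x) β x i) (fun i => F.psi a c i x)
      + F.pair c x (fun i => F.hessφ a c γ β i x • F.qchi a α x) (fun i => F.psi a c i x)
      + F.pair c x (fun i => F.tensorDphi a c (F.qchi a α x) β x i)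
        (fun i => F.nablaPsi a c γ i x) := by
  have h1 := dir_pair hc hx γ (smooth_tensorDphi hc (smooth_qchi (F := F) α) β) (smooth_psi hc)
  have h2 : ∀ i, F.covPsi a c γ (fun i p => F.tensorDphi a c (F.qchi a α p) β p i) i x
      = F.tensorDphi a c (F.nablaQ a γ α x) β x i + F.hessφ a c γ β i x • F.qchi a α x
        + ∑ η, σ.conn a γ α η x • F.tensorDphi a c (F.qchi a η x) β x i
        + ∑ η, σ.conn a γ β η x • F.tensorDphi a c (F.qchi a α x) η x i := fun i => by
    rw [covPsi_tensorDphi hc hx γ β (smooth_qchi α)]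
    simp only [nablaQ, tensorDphi, Fin.sum_univ_two]
    module
  simp only [h2, ← nablaPsi_eq, pair_add_left, pair_sum_left, pair_smul_left] at h1
  rw [covTensor]
  change dir (F.tensorZ a c α β) x (σ.e a γ x) = _ at h1
  rw [h1]
  simp only [tensorZ]
  ring

omit [IsManifold (𝓡 n) ∞ N] in
/-- The derivative of the trace of a tensor. -/
lemma dir_trace {S : Fin 2 → Fin 2 → M → ℝ} {x : M}
    (hS : ∀ α, MDifferentiableAt (𝓡 2) 𝓘(ℝ, ℝ) (S α α) x) (γ : Fin 2) :
    dir (fun p => ∑ α, S α α p) x (σ.e a γ x) = ∑ α, covTensor σ a γ S α α x := by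
  rw [dir_sum _ _ hS]
  simp only [covTensor, Fin.sum_univ_two, σ.conn_self, σ.conn_skew a γ 1 0]
  ring

end Tensors

/-! ### γ-traceless gravitinos and the supercurrent. -/

section Gravitino

variable {M : Type*} [TopologicalSpace M] [ChartedSpace (EuclideanSpace ℝ (Fin 2)) M]
  [IsManifold (𝓡 2) ∞ M] {ι : Type*} {g : RMetric 2 M} {σ : SpinStructure ι g}
  {n : ℕ} {N : Type*} [TopologicalSpace N] [ChartedSpace (EuclideanSpace ℝ (Fin n)) N]
  [IsManifold (𝓡 n) ∞ N] {h : RMetric n N}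

variable {F : Fields σ h} {a : ι} {c : OpenPartialHomeomorph N (EuclideanSpace ℝ (Fin n))}

lemma volume_mul_volume_mul (s : ℍ[ℝ]) : cliff 0 * cliff 1 * (cliff 0 * cliff 1 * s) = -s := by
  ext <;> simp

lemma sum_cliff_chi (α : Fin 2) (x : M) :
    ∑ η, cliff η * cliff α * F.chi a η x = (-2 : ℝ) • F.qchi a α x := by
  rw [qchi]
  module

lemma xi_eq (β : Fin 2) (x : M) : F.xi a β x = (-2 : ℝ) • F.qchi a β x := sum_cliff_chi β x

/-- This is the γ-trace condition e_α·(Qχ)^α = 0 solved for the second component; it holds because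
e_α·e_β·e_α = 0, summed over α, in dimension two. -/
lemma qchi_one (x : M) : F.qchi a 1 x = -(cliff 0 * cliff 1) * F.qchi a 0 x := by
  simp only [qchi, Fin.sum_univ_two]
  ext <;> simp <;> ring

/-- The γ-trace condition is parallel, since e_0·e_1 commutes with ∇^s. Hence ∇_γ Qχ is an
admissible test gravitino for the supercurrent. -/
lemma nablaQ_one {x : M} (hx : x ∈ F.dom a c) (γ : Fin 2) :
    F.nablaQ a γ 1 x = -(cliff 0 * cliff 1) * F.nablaQ a γ 0 x := by
  have h1 : F.qchi a 1 = fun p => -(cliff 0 * cliff 1) * F.qchi a 0 p := funext fun p => qchi_one p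
  have h2 : σ.nablaS a γ (F.qchi a 1) x = -(cliff 0 * cliff 1) * σ.nablaS a γ (F.qchi a 0) x := by
    rw [h1, SpinStructure.nablaS, dir_cliff_mul _ _ (mdiff (smooth_qchi (c := c) 0) hx),
      SpinStructure.nablaS, SpinStructure.spinTerm_eq, SpinStructure.spinTerm_eq, mul_add,
      mul_smul_comm, neg_mul, neg_mul, neg_mul, mul_neg]
  rw [nablaQ, nablaQ, h2]
  simp only [Fin.sum_univ_two, σ.conn_self, σ.conn_skew a γ 1 0, qchi_one]
  simp only [mul_sub, mul_add, mul_smul_comm, neg_mul, mul_neg, volume_mul_volume_mul]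
  module

/-- The connection terms in `divXi` and `nablaQ` have opposite signs and exchanged indices, which
agree by skew-symmetry. -/
lemma divXi_eq {x : M} (hx : x ∈ F.dom a c) :
    F.divXi a x = (-2 : ℝ) • ∑ β, F.nablaQ a β β x := by
  have h1 : ∀ β, F.xi a β = fun p => (-2 : ℝ) • F.qchi a β p := fun β => funext fun p => xi_eq β p
  have h2 : ∀ β, σ.nablaS a β (F.xi a β) x = (-2 : ℝ) • σ.nablaS a β (F.qchi a β) x := fun β => by
    rw [h1, σ.nablaS_smul (f := fun _ => (-2 : ℝ)) a β mdifferentiableAt_const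
      (mdiff (smooth_qchi (c := c) β) hx), dir_const]
    simp
  simp only [divXi, h2, xi_eq, nablaQ, Fin.sum_univ_two, σ.conn_self, σ.conn_skew a _ 1 0]
  module

/-- The vanishing of the supercurrent, tested with a `γ`-traceless gravitino `P`. -/
lemma psiSq_mul_inner_qchi {x : M} (hJ : ∀ α, F.supercurrent a c α x = 0) (P : Fin 2 → ℍ[ℝ])
    (hP : P 1 = -(cliff 0 * cliff 1) * P 0) :
    F.psiSq a c x * ∑ α, (inner ℝ (F.qchi a α x) (P α) : ℝ)
      = -2 * ∑ β, F.pair c x (fun i => F.tensorDphi a c (P β) β x i)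
        (fun i => F.psi a c i x) := by
  -- Since e_η·e_α·χ^η = -2(Qχ)^α, the equation J^α = 0 is solved for the contraction of φ_* with ψ.
  have h1 : ∀ α, ∑ β, F.contract a c β x (fun i => cliff β * cliff α * F.psi a c i x)
      = F.psiSq a c x • F.qchi a α x := by
    intro α
    have h := hJ α
    rw [supercurrent, Finset.sum_add_distrib, ← Finset.smul_sum, ← Finset.smul_sum,
      sum_cliff_chi] at h
    have h' := congrArg (fun s => (1 / 2 : ℝ) • s) (eq_neg_of_add_eq_zero_left h)
    simp only [smul_smul, smul_neg] at h'
    rw [← one_smul ℝ (∑ β, _)]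
    convert h' using 1
    · norm_num
    · rw [← neg_smul]; congr 1; ring
  have h2 : ∀ α, F.psiSq a c x * (inner ℝ (F.qchi a α x) (P α) : ℝ)
      = ∑ β, F.pair c x (fun i => F.dphi a c β i x • (cliff α * cliff β * P α))
        (fun i => F.psi a c i x) := by
    intro α
    have h3 : F.psiSq a c x * (inner ℝ (F.qchi a α x) (P α) : ℝ)
        = inner ℝ (P α) (F.psiSq a c x • F.qchi a α x) := by
      rw [inner_smul_right, real_inner_comm]
    rw [h3, ← h1, inner_sum]
    refine Finset.sum_congr rfl fun β _ => ?_
    rw [contract, ← pair_smul_spinor, ← pair_cliff_cliff_mul]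
    simp only [mul_smul_comm]
  -- By e_α·e_β = -2δ_{αβ} - e_β·e_α and e_α·P^α = 0, the sum over α of e_α·e_β·P^α is -2P^β; this
  -- is the source of the factor -2.
  rw [Finset.mul_sum]
  simp only [h2, Fin.sum_univ_two, hP, tensorDphi]
  have e0 : ∀ s : ℍ[ℝ], cliff 0 * cliff 0 * s = -s := fun s => by simp [cliff_sq]
  have e1 : ∀ s : ℍ[ℝ], cliff 1 * cliff 1 * s = -s := fun s => by simp [cliff_sq]
  simp only [e0, e1, cliff_one_mul_zero, neg_mul, mul_neg, neg_neg, smul_neg, pair_neg_left,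
    volume_mul_volume_mul]
  ring

end Gravitino

end Fields

namespace Fields

/-! ### Algebraic consequences of criticality: normal form, symmetry and trace of T. -/

section Critical

variable {M : Type*} [TopologicalSpace M] [ChartedSpace (EuclideanSpace ℝ (Fin 2)) M]
  [IsManifold (𝓡 2) ∞ M] {ι : Type*} {g : RMetric 2 M} {σ : SpinStructure ι g}
  {n : ℕ} {N : Type*} [TopologicalSpace N] [ChartedSpace (EuclideanSpace ℝ (Fin n)) N]
  [IsManifold (𝓡 n) ∞ N] {h : RMetric n N}

variable {F : Fields σ h} {a : ι} {c : OpenPartialHomeomorph N (EuclideanSpace ℝ (Fin n))}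
  (hF : F.IsCritical) (hc : c ∈ IsManifold.maximalAtlas (𝓡 n) ∞ N) {x : M} (hx : x ∈ F.dom a c)

include hc hx in
-- Multiplication by e_0·e_1 is skew-adjoint while the remaining factor is symmetric under p ↔ r, q
-- ↔ s by pair symmetry, so the sum equals its own negative.
lemma pair_SR_volume_mul : F.pair c x (fun i => F.SR a c i x)
    (fun i => cliff 0 * cliff 1 * F.psi a c i x) = 0 := by
  have h1 : ∀ s t : ℍ[ℝ], (inner ℝ s (cliff 0 * cliff 1 * t) : ℝ)
      = -inner ℝ t (cliff 0 * cliff 1 * s) := fun s t => by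
    rw [real_inner_comm, inner_cliff_cliff_mul, cliff_one_mul_zero, neg_mul, inner_neg_right]
  have h2 := F.pair_SR (a := a) (c := c) x (fun i => cliff 0 * cliff 1 * F.psi a c i x)
  have h4 : ∀ p q r s, riemLow h c r s p q (F.yφ c x)
      * ((inner ℝ (F.psi a c p x) (cliff 0 * cliff 1 * F.psi a c r x) : ℝ)
        * inner ℝ (F.psi a c s x) (F.psi a c q x))
      = -(riemLow h c p q r s (F.yφ c x)
      * ((inner ℝ (F.psi a c r x) (cliff 0 * cliff 1 * F.psi a c p x) : ℝ)
        * inner ℝ (F.psi a c q x) (F.psi a c s x))) := fun p q r s => by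
    rw [riemLow_pair_symm h hc (yφ_mem hx) r s p q, h1 (F.psi a c p x),
      real_inner_comm (F.psi a c q x)]
    ring
  have h3 := (h2.trans (sum_four_swap_pairs _)).trans (Finset.sum_congr rfl fun p _ =>
    Finset.sum_congr rfl fun q _ => Finset.sum_congr rfl fun r _ =>
      Finset.sum_congr rfl fun s _ => h4 p q r s)
  simp only [Finset.sum_neg_distrib] at h3
  linarith

include hF hc hx in
/-- The Euler-Lagrange equation for `ψ`, paired with a vector spinor. -/
lemma pair_dirac (t : Fin n → ℍ[ℝ]) : F.pair c x (fun i => F.dirac a c i x) t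
    = F.qchiSq a x * F.pair c x (fun i => F.psi a c i x) t
      + (1 / 3) * F.pair c x (fun i => F.SR a c i x) t
      + 2 * ∑ α, F.pair c x (fun i => F.tensorDphi a c (F.qchi a α x) α x i) t := by
  have h1 : ∀ i, F.dirac a c i x = F.qchiSq a x • F.psi a c i x + (1 / 3 : ℝ) • F.SR a c i x
      + (2 : ℝ) • F.qchiPush a c i x := fun i => (hF.1 a c hc x hx.1 hx.2 i).2
  simp only [h1, pair_add_left, pair_smul_left, qchiPush, pair_sum_left]

lemma pair_psi_dirac : F.pair c x (fun i => F.psi a c i x) (fun i => F.dirac a c i x)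
    = ∑ α, F.tensorW a c α α x := by
  simp only [dirac, pair_sum_right, tensorW]

include hF hc hx in
lemma psiSq_mul_qchiSq :
    F.psiSq a c x * F.qchiSq a x = -2 * ∑ α, F.tensorZ a c α α x :=
  psiSq_mul_inner_qchi (hF.2 a c hc x hx.1 hx.2) (fun α => F.qchi a α x) (qchi_one x)

lemma volume_mul_qchi_zero (x : M) : cliff 0 * cliff 1 * F.qchi a 0 x = -F.qchi a 1 x := by
  rw [qchi_one]; simp

lemma volume_mul_qchi_one (x : M) : cliff 0 * cliff 1 * F.qchi a 1 x = F.qchi a 0 x := by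
  rw [qchi_one, neg_mul, mul_neg, volume_mul_volume_mul, neg_neg]

include hF hc hx in
-- The test gravitino is e_0·e_1·Qχ: it is again γ-traceless and pointwise orthogonal to Qχ, so the
-- left side of the supercurrent identity vanishes.
lemma tensorZ_comm : F.tensorZ a c 0 1 x = F.tensorZ a c 1 0 x := by
  have h1 := psiSq_mul_inner_qchi (hF.2 a c hc x hx.1 hx.2)
    (fun α => cliff 0 * cliff 1 * F.qchi a α x) (by
      simp only [volume_mul_qchi_one, volume_mul_qchi_zero, neg_mul, mul_neg, neg_neg])
  simp only [Fin.sum_univ_two, volume_mul_qchi_one, volume_mul_qchi_zero, tensorDphi, smul_neg,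
    pair_neg_left, inner_neg_right, real_inner_comm (F.qchi a 0 x)] at h1
  simp only [tensorZ, tensorDphi]
  linarith

include hF hc hx in
-- In the Dirac equation paired with ψ, the terms |Qχ|²|ψ|² and 2 tr Z cancel by `psiSq_mul_qchiSq`.
lemma sum_tensorW : ∑ α, F.tensorW a c α α x = (1 / 3) * F.RmPsi a c x := by
  have h1 := psiSq_mul_qchiSq hF hc hx
  have h2 := pair_dirac hF hc hx (fun i => F.psi a c i x)
  rw [pair_comm, pair_psi_dirac] at h2
  change _ = F.qchiSq a x * F.psiSq a c x + (1 / 3) * F.RmPsi a c x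
    + 2 * ∑ α, F.tensorZ a c α α x at h2
  linarith

include hF hc hx in
-- The Dirac equation paired with e_0·e_1·ψ expresses W_{01} - W_{10} through three terms: those in
-- ψ and SR(ψ) vanish by skewness, and the gravitino term is a multiple of Z_{01} - Z_{10}.
lemma tensorW_comm : F.tensorW a c 0 1 x = F.tensorW a c 1 0 x := by
  have h1 : F.pair c x (fun i => cliff 0 * cliff 1 * F.psi a c i x) (fun i => F.dirac a c i x)
      = F.tensorW a c 0 1 x - F.tensorW a c 1 0 x := by
    have h : ∀ i, cliff 0 * cliff 1 * F.dirac a c i x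
        = cliff 1 * F.nablaPsi a c 0 i x - cliff 0 * F.nablaPsi a c 1 i x := fun i => by
      simp only [dirac, Fin.sum_univ_two]
      ext <;> simp <;> ring
    simp only [pair_volume_mul, h, pair_sub_right, tensorW]
    ring
  have h2 : ∀ α (s : ℍ[ℝ]), F.pair c x (fun i => F.tensorDphi a c s α x i)
      (fun i => cliff 0 * cliff 1 * F.psi a c i x)
      = -F.pair c x (fun i => F.tensorDphi a c (cliff 0 * cliff 1 * s) α x i)
        (fun i => F.psi a c i x) := fun α s => by
    simp only [tensorDphi, ← mul_smul_comm, pair_volume_mul, neg_neg]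
  have h3 := pair_dirac hF hc hx (fun i => cliff 0 * cliff 1 * F.psi a c i x)
  rw [pair_comm, h1, pair_SR_volume_mul hc hx, pair_volume_mul_self] at h3
  simp only [h2, Fin.sum_univ_two, volume_mul_qchi_one, volume_mul_qchi_zero] at h3
  have h4 := tensorZ_comm hF hc hx
  simp only [tensorZ] at h4
  simp only [tensorDphi, smul_neg, pair_neg_left] at h3 h4
  linarith

/-- The energy-momentum tensor of critical fields. -/
def criticalT (F : Fields σ h) (a : ι) (c : OpenPartialHomeomorph N (EuclideanSpace ℝ (Fin n)))
    (α β : Fin 2) (x : M) : ℝ :=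
  2 * F.dphiInner a c α β x + F.tensorW a c α β x - 4 * F.tensorZ a c α β x
    + (if α = β then 1 else 0)
      * (2 * (∑ η, F.tensorZ a c η η x) - F.dphiSq a c x - (1 / 6) * F.RmPsi a c x)

lemma pair_tensorDphi_sum_cliff_chi (α β : Fin 2) (x : M) :
    F.pair c x (fun i => F.tensorDphi a c (∑ η, cliff η * cliff α * F.chi a η x) β x i)
      (fun i => F.psi a c i x) = -2 * F.tensorZ a c α β x := by
  rw [sum_cliff_chi]
  simp only [tensorZ, tensorDphi, smul_comm _ (-2 : ℝ), pair_smul_left]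

lemma dphiInner_comm (α β : Fin 2) (x : M) :
    F.dphiInner a c α β x = F.dphiInner a c β α x := F.hInner_comm c x _ _

include hF hc hx in
lemma T_eq_criticalT (α β : Fin 2) : F.T a c α β x = F.criticalT a c α β x := by
  have h1 : F.T a c α β x = 2 * F.dphiInner a c α β x - F.dphiSq a c x * (if α = β then 1 else 0)
      + (1 / 2) * (F.tensorW a c α β x + F.tensorW a c β α x)
      - (∑ η, F.tensorW a c η η x) * (if α = β then 1 else 0)
      + (-2 * F.tensorZ a c α β x + -2 * F.tensorZ a c β α x)
      + 4 * (∑ η, F.tensorZ a c η η x) * (if α = β then 1 else 0)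
      + F.psiSq a c x * F.qchiSq a x * (if α = β then 1 else 0)
      + (1 / 6) * F.RmPsi a c x * (if α = β then 1 else 0) := by
    simp only [T, pair_psi_dirac, pair_add_left, pair_add_right, pair_tensorDphi_sum_cliff_chi,
      qchiPush, pair_sum_left, mul_comm (F.psiSq a c x)]
    rfl
  rw [h1, psiSq_mul_qchiSq hF hc hx, sum_tensorW hF hc hx, criticalT]
  have h2 := tensorW_comm hF hc hx
  have h3 := tensorZ_comm hF hc hx
  fin_cases α <;> fin_cases β <;> simp [h2, h3] <;> ring

include hF hc hx in
lemma T₂_eq_criticalT (α β : Fin 2) : F.T₂ a c α β x = F.criticalT a c α β x := by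
  have h1 : F.T₂ a c α β x = 2 * F.dphiInner a c α β x - F.dphiSq a c x * (if α = β then 1 else 0)
      + F.tensorW a c α β x - (1 / 2) * (∑ η, F.tensorW a c η η x) * (if α = β then 1 else 0)
      + 2 * (-2 * F.tensorZ a c α β x)
      - (∑ η, -2 * F.tensorZ a c η η x) * (if α = β then 1 else 0) := by
    simp only [T₂, pair_psi_dirac, pair_tensorDphi_sum_cliff_chi, pair_sum_left]
    rfl
  rw [h1, sum_tensorW hF hc hx, criticalT, ← Finset.mul_sum]
  ring

include hF hc hx in
lemma criticalT_comm (α β : Fin 2) : F.criticalT a c α β x = F.criticalT a c β α x := by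
  have h2 := tensorW_comm hF hc hx
  have h3 := tensorZ_comm hF hc hx
  fin_cases α <;> fin_cases β <;> simp [criticalT, h2, h3, dphiInner_comm 0 1]

include hF hc hx in
lemma sum_criticalT : ∑ α, F.criticalT a c α α x = 0 := by
  have h1 := sum_tensorW hF hc hx
  rw [Fin.sum_univ_two] at h1
  simp only [criticalT, dphiSq, Fin.sum_univ_two, if_true]
  linarith

include hc in
lemma smooth_criticalT (α β : Fin 2) : SmoothOn (F.dom a c) (F.criticalT a c α β) := by
  have hC : ∀ b : ℝ, SmoothOn (F.dom a c) fun _ => b := fun b => contMDiffOn_const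
  exact ((((hC 2).mul (smooth_dphiInner hc α β)).fun_add (smooth_tensorW hc α β)).fun_sub
    ((hC 4).mul (smooth_tensorZ hc α β))).fun_add ((hC _).mul ((((hC 2).mul
      (SmoothOn.sum _ fun η => smooth_tensorZ hc η η)).fun_sub
      (SmoothOn.sum _ fun η => smooth_dphiInner hc η η)).fun_sub ((hC _).mul (smooth_RmPsi hc))))

include hF hc hx in
-- Criticality holds at every point of an open set, so the normal form may also be used under
-- derivatives.
lemma T_eventuallyEq (α β : Fin 2) : F.T a c α β =ᶠ[𝓝 x] F.criticalT a c α β :=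
  Filter.eventually_of_mem ((F.isOpen_dom a c).mem_nhds hx) fun _ hp =>
    T_eq_criticalT hF hc hp α β

end Critical

end Fields

namespace Fields

/-! ### Vanishing of the divergence. -/

section Divergence

variable {M : Type*} [TopologicalSpace M] [ChartedSpace (EuclideanSpace ℝ (Fin 2)) M]
  [IsManifold (𝓡 2) ∞ M] {ι : Type*} {g : RMetric 2 M} {σ : SpinStructure ι g}
  {n : ℕ} {N : Type*} [TopologicalSpace N] [ChartedSpace (EuclideanSpace ℝ (Fin n)) N]
  [IsManifold (𝓡 n) ∞ N] {h : RMetric n N}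

variable {F : Fields σ h} {a : ι} {c : OpenPartialHomeomorph N (EuclideanSpace ℝ (Fin n))}
  (hF : F.IsCritical) (hc : c ∈ IsManifold.maximalAtlas (𝓡 n) ∞ N) {x : M} (hx : x ∈ F.dom a c)

include hx in
lemma dir_qchiSq (β : Fin 2) : dir (F.qchiSq a) x (σ.e a β x)
    = 2 * ∑ α, (inner ℝ (F.qchi a α x) (F.nablaQ a β α x) : ℝ) := by
  have hq := fun α => mdiff (smooth_qchi (F := F) (a := a) (c := c) α) hx
  have h1 : dir (F.qchiSq a) x (σ.e a β x)
      = ∑ α, 2 * (inner ℝ (F.qchi a α x) (σ.nablaS a β (F.qchi a α) x) : ℝ) := by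
    unfold qchiSq
    rw [dir_sum _ _ fun α => mdiff ((smooth_qchi (c := c) α).inner (smooth_qchi α)) hx]
    refine Finset.sum_congr rfl fun α _ => ?_
    rw [σ.dir_inner_nablaS a β (hq α) (hq α), real_inner_comm]
    ring
  rw [h1]
  simp only [nablaQ, inner_sub_right, inner_smul_right, Fin.sum_univ_two, σ.conn_self,
    σ.conn_skew a β 1 0, inner_add_right, real_inner_comm (F.qchi a 0 x) (F.qchi a 1 x)]
  ring

include hc hx in
lemma dir_psiSq (β : Fin 2) : dir (F.psiSq a c) x (σ.e a β x)
    = 2 * F.pair c x (fun i => F.psi a c i x) (fun i => F.nablaPsi a c β i x) := by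
  have h1 := dir_pair hc hx β (smooth_psi (F := F) (a := a) hc) (smooth_psi hc)
  simp only [← nablaPsi_eq] at h1
  refine h1.trans ?_
  rw [pair_comm]
  ring

include hc hx in
lemma dir_sum_tensorW (β : Fin 2) : dir (fun p => ∑ α, F.tensorW a c α α p) x (σ.e a β x)
    = F.pair c x (fun i => F.dirac a c i x) (fun i => F.nablaPsi a c β i x)
      + ∑ α, F.pair c x (fun i => F.psi a c i x) (fun i => cliff α * F.hessψ a c β α i x) := by
  rw [dir_trace (fun α => mdiff (smooth_tensorW hc α α) hx)]
  simp only [covTensor_tensorW hc hx, Finset.sum_add_distrib]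
  rw [pair_comm F c x (fun i => F.dirac a c i x)]
  simp only [dirac, pair_sum_right]

include hc hx in
lemma dir_sum_tensorZ (β : Fin 2) : dir (fun p => ∑ α, F.tensorZ a c α α p) x (σ.e a β x)
    = ∑ α, F.pair c x (fun i => F.tensorDphi a c (F.nablaQ a β α x) α x i)
        (fun i => F.psi a c i x)
      + ∑ α, F.pair c x (fun i => F.hessφ a c α β i x • F.qchi a α x) (fun i => F.psi a c i x)
      + ∑ α, F.pair c x (fun i => F.tensorDphi a c (F.qchi a α x) α x i)
        (fun i => F.nablaPsi a c β i x) := by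
  rw [dir_trace (fun α => mdiff (smooth_tensorZ hc α α) hx)]
  simp only [covTensor_tensorZ hc hx, Finset.sum_add_distrib, hessφ_comm hc hx β]

include hc hx in
lemma dir_dphiSq (β : Fin 2) : dir (F.dphiSq a c) x (σ.e a β x)
    = 2 * ∑ α, F.hInner c x (fun i => F.dphi a c α i x) (fun i => F.hessφ a c α β i x) := by
  unfold dphiSq
  rw [dir_trace (fun α => mdiff (smooth_dphiInner hc α α) hx), Finset.mul_sum]
  refine Finset.sum_congr rfl fun α _ => ?_
  rw [dir_dphiInner hc hx, hInner_comm]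
  simp only [hessφ_comm hc hx β]
  ring

include hF hc hx in
/-- The Euler-Lagrange equation for `φ`, paired with `φ_* e_β`. -/
lemma hInner_tension (β : Fin 2) :
    F.hInner c x (fun i => F.tension a c i x) (fun i => F.dphi a c β i x)
      = (1 / 2) * F.hInner c x (fun i => F.RmDphi a c i x) (fun i => F.dphi a c β i x)
        - (1 / 12) * F.nablaRmPsi a c β x
        + 2 * ∑ α, F.pair c x (fun i => F.tensorDphi a c (F.nablaQ a α α x) β x i)
          (fun i => F.psi a c i x)
        + 2 * ∑ α, F.pair c x (fun i => F.tensorDphi a c (F.qchi a α x) β x i)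
          (fun i => F.nablaPsi a c α i x) := by
  have h1 : ∀ i, F.tension a c i x = (1 / 2) * F.RmDphi a c i x - (1 / 12) * F.SNablaR a c i x
      + (2 * ∑ α, (inner ℝ (F.nablaQ a α α x) (F.psi a c i x) : ℝ)
        + 2 * ∑ α, (inner ℝ (F.qchi a α x) (F.nablaPsi a c α i x) : ℝ)) := fun i => by
    rw [(hF.1 a c hc x hx.1 hx.2 i).1, divXi_eq hx]
    simp only [xi_eq, inner_smul_left, conj_trivial, ← Finset.mul_sum, sum_inner]
    ring
  simp only [h1, hInner_add_left, hInner_sub_left, hInner_smul_left, hInner_sum_left,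
    hInner_SNablaR hc hx, hInner_inner_left, tensorDphi]
  ring

/-- e_α·e_0·e_1 is, up to sign, the other generator, hence skew-adjoint. This removes the curvature
of M from the divergence. -/
lemma pair_cliff_mul_volume_mul (α : Fin 2) (s : Fin n → ℍ[ℝ]) :
    F.pair c x s (fun i => cliff α * (cliff 0 * cliff 1 * s i)) = 0 := by
  have h0 : ∀ s : ℍ[ℝ], cliff 0 * (cliff 0 * cliff 1 * s) = -(cliff 1 * s) := fun s => by
    ext <;> simp
  have h1 : ∀ s : ℍ[ℝ], cliff 1 * (cliff 0 * cliff 1 * s) = cliff 0 * s := fun s => by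
    ext <;> simp
  fin_cases α
  · simp [h0, pair_neg_right, pair_cliff_mul_self]
  · simp [h1, pair_cliff_mul_self]

include hc hx in
/-- The Weitzenböck-type identity for commuting the covariant derivatives of `ψ`. -/
lemma sum_pair_hessψ (β : Fin 2) :
    ∑ α, F.pair c x (fun i => F.psi a c i x) (fun i => cliff α * F.hessψ a c α β i x)
      = ∑ α, F.pair c x (fun i => F.psi a c i x) (fun i => cliff α * F.hessψ a c β α i x)
        - F.hInner c x (fun i => F.RmDphi a c i x) (fun i => F.dphi a c β i x) := by
  rw [sub_eq_add_neg, ← sum_pair_pullCurv hc hx β, ← Finset.sum_add_distrib]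
  refine Finset.sum_congr rfl fun α _ => ?_
  obtain ⟨b, hb⟩ := hessψ_sub_hessψ hc hx α β
  have h1 : ∀ i, cliff α * F.hessψ a c α β i x = cliff α * F.hessψ a c β α i x
      + (b • (cliff α * (cliff 0 * cliff 1 * F.psi a c i x))
        + cliff α * ∑ k, F.pullCurv a c α β i k x • F.psi a c k x) := fun i => by
    rw [eq_add_of_sub_eq' (hb i), mul_add, mul_add, mul_smul_comm]
  simp only [h1, pair_add_right, pair_smul_right, pair_cliff_mul_volume_mul, mul_zero, zero_add]

include hc hx in
lemma covTensor_criticalT (γ α β : Fin 2) : covTensor σ a γ (F.criticalT a c) α β x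
    = 2 * covTensor σ a γ (F.dphiInner a c) α β x + covTensor σ a γ (F.tensorW a c) α β x
      - 4 * covTensor σ a γ (F.tensorZ a c) α β x
      + (if α = β then 1 else 0) * (2 * dir (fun p => ∑ η, F.tensorZ a c η η p) x (σ.e a γ x)
        - dir (F.dphiSq a c) x (σ.e a γ x) - (1 / 6) * dir (F.RmPsi a c) x (σ.e a γ x)) := by
  have hC : ∀ b : ℝ, SmoothOn (F.dom a c) fun _ => b := fun b => contMDiffOn_const
  have hK := smooth_dphiInner (F := F) (a := a) hc
  have hW := smooth_tensorW (F := F) (a := a) hc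
  have hZ := smooth_tensorZ (F := F) (a := a) hc
  have hR := smooth_RmPsi (F := F) (a := a) hc
  have hS := SmoothOn.sum Finset.univ fun η => hZ η η
  have hD : SmoothOn (F.dom a c) (F.dphiSq a c) := SmoothOn.sum Finset.univ fun η => hK η η
  have h1 : dir (F.criticalT a c α β) x (σ.e a γ x)
      = 2 * dir (F.dphiInner a c α β) x (σ.e a γ x) + dir (F.tensorW a c α β) x (σ.e a γ x)
      - 4 * dir (F.tensorZ a c α β) x (σ.e a γ x)
      + (if α = β then 1 else 0) * (2 * dir (fun p => ∑ η, F.tensorZ a c η η p) x (σ.e a γ x)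
        - dir (F.dphiSq a c) x (σ.e a γ x) - (1 / 6) * dir (F.RmPsi a c) x (σ.e a γ x)) := by
    have hf := (((hC 2).mul hS).fun_sub hD).fun_sub ((hC (1 / 6)).mul hR)
    unfold criticalT
    rw [dir_add _ (mdiff ((((hC 2).mul (hK α β)).fun_add (hW α β)).fun_sub
        ((hC 4).mul (hZ α β))) hx) (mdiff ((hC _).mul hf) hx),
      dir_sub _ (mdiff (((hC 2).mul (hK α β)).fun_add (hW α β)) hx)
        (mdiff ((hC 4).mul (hZ α β)) hx),
      dir_add _ (mdiff ((hC 2).mul (hK α β)) hx) (mdiff (hW α β) hx),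
      dir_const_mul 2 _ (mdiff (hK α β) hx), dir_const_mul 4 _ (mdiff (hZ α β) hx),
      dir_const_mul _ _ (mdiff hf hx),
      dir_sub _ (mdiff (((hC 2).mul hS).fun_sub hD) hx) (mdiff ((hC (1 / 6)).mul hR) hx),
      dir_sub _ (mdiff ((hC 2).mul hS) hx) (mdiff hD hx), dir_const_mul 2 _ (mdiff hS hx),
      dir_const_mul _ _ (mdiff hR hx)]
  rw [covTensor, h1]
  simp only [covTensor, criticalT, Fin.sum_univ_two]
  fin_cases α <;> fin_cases β <;> simp [σ.conn_self, σ.conn_skew a γ 1 0] <;> ring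

include hF hc hx in
-- The derivative of |ψ|²|Qχ|² = -2 tr Z contains |ψ|²⟨Qχ, ∇_βQχ⟩, which the supercurrent tested
-- with the γ-traceless ∇_βQχ rewrites as a pairing with ψ.
lemma dir_sum_tensorZ_eq (β : Fin 2) :
    2 * dir (fun p => ∑ α, F.tensorZ a c α α p) x (σ.e a β x)
      = -2 * F.qchiSq a x
          * F.pair c x (fun i => F.psi a c i x) (fun i => F.nablaPsi a c β i x)
        + 4 * ∑ α, F.pair c x (fun i => F.tensorDphi a c (F.nablaQ a β α x) α x i)
          (fun i => F.psi a c i x) := by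
  have hp : SmoothOn (F.dom a c) (F.psiSq a c) := smooth_pair hc (smooth_psi hc) (smooth_psi hc)
  have hq : SmoothOn (F.dom a c) (F.qchiSq a) :=
    SmoothOn.sum _ fun α => (smooth_qchi (c := c) α).inner (smooth_qchi α)
  have hS := SmoothOn.sum Finset.univ fun η => smooth_tensorZ (F := F) (a := a) hc η η
  have h1 : (fun p => F.psiSq a c p * F.qchiSq a p)
      =ᶠ[𝓝 x] fun p => -2 * ∑ α, F.tensorZ a c α α p :=
    Filter.eventually_of_mem ((F.isOpen_dom a c).mem_nhds hx) fun p hp =>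
      psiSq_mul_qchiSq hF hc hp
  have h2 := dir_congr (σ.e a β x) h1
  rw [dir_mul _ (mdiff hp hx) (mdiff hq hx), dir_const_mul _ _ (mdiff hS hx), dir_psiSq hc hx,
    dir_qchiSq hx] at h2
  have h3 := psiSq_mul_inner_qchi (hF.2 a c hc x hx.1 hx.2) (fun α => F.nablaQ a β α x)
    (nablaQ_one hx β)
  linarith

include hF hc hx in
lemma dir_sum_tensorW_eq (β : Fin 2) :
    dir (fun p => ∑ α, F.tensorW a c α α p) x (σ.e a β x)
      = (1 / 3) * dir (F.RmPsi a c) x (σ.e a β x) := by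
  have h1 : (fun p => ∑ α, F.tensorW a c α α p) =ᶠ[𝓝 x] fun p => (1 / 3) * F.RmPsi a c p :=
    Filter.eventually_of_mem ((F.isOpen_dom a c).mem_nhds hx) fun p hp => sum_tensorW hF hc hp
  rw [dir_congr _ h1, dir_const_mul _ _ (mdiff (smooth_RmPsi hc) hx)]

include hF hc hx in
/-- The energy-momentum tensor of critical fields is divergence-free. -/
lemma sum_covTensor_criticalT (β : Fin 2) :
    ∑ α, covTensor σ a α (F.criticalT a c) α β x = 0 := by
  have h1 : ∑ α, covTensor σ a α (F.criticalT a c) α β x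
      = 2 * ∑ α, covTensor σ a α (F.dphiInner a c) α β x
        + ∑ α, covTensor σ a α (F.tensorW a c) α β x
        - 4 * ∑ α, covTensor σ a α (F.tensorZ a c) α β x
        + (2 * dir (fun p => ∑ η, F.tensorZ a c η η p) x (σ.e a β x)
        - dir (F.dphiSq a c) x (σ.e a β x) - (1 / 6) * dir (F.RmPsi a c) x (σ.e a β x)) := by
    simp only [covTensor_criticalT hc hx, Finset.sum_add_distrib, Finset.sum_sub_distrib,
      Finset.mul_sum, ite_mul, one_mul, zero_mul, Finset.sum_ite_eq', Finset.mem_univ, if_true]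
  have hK : ∑ α, covTensor σ a α (F.dphiInner a c) α β x
      = F.hInner c x (fun i => F.tension a c i x) (fun i => F.dphi a c β i x)
        + ∑ α, F.hInner c x (fun i => F.dphi a c α i x) (fun i => F.hessφ a c α β i x) := by
    simp only [dir_dphiInner hc hx, Finset.sum_add_distrib, tension_eq, hInner_sum_left]
  have hW : ∑ α, covTensor σ a α (F.tensorW a c) α β x
      = -F.pair c x (fun i => F.dirac a c i x) (fun i => F.nablaPsi a c β i x)
        + ∑ α, F.pair c x (fun i => F.psi a c i x)
          (fun i => cliff α * F.hessψ a c α β i x) := by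
    simp only [covTensor_tensorW hc hx, Finset.sum_add_distrib, dirac, pair_sum_left,
      pair_cliff_mul, Finset.sum_neg_distrib, neg_neg]
  have hZ : ∑ α, covTensor σ a α (F.tensorZ a c) α β x
      = ∑ α, F.pair c x (fun i => F.tensorDphi a c (F.nablaQ a α α x) β x i)
          (fun i => F.psi a c i x)
        + ∑ α, F.pair c x (fun i => F.hessφ a c α β i x • F.qchi a α x) (fun i => F.psi a c i x)
        + ∑ α, F.pair c x (fun i => F.tensorDphi a c (F.qchi a α x) β x i)
          (fun i => F.nablaPsi a c α i x) := by
    simp only [covTensor_tensorZ hc hx, Finset.sum_add_distrib]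
  -- The derivative of tr W is known in two ways, from its definition and from tr W = Rm(ψ)/3;
  -- comparing them eliminates the second derivatives of ψ. The two formulas for d(tr Z) likewise
  -- eliminate ∇dφ from the gravitino terms.
  have hWd := dir_sum_tensorW hc hx (F := F) (a := a) β
  rw [dir_sum_tensorW_eq hF hc hx] at hWd
  have hZd := dir_sum_tensorZ_eq hF hc hx β
  have hZd' := dir_sum_tensorZ hc hx (F := F) (a := a) β
  have hD := pair_dirac hF hc hx (fun i => F.nablaPsi a c β i x)
  rw [h1, hK, hW, hZ, hInner_tension hF hc hx, sum_pair_hessψ hc hx, dir_dphiSq hc hx]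
  have hRm := dir_RmPsi hc hx (F := F) (a := a) β
  -- The terms with ∇_αQχ^α and ∇_αψ from 2τ(φ) cancel those of -4 div Z. The quartic terms sum to
  -- zero because 1/3 - 1/6 = 1/6 and 4/6 = 2/3.
  linarith

include hF hc hx in
lemma divT_eq_zero (β : Fin 2) : F.divT a c β x = 0 := by
  rw [← sum_covTensor_criticalT hF hc hx β]
  refine Finset.sum_congr rfl fun α _ => ?_
  simp only [covTensor, dir_congr _ (T_eventuallyEq hF hc hx α β), T_eq_criticalT hF hc hx]

end Divergence

end Fields

end SigmaModel

end

theorem mainTheorem6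
    {M : Type*} [TopologicalSpace M] [T2Space M] [CompactSpace M]
    [ChartedSpace (EuclideanSpace ℝ (Fin 2)) M] [IsManifold (𝓡 2) ∞ M]
    (g : SigmaModel.RMetric 2 M) {ι : Type*} (σ : SigmaModel.SpinStructure ι g)
    {n : ℕ} {N : Type*} [TopologicalSpace N] [T2Space N] [CompactSpace N]
    [ChartedSpace (EuclideanSpace ℝ (Fin n)) N] [IsManifold (𝓡 n) ∞ N]
    (h : SigmaModel.RMetric n N)
    (F : SigmaModel.Fields σ h) (hF : F.IsCritical)
    (a : ι) (c : OpenPartialHomeomorph N (EuclideanSpace ℝ (Fin n)))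
    (hc : c ∈ IsManifold.maximalAtlas (𝓡 n) ∞ N) (x : M) (hx : x ∈ σ.U a)
    (hφx : F.φ x ∈ c.source) :
    (∀ α β, F.T a c α β x = F.T₂ a c α β x) ∧
    (∀ α β, F.T a c α β x = F.T a c β α x) ∧
    ∑ α, F.T a c α α x = 0 ∧
    (∀ α β, MDifferentiableAt (𝓡 2) 𝓘(ℝ, ℝ) (F.T a c α β) x) ∧
    ∀ β, F.divT a c β x = 0 := by
  have hx' : x ∈ F.dom a c := ⟨hx, hφx⟩
  have hT := fun α β => SigmaModel.Fields.T_eq_criticalT hF hc hx' α β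
  refine ⟨fun α β => ?_, fun α β => ?_, ?_, fun α β => ?_,
    fun β => SigmaModel.Fields.divT_eq_zero hF hc hx' β⟩
  · rw [hT, SigmaModel.Fields.T₂_eq_criticalT hF hc hx']
  · rw [hT, hT, SigmaModel.Fields.criticalT_comm hF hc hx']
  · simp only [hT, SigmaModel.Fields.sum_criticalT hF hc hx']
  -- Differentiability ensures that the derivatives in `divT` are genuine and not the default value
  -- zero.
  · exact (SigmaModel.Fields.mdiff (SigmaModel.Fields.smooth_criticalT hc α β)
      hx').congr_of_eventuallyEq (SigmaModel.Fields.T_eventuallyEq hF hc hx' α β)
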